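/- **Theorem (Complexity of SolveMdp2).** Consider infinite-horizon discounted MDPs with finite non-empty state and action sets $\mathcal S,\mathcal A$ ($S=|\mathcal S|$, $A=|\mathcal A|$), rewards $r[s,a]\in[0,1]$, discount factor $\gamma\in[0,1)$ and transition probabilities $p(s'|s,a)$; put $\Gamma=(1-\gamma)^{-1}$. For $\pi:\mathcal S\to\mathcal A$ let $v^\pi[s]=\mathbb E[\sum_{t\ge0}\gamma^t r[s_t,a_t]\mid s_0=s,\ a_i=\pi[s_i]\ \forall i]$ and let $v^*[s]=\max_\pi v^\pi[s]$. The quantities $\mathcal S,\mathcal A,r,\gamma$ are known; $p$ is accessible only through a quantum generative model, a unitary $\mathcal O$ on $\mathbb C^{S}\otimes\mathbb C^{A}\otimes\mathbb C^{S}\otimes\mathbb C^{J}$ with $\mathcal O|s\rangle|a\rangle|0\rangle|0\rangle=|s\rangle|a\rangle\sum_{s'}\sqrt{p(s'|s,a)}\,|s'\rangle|\psi_{s',s,a}\rangle$ for some unit vectors $\psi_{s',s,a}\in\mathbb C^J$. A query is one use of $\mathcal O$ or $\mathcal O^{-1}$. For $\epsilon\in(0,\Gamma]$ and $\delta\in(0,1)$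 the algorithm SolveMdp2 sets $L=\lceil\Gamma\lceil\log(4\Gamma/\epsilon)\rceil\rceil+1$, $v_0=0$, takes an arbitrary policy $\pi_0$, and for $l=1,\dots,L$ and every $s\in\mathcal S$ runs a quantum routine which returns a pair $(a^*[s],\tilde v_l[s])$; then it sets $(v_l[s],\pi_l[s])=(\tilde v_l[s],a^*[s])$ if $\tilde v_l[s]\ge v_{l-1}[s]$ and $(v_l[s],\pi_l[s])=(v_{l-1}[s],\pi_{l-1}[s])$ otherwise. It outputs $\hat v=v_L$ and $\hat\pi=\pi_L$. The routine is called correct if, whenever $0\le v_{l-1}\le\Gamma$, with probability at least $1-\delta/(LS)$ its result satisfies $a^*[s]\in\operatorname{argmax}_a q_{l-1,s}[a]$ and $\tilde v_l[s]=q_{l-1,s}[a^*[s]]$ for some vector $q_{l-1,s}\in\mathbb R^{\mathcal A}$ of the following form: $q_{0,s}=0$, and for $l\ge2$, $q_{l-1,s}[a]=\max\{r[s,a]+\gamma z[a],0\}$, where $z[a]+(1-\gamma)\epsilon/4$ is, for every $a$, an estimate of $\sum_{s'}p(s'|s,a)v_{l-1}[s']$ with error less than $(1-\gamma)\epsilon/4$.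 There is a universal constant $C$ such that for all $\mathcal S,\mathcal A,r,\gamma,J,\epsilon,\delta$ as above there is an implementation of this routine by quantum query circuits, not depending on $p$ or $\mathcal O$, such that for every $p$ and every quantum generative model $\mathcal O$ of $p$ the routine is correct and, for every $\pi_0$, 1. SolveMdp2 always makes at most $$C\,S\sqrt A\,\Gamma^3\,\epsilon^{-1}\,\log^2(2\Gamma/\epsilon)\,\log(2SA\Gamma/\delta)$$ queries; 2. with probability at least $1-\delta$, $\;v^*-\epsilon\le\hat v\le v^{\hat\pi}\le v^*$ entrywise. In particular, the query complexity is $O\big(S\sqrt A\,\Gamma^3\epsilon^{-1}\log^2(\Gamma/\epsilon)\log(SA\Gamma/\delta)\big)$ for $\epsilon\le\Gamma/2$ and $\delta\le1/2$. -/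

import Mathlib

open MeasureTheory ProbabilityTheory
open scoped Kronecker

noncomputable section

namespace QMDP

/-! ### Markov decision processes -/

/-- The part of an infinite-horizon discounted MDP that is known to the agent: the rewards
`r[s, a] ∈ [0, 1]` and the discount factor `γ ∈ [0, 1)`.  The transition probabilities are kept
separate, as a function `p : 𝒮 → 𝒜 → PMF 𝒮`, because they are only accessible through the oracle. -/
structure RewardModel (𝒮 𝒜 : Type) where
  r : 𝒮 → 𝒜 → ℝ
  γ : ℝ
  r_nonneg : ∀ s a, 0 ≤ r s a
  r_le_one : ∀ s a, r s a ≤ 1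
  γ_nonneg : 0 ≤ γ
  γ_lt_one : γ < 1

/-- The effective time horizon `Γ = (1 - γ)⁻¹`. -/
def RewardModel.horizon {𝒮 𝒜 : Type} (M : RewardModel 𝒮 𝒜) : ℝ := (1 - M.γ)⁻¹

section Value

variable {𝒮 𝒜 : Type} [Fintype 𝒮] [MeasurableSpace 𝒮] [DiscreteMeasurableSpace 𝒮]

/-- One transition of the Markov chain that follows the policy `π`: from `x` to
`x' ∼ p(· | x, π x)`. -/
def policyKernel (p : 𝒮 → 𝒜 → PMF 𝒮) (π : 𝒮 → 𝒜) : Kernel 𝒮 𝒮 :=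
  Kernel.ofFunOfCountable fun x => (p x (π x)).toMeasure

instance policyKernel_isMarkov (p : 𝒮 → 𝒜 → PMF 𝒮) (π : 𝒮 → 𝒜) :
    IsMarkovKernel (policyKernel p π) :=
  ⟨fun x => PMF.toMeasure.isProbabilityMeasure (p x (π x))⟩

/-- The same transition, as a kernel from histories `(s₀, …, sₙ)` to the next state `sₙ₊₁`. -/
def historyKernel (p : 𝒮 → 𝒜 → PMF 𝒮) (π : 𝒮 → 𝒜) (n : ℕ) :
    Kernel ((i : Finset.Iic n) → (fun _ : ℕ => 𝒮) i) 𝒮 :=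
  (policyKernel p π).comap (fun h => h ⟨n, Finset.mem_Iic.2 le_rfl⟩) (measurable_pi_apply _)

instance historyKernel_isMarkov (p : 𝒮 → 𝒜 → PMF 𝒮) (π : 𝒮 → 𝒜) (n : ℕ) :
    IsMarkovKernel (historyKernel p π n) := by
  unfold historyKernel
  infer_instance

/-- The law of the state trajectory `(s₀, s₁, …)` when `s₀ = s` and `aᵢ = π sᵢ` for all `i`. -/
def trajectoryLaw (p : 𝒮 → 𝒜 → PMF 𝒮) (π : 𝒮 → 𝒜) (s : 𝒮) : Measure (ℕ → 𝒮) :=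
  Kernel.traj (X := fun _ : ℕ => 𝒮) (historyKernel p π) 0 (fun _ => s)

/-- The value `v^π[s] = 𝔼[∑ₜ γᵗ r[sₜ, aₜ] | s₀ = s, aᵢ = π sᵢ]` of the policy `π`. -/
def value (M : RewardModel 𝒮 𝒜) (p : 𝒮 → 𝒜 → PMF 𝒮) (π : 𝒮 → 𝒜) (s : 𝒮) : ℝ :=
  ∫ ω, ∑' t : ℕ, M.γ ^ t * M.r (ω t) (π (ω t)) ∂(trajectoryLaw p π s)

/-- The optimal value `v*[s] = max_π v^π[s]` (there are finitely many policies `𝒮 → 𝒜`). -/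
def optimalValue (M : RewardModel 𝒮 𝒜) (p : 𝒮 → 𝒜 → PMF 𝒮) (s : 𝒮) : ℝ :=
  ⨆ π : 𝒮 → 𝒜, value M p π s

end Value

/-! ### Quantum query circuits -/

section Quantum

variable {Q : Type} [Fintype Q] [DecidableEq Q]

/-- A quantum circuit with query access to an unknown unitary `U` on `ℂ^Q`.  It acts on
`ℂ^Q ⊗ ℂ^W` with `ℂ^W` a finite workspace, starts in a computational basis state, applies the
unitary `prep`, and then for each entry `(b, G)` of `steps` makes one query (to `U ⊗ 1` if
`b = false`, to `U⁻¹ ⊗ 1` if `b = true`) followed by the unitary `G`.  In the end it is measured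
in the computational basis, and the result is decoded by `readout`. -/
structure QueryCircuit (Q Out : Type) [Fintype Q] [DecidableEq Q] where
  W : Type
  [fintypeW : Fintype W]
  [decEqW : DecidableEq W]
  start : Q × W
  prep : Matrix.unitaryGroup (Q × W) ℂ
  steps : List (Bool × Matrix.unitaryGroup (Q × W) ℂ)
  readout : Q × W → Out

attribute [instance] QueryCircuit.fintypeW QueryCircuit.decEqW

/-- The number of oracle queries of a circuit. -/
def QueryCircuit.queries {Out : Type} (c : QueryCircuit Q Out) : ℕ := c.steps.length

/-- The operator `V ⊗ 1` on `ℂ^Q ⊗ ℂ^W`. -/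
def onQuery (W : Type) [Fintype W] [DecidableEq W] (V : Matrix.unitaryGroup Q ℂ) :
    Matrix.unitaryGroup (Q × W) ℂ :=
  ⟨(V : Matrix Q Q ℂ) ⊗ₖ (1 : Matrix W W ℂ),
    Matrix.kronecker_mem_unitary V.2 (one_mem _)⟩

/-- The unitary that the whole circuit implements when the oracle is `U`. -/
def QueryCircuit.evolution {Out : Type} (c : QueryCircuit Q Out) (U : Matrix.unitaryGroup Q ℂ) :
    Matrix.unitaryGroup (Q × c.W) ℂ :=
  c.steps.foldl (fun T g => g.2 * onQuery c.W (if g.1 then U⁻¹ else U) * T) c.prep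

/-- The amplitudes of the final state of the circuit. -/
def QueryCircuit.finalState {Out : Type} (c : QueryCircuit Q Out)
    (U : Matrix.unitaryGroup Q ℂ) : Q × c.W → ℂ :=
  (c.evolution U : Matrix (Q × c.W) (Q × c.W) ℂ).mulVec (Pi.single c.start 1)

theorem QueryCircuit.sum_born {Out : Type} (c : QueryCircuit Q Out)
    (U : Matrix.unitaryGroup Q ℂ) :
    ∑ i, ENNReal.ofReal (‖c.finalState U i‖ ^ 2) = 1 := by
  rw [← ENNReal.ofReal_sum_of_nonneg (fun i _ => sq_nonneg _), ← ENNReal.ofReal_one]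
  congr 1
  have h := congrFun (congrFun (Matrix.mem_unitaryGroup_iff'.1 (c.evolution U).2) c.start) c.start
  rw [Matrix.mul_apply] at h
  have h2 : ∀ i, ((‖c.finalState U i‖ ^ 2 : ℝ) : ℂ) =
      star (c.evolution U : Matrix (Q × c.W) (Q × c.W) ℂ) c.start i *
        (c.evolution U : Matrix (Q × c.W) (Q × c.W) ℂ) i c.start := by
    intro i
    have : c.finalState U i = (c.evolution U : Matrix (Q × c.W) (Q × c.W) ℂ) i c.start := by
      simp [QueryCircuit.finalState]
    rw [this, Matrix.star_apply]
    push_cast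
    exact (Complex.conj_mul' _).symm
  have h3 : ((∑ i, ‖c.finalState U i‖ ^ 2 : ℝ) : ℂ) = ((1 : ℝ) : ℂ) := by
    rw [Complex.ofReal_sum, Finset.sum_congr rfl (fun i _ => h2 i), h]
    simp
  exact_mod_cast h3

/-- The Born distribution of the computational basis measurement of the final state. -/
def QueryCircuit.measurement {Out : Type} (c : QueryCircuit Q Out)
    (U : Matrix.unitaryGroup Q ℂ) : PMF (Q × c.W) :=
  PMF.ofFintype (fun i => ENNReal.ofReal (‖c.finalState U i‖ ^ 2)) (c.sum_born U)

/-- The distribution of the decoded output of the circuit. -/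
def QueryCircuit.output {Out : Type} (c : QueryCircuit Q Out) (U : Matrix.unitaryGroup Q ℂ) :
    PMF Out :=
  (c.measurement U).map c.readout

/-- The joint distribution of the outputs of a finite family of circuits that are run
independently of each other. -/
def runAll {ι Out : Type} [Fintype ι] [DecidableEq ι] (c : ι → QueryCircuit Q Out)
    (U : Matrix.unitaryGroup Q ℂ) : PMF (ι → Out) :=
  (PMF.ofFintype (fun x : (i : ι) → Q × (c i).W => ∏ i, (c i).measurement U (x i)) (by
    have h := Finset.prod_univ_sum (fun i : ι => (Finset.univ : Finset (Q × (c i).W)))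
      (fun i y => (c i).measurement U y)
    rw [Fintype.piFinset_univ] at h
    rw [← h]
    refine Finset.prod_eq_one fun i _ => ?_
    rw [← tsum_fintype (L := .unconditional _)]
    exact ((c i).measurement U).tsum_coe)).map (fun x i => (c i).readout (x i))

end Quantum

/-! ### The quantum generative model -/

/-- The register `ℂ^𝒮 ⊗ ℂ^𝒜 ⊗ ℂ^𝒮 ⊗ ℂ^J` on which the oracle acts. -/
abbrev OracleReg (𝒮 𝒜 J : Type) : Type := 𝒮 × 𝒜 × 𝒮 × J

/-- `U` is a quantum generative model for `p`: for unit vectors `ψ_{s',s,a} ∈ ℂ^J`, it maps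
`|s⟩|a⟩|0⟩|0⟩` to `|s⟩|a⟩ ∑_{s'} √p(s'|s,a) |s'⟩|ψ_{s',s,a}⟩`.
Here `s₀` and `j₀` are the basis elements called `0`. -/
def IsGenerativeModel {𝒮 𝒜 J : Type} [Fintype 𝒮] [Fintype 𝒜] [Fintype J]
    [DecidableEq 𝒮] [DecidableEq 𝒜] [DecidableEq J] (p : 𝒮 → 𝒜 → PMF 𝒮) (s₀ : 𝒮) (j₀ : J)
    (U : Matrix.unitaryGroup (OracleReg 𝒮 𝒜 J) ℂ) : Prop :=
  ∃ ψ : 𝒮 → 𝒮 → 𝒜 → J → ℂ, (∀ s' s a, ∑ j, ‖ψ s' s a j‖ ^ 2 = 1) ∧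
    ∀ s a, (U : Matrix (OracleReg 𝒮 𝒜 J) (OracleReg 𝒮 𝒜 J) ℂ).mulVec
        (Pi.single (s, a, s₀, j₀) 1) =
      fun x => if x.1 = s ∧ x.2.1 = a then
        (Real.sqrt (p s a x.2.2.1).toReal : ℂ) * ψ x.2.2.1 s a x.2.2.2 else 0

/-! ### The algorithm SolveMdp2 -/

section Algorithm

variable {𝒮 𝒜 : Type} [Fintype 𝒮]

/-- The number of iterations `L = Γ ⌈log (4 Γ / ε)⌉ + 1`, rounded up to an integer. -/
def numIter (M : RewardModel 𝒮 𝒜) (ε : ℝ) : ℕ :=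
  ⌈M.horizon * ⌈Real.log (4 * M.horizon / ε)⌉₊⌉₊ + 1

/-- The accuracy `(1 - γ) ε / 4` of the mean estimates. -/
def accuracy (M : RewardModel 𝒮 𝒜) (ε : ℝ) : ℝ := (1 - M.γ) * ε / 4

/-- `z[a]` is, for every action `a`, an estimate of the mean `(P v)[s, a]` with error less than
`(1 - γ) ε / 4`, shifted down by `(1 - γ) ε / 4`. -/
def IsShiftedEstimate (M : RewardModel 𝒮 𝒜) (p : 𝒮 → 𝒜 → PMF 𝒮) (ε : ℝ) (v : 𝒮 → ℝ) (s : 𝒮)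
    (z : 𝒜 → ℝ) : Prop :=
  ∃ μ : 𝒜 → ℝ, (∀ a, |μ a - ∑ s', (p s a s').toReal * v s'| < accuracy M ε) ∧
    ∀ a, z a = μ a - accuracy M ε

/-- The possible vectors `q_{l-1,s}` at the start of iteration `l`, where `v = v_{l-1}`: the zero
vector if `l = 1`, and otherwise `q_{l-1,s}[a] = max {r[s,a] + γ z_{l-1,s}[a], 0}` with
`z_{l-1,s}` a vector of correct shifted mean estimates. -/
def IsQVector (M : RewardModel 𝒮 𝒜) (p : 𝒮 → 𝒜 → PMF 𝒮) (ε : ℝ) (l : ℕ) (v : 𝒮 → ℝ) (s : 𝒮)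
    (q : 𝒜 → ℝ) : Prop :=
  if l = 1 then q = 0
  else ∃ z, IsShiftedEstimate M p ε v s z ∧ ∀ a, q a = max (M.r s a + M.γ * z a) 0

/-- `(a*, w)` is a correct outcome of maximum finding in state `s` during iteration `l`:
`a*` is a maximizer of `q_{l-1,s}` and `w = q_{l-1,s}[a*]`. -/
def IsCorrectMax (M : RewardModel 𝒮 𝒜) (p : 𝒮 → 𝒜 → PMF 𝒮) (ε : ℝ) (l : ℕ) (v : 𝒮 → ℝ) (s : 𝒮)
    (out : 𝒜 × ℝ) : Prop :=
  ∃ q, IsQVector M p ε l v s q ∧ (∀ a, q a ≤ q out.1) ∧ out.2 = q out.1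

variable {Q : Type} [Fintype Q] [DecidableEq Q]

/-- Implementations of the quantum part of the algorithm: for the iteration `l`, the current
value vector `v_{l-1}` and a state `s`, a circuit that estimates the means, forms the vector
`q_{l-1,s}` and finds its maximum.  It outputs a maximizing action and the maximum. -/
abbrev MaxRoutine (𝒮 𝒜 Q : Type) [Fintype Q] [DecidableEq Q] : Type 1 :=
  ℕ → (𝒮 → ℝ) → 𝒮 → QueryCircuit Q (𝒜 × ℝ)

/-- The routine is correct, with failure probability at most `f` per call, for the oracle `U` of
an MDP with transition probabilities `p`, in all iterations `1, …, L` and for all value vectors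
with entries in `[0, Γ]`. -/
def MaxRoutine.Correct (R : MaxRoutine 𝒮 𝒜 Q) (M : RewardModel 𝒮 𝒜) (p : 𝒮 → 𝒜 → PMF 𝒮)
    (U : Matrix.unitaryGroup Q ℂ) (ε f : ℝ) : Prop :=
  ∀ l : ℕ, 1 ≤ l → l ≤ numIter M ε → ∀ v : 𝒮 → ℝ, (∀ s, 0 ≤ v s ∧ v s ≤ M.horizon) → ∀ s : 𝒮,
    ENNReal.ofReal (1 - f) ≤
      ((R l v s).output U).toOuterMeasure {out | IsCorrectMax M p ε l v s out}

/-- The classical data kept by the algorithm: the total number of oracle queries made so far, and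
the current `v_l` and `π_l`. -/
structure State (𝒮 𝒜 : Type) where
  queries : ℕ
  v : 𝒮 → ℝ
  π : 𝒮 → 𝒜

variable [DecidableEq 𝒮]

/-- One iteration: run the maximum finding routine in all states, then update by the
if-then-else rule, that is, replace `v[s]` and `π[s]` exactly where the new value is not smaller. -/
def iteration (R : MaxRoutine 𝒮 𝒜 Q) (U : Matrix.unitaryGroup Q ℂ) (l : ℕ) (x : State 𝒮 𝒜) :
    PMF (State 𝒮 𝒜) :=
  (runAll (R l x.v) U).map fun out =>
    { queries := x.queries + ∑ s, (R l x.v s).queries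
      v := fun s => if x.v s ≤ (out s).2 then (out s).2 else x.v s
      π := fun s => if x.v s ≤ (out s).2 then (out s).1 else x.π s }

/-- The first `l` iterations, started from `v₀ = 0` and the policy `π₀`. -/
def iterations (R : MaxRoutine 𝒮 𝒜 Q) (U : Matrix.unitaryGroup Q ℂ) (π₀ : 𝒮 → 𝒜) :
    ℕ → PMF (State 𝒮 𝒜)
  | 0 => PMF.pure { queries := 0, v := 0, π := π₀ }
  | l + 1 => (iterations R U π₀ l).bind (iteration R U (l + 1))

/-- The algorithm SolveMdp2 with the quantum routine `R`, the oracle `U` and initial policy `π₀`: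
the joint distribution of the number of oracle queries and the outputs `v_L` and `π_L`. -/
def solveMdp2 (M : RewardModel 𝒮 𝒜) (R : MaxRoutine 𝒮 𝒜 Q) (U : Matrix.unitaryGroup Q ℂ)
    (ε : ℝ) (π₀ : 𝒮 → 𝒜) : PMF (State 𝒮 𝒜) :=
  iterations R U π₀ (numIter M ε)

end Algorithm

end QMDP

end

namespace QMDP
noncomputable section

/-! ### Block-diagonal circuits -/

section Circuits

open Matrix

variable {Q : Type} [Fintype Q] [DecidableEq Q]

/-! The classical side is monotone approximate value iteration. Because the estimates are shifted
down, every accepted value lies below the Bellman update, so `v ≤ r + γ P v` along the current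
policy survives each iteration and gives `v ≤ v^π` by the comparison principle `le_of_le_bellman`.
From the second iteration on, the bound on the distance to the optimal values contracts by `γ`, up
to an additive `2 γ` times the accuracy. This is `IsValueBound.update`;
`le_toOuterMeasure_iterations` accumulates the failure probabilities.

The quantum side finds, among `A` arms whose values are a known offset plus an unknown mean in `[0,
1]`, a maximum up to `β` with `O(√A / β · log (1 / f))` queries (`solvesIn_maximum`). No amplitude
estimate is ever computed. The core is `solves_threshold`, a test built from two reflections: one is
`U⁻¹ D U`, the other is the fixed reflection about the span of the positive witnesses of all
oracles. By `solves_of_witnesses`, averaging the powers of their product separates the two cases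
once the witnesses are orthogonal and have suitable norms. If an arm exceeds the threshold by `s` in
one oracle and falls short of it by `t` in another, its means differ by `s + t`, and this difference
is a combination of inner products of eigenparts of the two reflections
(`inner_fixedPart_negatedPart_sub`). Orthogonality requires dividing by `s + t`; the Cayley
transform turns `1 / (s + t)` into a geometric series of products of a function of `s` and a
function of `t`. Its truncation costs workspace but no queries, and the witness norms give `√K / h`.

Two recursions use this test: shrinking an interval around the maximum (`solvesIn_value`) and
halving the set of arms (`solvesIn_arm`). Their costs grow geometrically, faster than the log factor
grows when failure budgets are halved, so the last stages dominate. Circuits are composed without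
intermediate measurement by giving each outcome its own workspace sector (`Computes.bind`).

The two sides meet in `isCorrectMax_of_lt`: an approximate maximum suffices, since a vector `q`
explaining it can be reconstructed afterwards. With `β = ε / (2 Γ²)` and `L = O(Γ log (2Γ/ε))`
iterations over `S` states the query bound follows. -/

/-- A register whose workspace is a disjoint union is the disjoint union of the registers. -/
def sigmaEquiv (Q : Type) {Y : Type} (W : Y → Type) : Q × (Σ y, W y) ≃ Σ y, Q × W y where
  toFun x := ⟨x.2.1, x.1, x.2.2⟩
  invFun x := (x.2.1, ⟨x.1, x.2.2⟩)
  left_inv _ := rfl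
  right_inv _ := rfl

section SigmaBlock

variable {Y : Type} [Fintype Y] [DecidableEq Y] {W : Y → Type} [∀ y, Fintype (W y)]
  [∀ y, DecidableEq (W y)]

/-- The unitary that acts as `E y` on the sector `y` of the workspace. -/
def sigmaBlock (E : ∀ y, unitaryGroup (Q × W y) ℂ) : unitaryGroup (Q × Σ y, W y) ℂ :=
  ⟨(blockDiagonal' fun y => (E y : Matrix (Q × W y) (Q × W y) ℂ)).submatrix
      (sigmaEquiv Q W) (sigmaEquiv Q W), by
    rw [mem_unitaryGroup_iff, star_eq_conjTranspose, conjTranspose_submatrix,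
      blockDiagonal'_conjTranspose, submatrix_mul_equiv, ← blockDiagonal'_mul]
    have : (fun y => (E y : Matrix (Q × W y) (Q × W y) ℂ) *
        (E y : Matrix (Q × W y) (Q × W y) ℂ)ᴴ) = 1 :=
      funext fun y => mem_unitaryGroup_iff.1 (E y).2
    rw [this, blockDiagonal'_one, submatrix_one_equiv]⟩

theorem sigmaBlock_apply_same (E : ∀ y, unitaryGroup (Q × W y) ℂ) (q q' : Q) (y : Y)
    (w w' : W y) : (sigmaBlock E).1 (q, ⟨y, w⟩) (q', ⟨y, w'⟩) = (E y).1 (q, w) (q', w') := by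
  simp [sigmaBlock, sigmaEquiv, blockDiagonal'_apply]

theorem sigmaBlock_apply_ne (E : ∀ y, unitaryGroup (Q × W y) ℂ) (q q' : Q) {y y' : Y}
    (h : y ≠ y') (w : W y) (w' : W y') :
    (sigmaBlock E).1 (q, ⟨y, w⟩) (q', ⟨y', w'⟩) = 0 := by
  simp [sigmaBlock, sigmaEquiv, blockDiagonal'_apply, h]

theorem sigmaBlock_mul (E F : ∀ y, unitaryGroup (Q × W y) ℂ) :
    sigmaBlock E * sigmaBlock F = sigmaBlock fun y => E y * F y := by
  apply Subtype.ext
  simp only [sigmaBlock, Submonoid.coe_mul, submatrix_mul_equiv, ← blockDiagonal'_mul]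

/-- A single query serves all sectors at once, which is why parallel branches cost only as much as
one of them. -/
theorem onQuery_sigma (V : unitaryGroup Q ℂ) :
    onQuery (Σ y, W y) V = sigmaBlock fun y => onQuery (W y) V := by
  apply Subtype.ext
  ext ⟨q, y, w⟩ ⟨q', y', w'⟩
  by_cases h : y = y'
  · subst h
    rw [sigmaBlock_apply_same]
    simp [onQuery, kroneckerMap_apply, one_apply]
  · rw [sigmaBlock_apply_ne _ _ _ h]
    simp [onQuery, kroneckerMap_apply, one_apply, h]

end SigmaBlock

/-- The unitary that permutes the computational basis. -/
def permGate {ι : Type} [Fintype ι] [DecidableEq ι] (σ : Equiv.Perm ι) : unitaryGroup ι ℂ :=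
  ⟨(1 : Matrix ι ι ℂ).submatrix σ.symm id, by
    rw [mem_unitaryGroup_iff, star_eq_conjTranspose, conjTranspose_submatrix, conjTranspose_one]
    have := submatrix_mul_equiv (1 : Matrix ι ι ℂ) (1 : Matrix ι ι ℂ) σ.symm (Equiv.refl ι) σ.symm
    simp only [Equiv.coe_refl] at this
    rw [this, Matrix.one_mul, submatrix_one_equiv]⟩

theorem permGate_mul_apply {ι : Type} [Fintype ι] [DecidableEq ι] (σ : Equiv.Perm ι)
    (G : unitaryGroup ι ℂ) (i j : ι) : (permGate σ * G).1 i j = G.1 (σ.symm i) j := by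
  simp [permGate, Matrix.mul_apply, one_apply]

/-! ### Unitaries implemented with `n` pairs of queries -/

/-- `Implements n E`: the unitary `E U` is implemented by a circuit with fixed gates and `n` pairs
of queries, each of them to `U` and then to `U⁻¹`. -/
inductive Implements {W : Type} [Fintype W] [DecidableEq W] :
    ℕ → (unitaryGroup Q ℂ → unitaryGroup (Q × W) ℂ) → Prop
  | const (G : unitaryGroup (Q × W) ℂ) : Implements 0 fun _ => G
  | step {n : ℕ} {E : unitaryGroup Q ℂ → unitaryGroup (Q × W) ℂ}
      (G₁ G₂ : unitaryGroup (Q × W) ℂ) (h : Implements n E) :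
      Implements (n + 1) fun U => G₂ * onQuery W U⁻¹ * G₁ * onQuery W U * E U

theorem onQuery_inv_mul (W : Type) [Fintype W] [DecidableEq W] (U : unitaryGroup Q ℂ) :
    onQuery W U⁻¹ * onQuery W U = 1 := by
  apply Subtype.ext
  have : (U⁻¹ : unitaryGroup Q ℂ).1 * U.1 = 1 := congrArg Subtype.val (inv_mul_cancel U)
  simp only [onQuery, Submonoid.coe_mul, ← mul_kronecker_mul, this, Matrix.one_mul,
    one_kronecker_one, OneMemClass.coe_one]

namespace Implements

variable {W : Type} [Fintype W] [DecidableEq W]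
  {E F : unitaryGroup Q ℂ → unitaryGroup (Q × W) ℂ} {m n : ℕ}

theorem gate_mul (G : unitaryGroup (Q × W) ℂ) (h : Implements n E) :
    Implements n fun U => G * E U := by
  cases h with
  | const G' => exact const (G * G')
  | step G₁ G₂ h => simpa only [mul_assoc] using step G₁ (G * G₂) h

theorem comp (hF : Implements m F) (hE : Implements n E) :
    Implements (n + m) fun U => F U * E U := by
  induction hF with
  | const G => exact gate_mul G hE
  | step G₁ G₂ _ ih => simpa only [mul_assoc, add_assoc] using step G₁ G₂ ih

/-- A query to `U` followed directly by one to `U⁻¹` is the identity. Such padding equalizes the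
lengths of branches before they are run in parallel. -/
theorem succ (h : Implements n E) : Implements (n + 1) E := by
  have := step 1 1 h
  simpa only [one_mul, mul_one, onQuery_inv_mul] using this

theorem mono (h : Implements n E) (hnm : n ≤ m) : Implements m E := by
  induction hnm with
  | refl => exact h
  | step _ ih => exact ih.succ

theorem pow (h : Implements n E) (k : ℕ) : Implements (n * k) fun U => E U ^ k := by
  induction k with
  | zero => simpa using const (Q := Q) (1 : unitaryGroup (Q × W) ℂ)
  | succ k ih => simpa only [pow_succ', mul_add, mul_one] using h.comp ih

theorem exists_const (h : Implements 0 E) : ∃ G, E = fun _ => G := by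
  cases h with
  | const G => exact ⟨G, rfl⟩

theorem exists_step (h : Implements (n + 1) E) : ∃ G₁ G₂ E', Implements n E' ∧
    E = fun U => G₂ * onQuery W U⁻¹ * G₁ * onQuery W U * E' U := by
  cases h with
  | step G₁ G₂ h => exact ⟨G₁, G₂, _, h, rfl⟩

theorem sigmaBlock {Y : Type} [Fintype Y] [DecidableEq Y] {W : Y → Type} [∀ y, Fintype (W y)]
    [∀ y, DecidableEq (W y)] {E : ∀ y, unitaryGroup Q ℂ → unitaryGroup (Q × W y) ℂ}
    (h : ∀ y, Implements n (E y)) :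
    Implements n fun U => QMDP.sigmaBlock fun y => E y U := by
  induction n generalizing E with
  | zero =>
    choose G hG using fun y => (h y).exists_const
    obtain rfl : E = fun y _ => G y := funext hG
    exact const _
  | succ n ih =>
    choose G₁ G₂ E' h' hE using fun y => (h y).exists_step
    obtain rfl := funext hE
    simpa only [onQuery_sigma, sigmaBlock_mul] using
      step (QMDP.sigmaBlock G₁) (QMDP.sigmaBlock G₂) (ih h')

theorem exists_steps (h : Implements n E) : ∃ (prep : unitaryGroup (Q × W) ℂ)
    (steps : List (Bool × unitaryGroup (Q × W) ℂ)), steps.length = 2 * n ∧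
      ∀ U, steps.foldl (fun T g => g.2 * onQuery W (if g.1 then U⁻¹ else U) * T) prep = E U := by
  induction h with
  | const G => exact ⟨G, [], rfl, fun _ => rfl⟩
  | step G₁ G₂ _ ih =>
    obtain ⟨prep, steps, hl, hs⟩ := ih
    refine ⟨prep, steps ++ [(false, G₁), (true, G₂)], by simp [hl, mul_add], fun U => ?_⟩
    rw [List.foldl_append, hs]
    simp [mul_assoc]

end Implements

/-! ### Expected costs of circuits -/

/-- There is a circuit with `n` pairs of queries whose output `o` has the expected cost
`𝔼 (w i o) ≤ c i` on every instance `i`, where the oracle is `U i`. -/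
def Computes {I Out : Type} (U : I → unitaryGroup Q ℂ) (n : ℕ) (w : I → Out → ℝ) (c : I → ℝ) :
    Prop :=
  ∃ (W : Type) (_ : Fintype W) (_ : DecidableEq W) (start : Q × W)
    (E : unitaryGroup Q ℂ → unitaryGroup (Q × W) ℂ) (read : Q × W → Out),
    Implements n E ∧ ∀ i, ∑ x, ‖(E (U i)).1 x start‖ ^ 2 * w i (read x) ≤ c i

theorem sum_norm_sq_column {ι : Type} [Fintype ι] [DecidableEq ι] (G : unitaryGroup ι ℂ) (j : ι) :
    ∑ i, ‖G.1 i j‖ ^ 2 = 1 := by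
  have h := congrFun (congrFun (mem_unitaryGroup_iff'.1 G.2) j) j
  rw [Matrix.mul_apply, one_apply_eq] at h
  have h3 : ((∑ i, ‖G.1 i j‖ ^ 2 : ℝ) : ℂ) = ((1 : ℝ) : ℂ) := by
    rw [Complex.ofReal_sum, Complex.ofReal_one, ← h]
    refine Finset.sum_congr rfl fun i _ => ?_
    rw [star_apply]
    push_cast
    exact (Complex.conj_mul' _).symm
  exact_mod_cast h3

/-- The disjoint union of a family of workspaces and one more. -/
def OptionFamily {Y : Type} (W₁ : Type) (W₂ : Y → Type) : Option Y → Type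
  | none => W₁
  | some y => W₂ y

instance {Y : Type} (W₁ : Type) (W₂ : Y → Type) [h₁ : Fintype W₁] [h₂ : ∀ y, Fintype (W₂ y)] :
    ∀ o, Fintype (OptionFamily W₁ W₂ o)
  | none => h₁
  | some y => h₂ y

instance {Y : Type} (W₁ : Type) (W₂ : Y → Type) [h₁ : DecidableEq W₁]
    [h₂ : ∀ y, DecidableEq (W₂ y)] : ∀ o, DecidableEq (OptionFamily W₁ W₂ o)
  | none => h₁
  | some y => h₂ y

theorem exists_perm_apply_eq {α Y : Type} [Finite α] {f g : Y → α} (hf : f.Injective)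
    (hg : g.Injective) : ∃ σ : Equiv.Perm α, ∀ y, σ (f y) = g y := by
  classical
  let e : {x // x ∈ Set.range f} ≃ {x // x ∈ Set.range g} :=
    (Equiv.ofInjective f hf).symm.trans (Equiv.ofInjective g hg)
  refine ⟨e.extendSubtype, fun y => ?_⟩
  rw [e.extendSubtype_apply_of_mem _ ⟨y, rfl⟩]
  simp only [e, Equiv.trans_apply]
  have : (Equiv.ofInjective f hf).symm ⟨f y, y, rfl⟩ = y := Equiv.ofInjective_symm_apply hf y
  rw [this]
  rfl

namespace Computes

variable {I Out Out' : Type} {U : I → unitaryGroup Q ℂ} {m n : ℕ} {w : I → Out → ℝ} {c : I → ℝ}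

theorem pure [Nonempty Q] (o : Out) (h : ∀ i, w i o ≤ c i) : Computes U 0 w c := by
  refine ⟨Unit, inferInstance, inferInstance, (Classical.arbitrary Q, ()), _, fun _ => o,
    .const 1, fun i => ?_⟩
  rw [← Finset.sum_mul, sum_norm_sq_column, one_mul]
  exact h i

theorem mono (h : Computes U n w c) {w' : I → Out → ℝ} {c' : I → ℝ} (hn : n ≤ m)
    (hw : ∀ i o, w' i o ≤ w i o) (hc : ∀ i, c i ≤ c' i) : Computes U m w' c' := by
  obtain ⟨W, i₁, i₂, start, E, read, hE, hc'⟩ := h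
  refine ⟨W, i₁, i₂, start, E, read, hE.mono hn, fun i => le_trans ?_ ((hc' i).trans (hc i))⟩
  exact Finset.sum_le_sum fun x _ => mul_le_mul_of_nonneg_left (hw _ _) (sq_nonneg _)

theorem map (f : Out → Out') {w' : I → Out' → ℝ} (h : Computes U n (fun i o => w' i (f o)) c) :
    Computes U n w' c := by
  obtain ⟨W, i₁, i₂, start, E, read, hE, hc'⟩ := h
  exact ⟨W, i₁, i₂, start, E, f ∘ read, hE, hc'⟩

/-- Deferred measurement: a basis permutation sends each final basis state of the first circuit,
living in the sector `none`, to the start state of a sector of its own, where the chosen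
continuation runs. Different outcomes occupy different sectors, so they cannot interfere and the
probabilities multiply as for a measured outcome. -/
theorem bind_of_family {Y : Type} [Fintype Y] [DecidableEq Y] {W : Option Y → Type}
    [∀ o, Fintype (W o)] [∀ o, DecidableEq (W o)] (e : Y ≃ Q × W none) (start : Q × W none)
    {E : unitaryGroup Q ℂ → unitaryGroup (Q × W none) ℂ} (read : Y → Out) (hE : Implements n E)
    {w₁ : I → Out → ℝ} {w : I → Out' → ℝ}
    (hc : ∀ i, ∑ y, ‖(E (U i)).1 (e y) start‖ ^ 2 * w₁ i (read y) ≤ c i)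
    (st : ∀ y, Q × W (some y)) (F : ∀ y, unitaryGroup Q ℂ → unitaryGroup (Q × W (some y)) ℂ)
    (rd : ∀ y, Q × W (some y) → Out') (hF : ∀ y, Implements m (F y))
    (hc₂ : ∀ y i, ∑ x, ‖(F y (U i)).1 x (st y)‖ ^ 2 * w i (rd y x) ≤ w₁ i (read y)) :
    Computes U (n + m) w c := by
  -- `f y` is where the first circuit ends with outcome `y`; `g y` is where its continuation starts.
  let f : Y → Q × Σ o, W o := fun y => ((e y).1, ⟨none, (e y).2⟩)
  let g : Y → Q × Σ o, W o := fun y => ((st y).1, ⟨some y, (st y).2⟩)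
  have hf : f.Injective := by
    intro y y' h
    have h₁ : (e y).1 = (e y').1 := (Prod.ext_iff.1 h).1
    have h₂ : (⟨none, (e y).2⟩ : Σ o, W o) = ⟨none, (e y').2⟩ := (Prod.ext_iff.1 h).2
    exact e.injective (Prod.ext h₁ (by simpa using h₂))
  have hg : g.Injective := by
    intro y y' h
    have h₂ : (⟨some y, (st y).2⟩ : Σ o, W o).1 = (⟨some y', (st y').2⟩ : Σ o, W o).1 :=
      congrArg (fun x => x.2.1) h
    exact Option.some.inj h₂
  obtain ⟨σ, hσ⟩ := exists_perm_apply_eq hf hg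
  let E' : ∀ o, unitaryGroup Q ℂ → unitaryGroup (Q × W o) ℂ := fun o =>
    match o with
    | none => E
    | some _ => fun _ => 1
  let F' : ∀ o, unitaryGroup Q ℂ → unitaryGroup (Q × W o) ℂ := fun o =>
    match o with
    | none => fun _ => 1
    | some y => F y
  have hE' : ∀ o, Implements n (E' o) := fun o =>
    match o with
    | none => hE
    | some y => (Implements.const (Q := Q) (1 : unitaryGroup (Q × W (some y)) ℂ)).mono n.zero_le
  have hF' : ∀ o, Implements m (F' o) := fun o =>
    match o with
    | none => (Implements.const (Q := Q) (1 : unitaryGroup (Q × W none) ℂ)).mono m.zero_le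
    | some y => hF y
  -- The value on the sector `none` is a dummy: by `hnone` no amplitude is left there.
  let rd' : Q × (Σ o, W o) → Out' := fun x =>
    match x with
    | (_, ⟨none, _⟩) => rd (e.symm start) (st _)
    | (q, ⟨some y, z⟩) => rd y (q, z)
  refine ⟨Σ o, W o, inferInstance, inferInstance, f (e.symm start),
    fun U => QMDP.sigmaBlock (fun o => F' o U) * (permGate σ * QMDP.sigmaBlock (fun o => E' o U)),
    rd', (Implements.sigmaBlock hF').comp ((Implements.sigmaBlock hE').gate_mul _), fun i => ?_⟩
  have key : ∀ z, (QMDP.sigmaBlock (fun o => F' o (U i)) *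
      (permGate σ * QMDP.sigmaBlock (fun o => E' o (U i)))).1 z (f (e.symm start)) =
      ∑ y, (QMDP.sigmaBlock (fun o => F' o (U i))).1 z (g y) * (E (U i)).1 (e y) start := by
    intro z
    rw [Submonoid.coe_mul, Matrix.mul_apply, ← Equiv.sum_comp σ]
    have : ∀ z', (QMDP.sigmaBlock (fun o => F' o (U i))).1 z (σ z') *
        (permGate σ * QMDP.sigmaBlock (fun o => E' o (U i))).1 (σ z') (f (e.symm start)) =
        (QMDP.sigmaBlock (fun o => F' o (U i))).1 z (σ z') *
          (QMDP.sigmaBlock (fun o => E' o (U i))).1 z' (f (e.symm start)) := by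
      intro z'
      rw [permGate_mul_apply, Equiv.symm_apply_apply]
    rw [Finset.sum_congr rfl fun z' _ => this z', ← Finset.sum_subset
      (Finset.subset_univ (Finset.univ.image f)), Finset.sum_image fun x _ y _ h => hf h]
    · refine Finset.sum_congr rfl fun y _ => ?_
      rw [hσ]
      congr 1
      simp only [f]
      rw [sigmaBlock_apply_same, e.apply_symm_apply]
    · rintro ⟨q, o, z'⟩ - hz
      cases o with
      | none =>
        refine absurd (Finset.mem_image.2 ⟨e.symm (q, z'), Finset.mem_univ _, ?_⟩) hz
        simp [f]
      | some y =>
        have : (QMDP.sigmaBlock (fun o => E' o (U i))).1 (q, ⟨some y, z'⟩) (f (e.symm start)) =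
          0 := sigmaBlock_apply_ne _ _ _ (by simp) _ _
        rw [this, mul_zero]
  have hnone : ∀ q z, (QMDP.sigmaBlock (fun o => F' o (U i)) *
      (permGate σ * QMDP.sigmaBlock (fun o => E' o (U i)))).1 (q, ⟨none, z⟩)
        (f (e.symm start)) = 0 := by
    intro q z
    rw [key]
    refine Finset.sum_eq_zero fun y _ => ?_
    have : (QMDP.sigmaBlock (fun o => F' o (U i))).1 (q, ⟨none, z⟩) (g y) = 0 :=
      sigmaBlock_apply_ne _ _ _ (by simp) _ _
    rw [this, zero_mul]
  have hsome : ∀ q y (z : W (some y)), (QMDP.sigmaBlock (fun o => F' o (U i)) *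
      (permGate σ * QMDP.sigmaBlock (fun o => E' o (U i)))).1 (q, ⟨some y, z⟩)
        (f (e.symm start)) = (F y (U i)).1 (q, z) (st y) * (E (U i)).1 (e y) start := by
    intro q y z
    rw [key, Finset.sum_eq_single y]
    · congr 1
      exact sigmaBlock_apply_same _ _ _ _ _ _
    · intro y' _ h
      have : (QMDP.sigmaBlock (fun o => F' o (U i))).1 (q, ⟨some y, z⟩) (g y') = 0 :=
        sigmaBlock_apply_ne _ _ _ (by simpa using h.symm) _ _
      rw [this, zero_mul]
    · simp
  calc ∑ x, ‖(QMDP.sigmaBlock (fun o => F' o (U i)) * (permGate σ *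
        QMDP.sigmaBlock (fun o => E' o (U i)))).1 x (f (e.symm start))‖ ^ 2 * w i (rd' x)
      = ∑ y, ‖(E (U i)).1 (e y) start‖ ^ 2 *
          ∑ z, ‖(F y (U i)).1 z (st y)‖ ^ 2 * w i (rd y z) := by
        rw [← (sigmaEquiv Q W).symm.sum_comp, Fintype.sum_sigma, Fintype.sum_option,
          Finset.sum_eq_zero, zero_add]
        · refine Finset.sum_congr rfl fun y _ => ?_
          rw [Finset.mul_sum]
          refine Finset.sum_congr rfl fun z _ => ?_
          have := hsome z.1 y z.2
          simp only [sigmaEquiv, Equiv.coe_fn_symm_mk] at this ⊢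
          rw [this, norm_mul, mul_pow]
          simp only [rd']
          ring
        · intro z _
          have := hnone z.1 z.2
          simp only [sigmaEquiv, Equiv.coe_fn_symm_mk] at this ⊢
          rw [this]
          simp
    _ ≤ ∑ y, ‖(E (U i)).1 (e y) start‖ ^ 2 * w₁ i (read y) :=
        Finset.sum_le_sum fun y _ => mul_le_mul_of_nonneg_left (hc₂ y i) (sq_nonneg _)
    _ ≤ c i := hc i

theorem bind {w₁ : I → Out → ℝ} {w : I → Out' → ℝ} (h₁ : Computes U n w₁ c)
    (h₂ : ∀ o, Computes U m w fun i => w₁ i o) : Computes U (n + m) w c := by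
  obtain ⟨W₁, _, _, start, E, read, hE, hc⟩ := h₁
  choose W₂ i₁ i₂ st F rd hF hc₂ using fun x : Q × W₁ => h₂ (read x)
  exact bind_of_family (W := OptionFamily W₁ W₂) (Equiv.refl (Q × W₁)) start read hE hc st F rd
    hF hc₂

end Computes

end Circuits

/-! ### Failure probabilities and majority votes -/

section Solves

open Matrix (unitaryGroup)

variable {Q : Type} [Fintype Q] [DecidableEq Q] {I Out Out' : Type} {U : I → unitaryGroup Q ℂ}
  {m n : ℕ}

/-- The Born probabilities sum to one, so constants pass through the expectation. Rescaled costs are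
what `Computes.bind` needs as intermediate costs. -/
theorem Computes.affine {w : I → Out → ℝ} {c : I → ℝ} (h : Computes U n w c) (a b : I → ℝ)
    (hb : ∀ i, 0 ≤ b i) :
    Computes U n (fun i o => a i + b i * w i o) fun i => a i + b i * c i := by
  obtain ⟨W, i₁, i₂, start, E, read, hE, hc⟩ := h
  refine ⟨W, i₁, i₂, start, E, read, hE, fun i => ?_⟩
  have : ∀ x, ‖(E (U i)).1 x start‖ ^ 2 * (a i + b i * w i (read x)) =
      ‖(E (U i)).1 x start‖ ^ 2 * a i + b i * (‖(E (U i)).1 x start‖ ^ 2 * w i (read x)) :=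
    fun x => by ring
  simp only [this]
  rw [Finset.sum_add_distrib, ← Finset.sum_mul, sum_norm_sq_column, one_mul, ← Finset.mul_sum]
  gcongr
  · exact hb i
  · exact hc i

/-- There is a circuit with `n` pairs of queries whose output is in `G i` with probability at
least `1 - f` on every instance `i`. -/
def Solves (U : I → unitaryGroup Q ℂ) (n : ℕ) (f : ℝ) (G : I → Set Out) : Prop :=
  Computes U n (fun i o => (G i)ᶜ.indicator 1 o) fun _ => f

namespace Solves

variable {f f' f₁ f₂ : ℝ} {G : I → Set Out}

theorem pure [Nonempty Q] (o : Out) (hf : 0 ≤ f) (h : ∀ i, o ∈ G i) : Solves U 0 f G :=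
  Computes.pure o fun i => by simp [h i, hf]

theorem mono (h : Solves U n f G) {G' : I → Set Out} (hn : n ≤ m) (hG : ∀ i, G i ⊆ G' i)
    (hf : f ≤ f') : Solves U m f' G' :=
  Computes.mono h hn
    (fun i o => Set.indicator_le_indicator_of_subset (Set.compl_subset_compl.2 (hG i))
      (fun _ => zero_le_one) o) fun _ => hf

theorem map (g : Out → Out') {G' : I → Set Out'} (h : Solves U n f fun i => g ⁻¹' G' i) :
    Solves U n f G' :=
  Computes.map g h

theorem bind (h₁ : Solves U n f₁ G) {G₂ : I → Set Out'} (hf₂ : 0 ≤ f₂)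
    (h₂ : ∀ o, Solves U m f₂ fun i => {o' | o ∈ G i → o' ∈ G₂ i}) :
    Solves U (n + m) (f₁ + f₂) G₂ := by
  -- Union bound: the cost-to-go after the first stage is `f₂`, plus `1` if that stage has already
  -- failed.
  have h := Computes.affine h₁ (fun _ => f₂) (fun _ => 1) fun _ => zero_le_one
  refine (Computes.bind h fun o => ?_).mono le_rfl (fun i o => le_rfl) fun i => ?_
  · obtain ⟨W, i₁, i₂, start, E, read, hE, hc⟩ := h₂ o
    refine ⟨W, i₁, i₂, start, E, read, hE, fun i => ?_⟩
    by_cases ho : o ∈ G i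
    · simpa [ho] using hc i
    · simp only [Set.indicator_of_mem (Set.mem_compl ho), Pi.one_apply, mul_one]
      calc _ ≤ ∑ x, ‖(E (U i)).1 x start‖ ^ 2 := by
            refine Finset.sum_le_sum fun x _ => mul_le_of_le_one_right (sq_nonneg _) ?_
            exact Set.indicator_le_self' (fun _ _ => zero_le_one) _
        _ = 1 := sum_norm_sq_column _ _
        _ ≤ f₂ + 1 := by linarith
  · simp only [one_mul]
    linarith

/-- A potential that is at least `1` at the positions `d` whose sign is a wrong answer. -/
def wrongness (G : Set Bool) (d : ℤ) : ℝ :=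
  Gᶜ.indicator 1 true * 2 ^ d + Gᶜ.indicator 1 false * 2 ^ (-d)

theorem wrongness_nonneg (G : Set Bool) (d : ℤ) : 0 ≤ wrongness G d :=
  add_nonneg (mul_nonneg (Set.indicator_nonneg (fun _ _ => zero_le_one) _) (by positivity))
    (mul_nonneg (Set.indicator_nonneg (fun _ _ => zero_le_one) _) (by positivity))

/-- A vote changes each exponential by a factor `2` or `1/2`. If exactly one answer is wrong, a
wrong vote doubles the potential and a right vote halves it, with equality in both cases. -/
theorem wrongness_step (G : Set Bool) (d : ℤ) (b : Bool) :
    wrongness G (d + if b then 1 else -1) ≤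
      1 / 2 * wrongness G d + 3 / 2 * wrongness G d * Gᶜ.indicator 1 b := by
  have h1 : (2 : ℝ) ^ (d + 1) = 2 ^ d * 2 := by rw [zpow_add₀ two_ne_zero, zpow_one]
  have h2 : (2 : ℝ) ^ (d + -1) = 2 ^ d / 2 := by
    rw [zpow_add₀ two_ne_zero, zpow_neg_one, div_eq_mul_inv]
  have h3 : (2 : ℝ) ^ (-(d + 1)) = 2 ^ (-d) / 2 := by
    rw [neg_add, zpow_add₀ two_ne_zero, zpow_neg_one, div_eq_mul_inv]
  have h4 : (2 : ℝ) ^ (-(d + -1)) = 2 ^ (-d) * 2 := by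
    rw [neg_add, neg_neg, zpow_add₀ two_ne_zero, zpow_one]
  have p1 : (0 : ℝ) < 2 ^ d := by positivity
  have p2 : (0 : ℝ) < 2 ^ (-d) := by positivity
  by_cases ht : true ∈ G <;> by_cases hf : false ∈ G <;> cases b <;>
    simp only [wrongness, if_true, Bool.false_eq_true, if_false, h1, h2, h3, h4, Set.indicator,
      Set.mem_compl_iff, ht, hf, not_true_eq_false, not_false_eq_true, Pi.one_apply] <;> linarith

/-- Each vote is wrong with probability at most `1/16`, so the expected potential shrinks by `1/2 +
3/2 · 1/16 = 19/32` per vote. -/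
theorem walk [Nonempty Q] {G : I → Set Bool} (h : Solves U n (1 / 16) G) (k : ℕ) :
    Computes U (n * k) (fun i d => wrongness (G i) d)
      fun i => (19 / 32) ^ k * wrongness (G i) 0 := by
  induction k with
  | zero => exact Computes.pure 0 fun i => by simp
  | succ k ih =>
    have h₁ := Computes.affine ih (fun _ => 0) (fun _ => 19 / 32) fun _ => by norm_num
    refine (Computes.bind (m := n) (w := fun i d => wrongness (G i) d) h₁ fun d => ?_).mono
      (by rw [mul_add, mul_one]) (fun i o => le_rfl) fun i => by rw [pow_succ]; linarith
    refine Computes.map (fun b : Bool => d + if b then 1 else -1) ?_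
    have h₂ := Computes.affine h (fun i => 1 / 2 * wrongness (G i) d)
      (fun i => 3 / 2 * wrongness (G i) d) fun i => mul_nonneg (by norm_num) (wrongness_nonneg (G i) d)
    exact h₂.mono le_rfl (fun i b => wrongness_step (G i) d b) fun i => by linarith

theorem indicator_le_wrongness (G : Set Bool) (d : ℤ) :
    Gᶜ.indicator 1 (decide (0 ≤ d)) ≤ wrongness G d := by
  have p1 : (0 : ℝ) < 2 ^ d := by positivity
  have p2 : (0 : ℝ) < 2 ^ (-d) := by positivity
  by_cases hd : 0 ≤ d
  · have := one_le_zpow₀ (one_le_two (α := ℝ)) hd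
    by_cases ht : true ∈ G <;> by_cases hf : false ∈ G <;>
      simp [wrongness, hd, ht, hf] <;> linarith [zpow_neg (2 : ℝ) d]
  · have := one_le_zpow₀ (one_le_two (α := ℝ)) (show 0 ≤ -d by omega)
    rw [zpow_neg] at this p2
    by_cases ht : true ∈ G <;> by_cases hf : false ∈ G <;>
      simp [wrongness, hd, ht, hf] <;> linarith

/-- A bounded-error decision procedure can be repeated `O(log (1 / f))` times to make its failure
probability at most `f`. -/
theorem amplify [Nonempty Q] {G : I → Set Bool} (h : Solves U n (1 / 16) G) (hf : 0 < f)
    (hf1 : f ≤ 1) : ∃ k : ℕ, (k : ℝ) ≤ 2 * -Real.log f + 3 ∧ Solves U (n * k) f G := by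
  have hlog : 0 ≤ -Real.log f := by linarith [Real.log_nonpos hf.le hf1]
  -- With this `k`, `e^(-k/2) ≤ f / e`; the summand `2` pays for the initial potential, which is at
  -- most `2 < e`.
  refine ⟨⌈2 * -Real.log f + 2⌉₊, ?_, ?_⟩
  · have := Nat.ceil_lt_add_one (show 0 ≤ 2 * -Real.log f + 2 by linarith)
    linarith
  set k := ⌈2 * -Real.log f + 2⌉₊
  have hk : 2 * -Real.log f + 2 ≤ k := Nat.le_ceil _
  refine Solves.map (fun d : ℤ => decide (0 ≤ d)) ((walk h k).mono le_rfl
    (fun i d => indicator_le_wrongness (G i) d) fun i => ?_)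
  have h0 : wrongness (G i) 0 ≤ 2 := by
    simp only [wrongness, zpow_zero, neg_zero, mul_one]
    have : ∀ b, (G i)ᶜ.indicator (1 : Bool → ℝ) b ≤ 1 := fun b =>
      Set.indicator_le_self' (fun _ _ => zero_le_one) _
    linarith [this true, this false]
  have he : (19 / 32 : ℝ) ≤ Real.exp (-(1 / 2)) := by
    have h1 := Real.exp_one_lt_d9
    have h2 : Real.exp (1 / 2) * Real.exp (1 / 2) = Real.exp 1 := by
      rw [← Real.exp_add]; norm_num
    have h3 : Real.exp (1 / 2) ≤ 32 / 19 := by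
      by_contra! hc
      nlinarith
    rw [Real.exp_neg, le_inv_comm₀ (by norm_num) (Real.exp_pos _)]
    linarith
  calc (19 / 32 : ℝ) ^ k * wrongness (G i) 0 ≤ Real.exp (-(1 / 2)) ^ k * 2 := by
        gcongr
        exact wrongness_nonneg _ _
    _ = Real.exp (-(k / 2)) * 2 := by rw [← Real.exp_nat_mul]; ring_nf
    _ ≤ Real.exp (Real.log f - 1) * 2 := by
        gcongr
        linarith
    _ = f * (Real.exp (-1) * 2) := by rw [sub_eq_add_neg, Real.exp_add, Real.exp_log hf]; ring
    _ ≤ f * 1 := by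
        gcongr
        rw [Real.exp_neg, inv_mul_le_iff₀ (Real.exp_pos _)]
        linarith [Real.exp_one_gt_d9]
    _ = f := mul_one f

end Solves

end Solves

/-! ### Tests with fixed vectors as witnesses -/

section Action

open Matrix (unitaryGroup toEuclideanCLM)

variable {ι : Type} [Fintype ι] [DecidableEq ι]

/-- The action of the unitary matrices on the Hilbert space. -/
def unitaryAction : unitaryGroup ι ℂ →* (EuclideanSpace ℂ ι ≃ₗᵢ[ℂ] EuclideanSpace ℂ ι) where
  toFun G := Unitary.linearIsometryEquiv
    ⟨toEuclideanCLM (n := ι) (𝕜 := ℂ) G.1, Unitary.map_mem (toEuclideanCLM (n := ι) (𝕜 := ℂ)) G.2⟩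
  map_one' := LinearIsometryEquiv.ext fun x =>
    congrArg (WithLp.toLp 2) (Matrix.one_mulVec x.ofLp)
  map_mul' G H := LinearIsometryEquiv.ext fun x =>
    congrArg (WithLp.toLp 2) (Matrix.mulVec_mulVec x.ofLp G.1 H.1).symm

theorem unitaryAction_apply (G : unitaryGroup ι ℂ) (x : EuclideanSpace ℂ ι) :
    unitaryAction G x = WithLp.toLp 2 (G.1.mulVec x.ofLp) :=
  rfl

theorem unitaryAction_single (G : unitaryGroup ι ℂ) (i j : ι) :
    unitaryAction G (EuclideanSpace.single j 1) i = G.1 i j := by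
  rw [unitaryAction_apply]
  simp

theorem unitaryAction_neg (G : unitaryGroup ι ℂ) (x : EuclideanSpace ℂ ι) :
    unitaryAction (-G) x = -unitaryAction G x := by
  simp only [unitaryAction_apply, Unitary.coe_neg, Matrix.neg_mulVec, WithLp.toLp_neg]

theorem exists_unitaryAction_eq (e : EuclideanSpace ℂ ι ≃ₗᵢ[ℂ] EuclideanSpace ℂ ι) :
    ∃ G : unitaryGroup ι ℂ, unitaryAction G = e := by
  let F := toEuclideanCLM (n := ι) (𝕜 := ℂ)
  refine ⟨⟨F.symm (Unitary.linearIsometryEquiv.symm e).1,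
    Unitary.map_mem F.symm (Unitary.linearIsometryEquiv.symm e).2⟩, ?_⟩
  have : (⟨F (F.symm (Unitary.linearIsometryEquiv.symm e).1), Unitary.map_mem F
      (Unitary.map_mem F.symm (Unitary.linearIsometryEquiv.symm e).2)⟩ :
      unitary (EuclideanSpace ℂ ι →L[ℂ] EuclideanSpace ℂ ι)) =
      Unitary.linearIsometryEquiv.symm e := Subtype.ext (F.apply_symm_apply _)
  calc _ = Unitary.linearIsometryEquiv (Unitary.linearIsometryEquiv.symm e) :=
        congrArg Unitary.linearIsometryEquiv this
    _ = e := MulEquiv.apply_symm_apply _ _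

/-- There is a gate that prepares any given unit vector. -/
theorem exists_column_eq (v : EuclideanSpace ℂ ι) (hv : ‖v‖ = 1) (j : ι) :
    ∃ G : unitaryGroup ι ℂ, ∀ i, G.1 i j = v i := by
  have h : Orthonormal ℂ (({j} : Set ι).domRestrict fun _ => v) := by
    rw [orthonormal_iff_ite]
    rintro ⟨a, rfl⟩ ⟨b, rfl⟩
    simp [Set.domRestrict, inner_self_eq_norm_sq_to_K, hv]
  obtain ⟨b, hb⟩ := h.exists_orthonormalBasis_extension_of_card_eq (by simp)
  refine ⟨⟨_, (EuclideanSpace.basisFun ι ℂ).toMatrix_orthonormalBasis_mem_unitary b⟩, fun i => ?_⟩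
  simp [Module.Basis.toMatrix_apply, hb j rfl]

end Action

/-! ### Averages of the powers of an isometry -/

section Average

variable {E : Type*} [NormedAddCommGroup E] [InnerProductSpace ℂ E] (V : E ≃ₗᵢ[ℂ] E)

/-- The part `(u - V u) / 2` of `ψ` telescopes in the sum over powers, leaving a vector of norm at
most `‖u‖` before division by `T`; averaging does not enlarge the rest. -/
theorem norm_average_le {T : ℕ} (ψ u : E) :
    ‖(T : ℂ)⁻¹ • ∑ t ∈ Finset.range T, (V ^ t) ψ‖ ≤
      ‖ψ - (2 : ℂ)⁻¹ • (u - V u)‖ + ‖u‖ / T := by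
  rcases Nat.eq_zero_or_pos T with rfl | hT
  · simp
  have hT' : (0 : ℝ) < T := Nat.cast_pos.2 hT
  set χ := ψ - (2 : ℂ)⁻¹ • (u - V u)
  have h1 : ψ = χ + (2 : ℂ)⁻¹ • (u - V u) := by simp [χ]
  have h2 : ∑ t ∈ Finset.range T, (V ^ t) ψ =
      (∑ t ∈ Finset.range T, (V ^ t) χ) + (2 : ℂ)⁻¹ • (u - (V ^ T) u) := by
    rw [h1]
    simp only [map_add, map_smul, map_sub, Finset.sum_add_distrib, ← Finset.smul_sum]
    congr 2
    have := Finset.sum_range_sub' (fun t => (V ^ t) u) T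
    simpa [pow_succ] using this
  have h3 : ‖∑ t ∈ Finset.range T, (V ^ t) χ‖ ≤ T * ‖χ‖ := by
    refine (norm_sum_le _ _).trans ?_
    simp
  have h4 : ‖(2 : ℂ)⁻¹ • (u - (V ^ T) u)‖ ≤ ‖u‖ := by
    rw [norm_smul]
    have := norm_sub_le u ((V ^ T) u)
    rw [LinearIsometryEquiv.norm_map] at this
    norm_num
    linarith
  rw [h2, norm_smul, norm_inv, Complex.norm_natCast]
  calc (T : ℝ)⁻¹ * _ ≤ (T : ℝ)⁻¹ * (T * ‖χ‖ + ‖u‖) := by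
        gcongr
        exact (norm_add_le _ _).trans (add_le_add h3 h4)
    _ = ‖χ‖ + ‖u‖ / T := by field_simp

/-- Averaging preserves the inner product with a vector fixed by `V`, so an overlap with a fixed
vector forces the average to stay large. -/
theorem norm_inner_le_average {T : ℕ} (hT : 0 < T) (ψ φ : E) (hφ : V φ = φ) :
    ‖inner ℂ φ ψ‖ ≤ ‖φ‖ * ‖(T : ℂ)⁻¹ • ∑ t ∈ Finset.range T, (V ^ t) ψ‖ := by
  have h1 : ∀ t, (V ^ t) φ = φ := by
    intro t
    induction t with
    | zero => simp
    | succ t ih => rw [pow_succ]; exact (congrArg _ hφ).trans ih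
  have h2 : inner ℂ φ ((T : ℂ)⁻¹ • ∑ t ∈ Finset.range T, (V ^ t) ψ) = inner ℂ φ ψ := by
    have : ∀ t, inner ℂ φ ((V ^ t) ψ) = inner ℂ φ ψ := fun t => by
      conv_lhs => rw [← h1 t]
      exact LinearIsometryEquiv.inner_map_map _ _ _
    rw [inner_smul_right, inner_sum]
    simp only [this, Finset.sum_const, Finset.card_range, nsmul_eq_mul]
    have : (T : ℂ) ≠ 0 := Nat.cast_ne_zero.2 hT.ne'
    field_simp
  rw [← h2]
  exact norm_inner_le_norm _ _

end Average

/-! ### The two-reflection test -/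

section Test

open Matrix (unitaryGroup)

variable {Q Λ : Type} [Fintype Q] [DecidableEq Q] [Fintype Λ] [DecidableEq Λ]

/-- A gate on the clock register `Fin T`. -/
def clockGate {T : ℕ} (G : unitaryGroup (Fin T) ℂ) : unitaryGroup (Q × Σ _ : Fin T, Λ) ℂ :=
  ⟨((G : Matrix (Fin T) (Fin T) ℂ) ⊗ₖ (1 : Matrix (Q × Λ) (Q × Λ) ℂ)).submatrix
      (fun x => (x.2.1, x.1, x.2.2)) (fun x => (x.2.1, x.1, x.2.2)), by
    let e : Q × (Σ _ : Fin T, Λ) ≃ Fin T × Q × Λ :=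
      ⟨fun x => (x.2.1, x.1, x.2.2), fun x => (x.2.1, ⟨x.1, x.2.2⟩), fun _ => rfl, fun _ => rfl⟩
    change Matrix.submatrix _ e e ∈ _
    rw [Matrix.mem_unitaryGroup_iff, Matrix.star_eq_conjTranspose, Matrix.conjTranspose_submatrix,
      Matrix.submatrix_mul_equiv, ← Matrix.star_eq_conjTranspose,
      Matrix.mem_unitaryGroup_iff.1 (Matrix.kronecker_mem_unitary G.2 (one_mem _)),
      Matrix.submatrix_one_equiv]⟩

theorem clockGate_apply {T : ℕ} (G : unitaryGroup (Fin T) ℂ) (q q' : Q) (t t' : Fin T)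
    (x x' : Λ) : (clockGate G).1 (q, ⟨t, x⟩) (q', ⟨t', x'⟩) =
      if (q, x) = (q', x') then G.1 t t' else 0 := by
  simp [clockGate, Matrix.one_apply]

theorem sum_clock {Q Λ : Type} [Fintype Q] [Fintype Λ] {T : ℕ} {α : Type*} [AddCommMonoid α] (f : Q × (Σ _ : Fin T, Λ) → α) :
    ∑ x, f x = ∑ t : Fin T, ∑ z : Q × Λ, f (z.1, ⟨t, z.2⟩) := by
  rw [← (sigmaEquiv Q fun _ : Fin T => Λ).symm.sum_comp, Fintype.sum_sigma]
  rfl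

/-- A clock in uniform superposition controls the power `V ^ t`. Undoing the clock preparation and
accepting when the clock is back at its start projects exactly onto the average of the powers. Since
`t < T`, each branch pads to `T` query pairs. -/
theorem exists_average_circuit {T : ℕ} (hT : 0 < T) {V : unitaryGroup Q ℂ → unitaryGroup (Q × Λ) ℂ}
    (hV : Implements 1 V) (j : Q × Λ) :
    ∃ (start : Q × Σ _ : Fin T, Λ) (E : unitaryGroup Q ℂ → unitaryGroup (Q × Σ _ : Fin T, Λ) ℂ)
      (acc : Q × (Σ _ : Fin T, Λ) → Bool), Implements T E ∧
      ∀ U, ∑ x, (if acc x then ‖(E U).1 x start‖ ^ 2 else 0) =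
        ‖(T : ℂ)⁻¹ • ∑ t ∈ Finset.range T,
          (unitaryAction (V U) ^ t) (EuclideanSpace.single j (1 : ℂ))‖ ^ 2 := by
  have hT0 : (T : ℝ) ≠ 0 := Nat.cast_ne_zero.2 hT.ne'
  let t₀ : Fin T := ⟨0, hT⟩
  let v : EuclideanSpace ℂ (Fin T) := WithLp.toLp 2 fun _ => ((Real.sqrt T)⁻¹ : ℝ)
  have hv : ‖v‖ = 1 := by
    rw [EuclideanSpace.norm_eq]
    simp [v, hT0]
  obtain ⟨G, hG⟩ := exists_column_eq v hv t₀
  refine ⟨(j.1, ⟨t₀, j.2⟩), fun U => (clockGate G)⁻¹ *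
    (sigmaBlock (fun t : Fin T => V U ^ (t : ℕ)) * clockGate G), fun x => decide (x.2.1 = t₀),
    ?_, fun U => ?_⟩
  · refine Implements.gate_mul _ ?_
    have h1 : Implements T fun U => sigmaBlock (fun t : Fin T => V U ^ (t : ℕ)) :=
      Implements.sigmaBlock fun t => (hV.pow t).mono (by rw [one_mul]; exact t.2.le)
    simpa only [zero_add] using h1.comp (Implements.const (Q := Q) (clockGate G))
  have key : ∀ z : Q × Λ, ((clockGate G)⁻¹ * (sigmaBlock (fun t : Fin T => V U ^ (t : ℕ)) *
      clockGate G)).1 (z.1, ⟨t₀, z.2⟩) (j.1, ⟨t₀, j.2⟩) =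
      (T : ℂ)⁻¹ * ∑ t ∈ Finset.range T, (V U ^ t).1 z j := by
    rintro ⟨q, x⟩
    have hc : ∀ t, star (G.1 t t₀) * G.1 t t₀ = (T : ℂ)⁻¹ := by
      intro t
      rw [hG]
      simp only [v, RCLike.star_def, Complex.conj_ofReal]
      rw [← Complex.ofReal_mul, ← mul_inv, Real.mul_self_sqrt (Nat.cast_nonneg T)]
      simp
    have hB : ∀ t : Fin T, (sigmaBlock (fun t : Fin T => V U ^ (t : ℕ)) * clockGate G).1
        (q, ⟨t, x⟩) (j.1, ⟨t₀, j.2⟩) = (V U ^ (t : ℕ)).1 (q, x) j * G.1 t t₀ := by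
      intro t
      rw [Submonoid.coe_mul, Matrix.mul_apply, sum_clock, Finset.sum_eq_single t,
        Finset.sum_eq_single j]
      · rw [sigmaBlock_apply_same, clockGate_apply, if_pos rfl]
      · intro z _ hz
        rw [clockGate_apply, if_neg hz, mul_zero]
      · simp
      · intro t' _ ht
        refine Finset.sum_eq_zero fun z _ => ?_
        rw [sigmaBlock_apply_ne _ _ _ ht.symm, zero_mul]
      · simp
    rw [Submonoid.coe_mul, Matrix.mul_apply, sum_clock, Finset.mul_sum, Finset.sum_range]
    refine Finset.sum_congr rfl fun t _ => ?_
    rw [Finset.sum_eq_single (q, x)]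
    · rw [hB]
      have : ((clockGate G)⁻¹ : unitaryGroup (Q × Σ _ : Fin T, Λ) ℂ).1 (q, ⟨t₀, x⟩)
          (q, ⟨t, x⟩) = star (G.1 t t₀) := by
        have := clockGate_apply G q q t t₀ x x
        rw [if_pos rfl] at this
        rw [← this]
        rfl
      rw [this, ← hc t]
      ring
    · intro z _ hz
      have : ((clockGate G)⁻¹ : unitaryGroup (Q × Σ _ : Fin T, Λ) ℂ).1 (q, ⟨t₀, x⟩)
          (z.1, ⟨t, z.2⟩) = star ((clockGate G).1 (z.1, ⟨t, z.2⟩) (q, ⟨t₀, x⟩)) := rfl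
      rw [this, clockGate_apply, if_neg hz, star_zero, zero_mul]
    · simp
  rw [sum_clock, Finset.sum_eq_single t₀]
  · rw [EuclideanSpace.norm_sq_eq]
    refine Finset.sum_congr rfl fun z _ => ?_
    rw [if_pos (by simp), key z]
    congr 2
    simp only [PiLp.smul_apply, smul_eq_mul, WithLp.ofLp_sum, Finset.sum_apply, ← map_pow,
      unitaryAction_single]
  · intro t _ ht
    simp [ht]
  · simp

/-- A decision problem is solved with `T` pairs of queries if its positive instances `i` have
witnesses `φ i` that are fixed by the reflection `U⁻¹ D U`, its negative instances have witnesses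
`u i` with `(1 + U⁻¹ D U) (u i) / 2` close to the initial state, and the positive witnesses are
orthogonal to the negative ones. -/
theorem solves_of_witnesses {I : Type} {U : I → unitaryGroup Q ℂ} (D : unitaryGroup (Q × Λ) ℂ)
    (j : Q × Λ) {T : ℕ} (hT : 0 < T) {G : I → Set Bool}
    (φ u : I → EuclideanSpace ℂ (Q × Λ))
    (hφ : ∀ i, false ∉ G i →
      unitaryAction (onQuery Λ (U i)⁻¹ * D * onQuery Λ (U i)) (φ i) = φ i ∧ φ i j = 1 ∧
        ‖φ i‖ ^ 2 ≤ 16 / 15)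
    (hu : ∀ i, true ∉ G i →
      ‖(2 : ℂ)⁻¹ • (u i + unitaryAction (onQuery Λ (U i)⁻¹ * D * onQuery Λ (U i)) (u i)) -
        EuclideanSpace.single j 1‖ ≤ 1 / 8 ∧ ‖u i‖ ≤ T / 8)
    (horth : ∀ i i', false ∉ G i → true ∉ G i' → inner ℂ (φ i) (u i') = 0) :
    Solves U T (1 / 16) G := by
  -- The span runs over the positive witnesses of all instances, so the reflection about it does not
  -- depend on the oracle and is a legitimate fixed gate.
  let A : Submodule ℂ (EuclideanSpace ℂ (Q × Λ)) :=
    Submodule.span ℂ {x | ∃ i, false ∉ G i ∧ φ i = x}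
  obtain ⟨R, hR⟩ := exists_unitaryAction_eq A.reflection
  obtain ⟨start, E, acc, hE, hacc⟩ := exists_average_circuit (Q := Q) (Λ := Λ) hT
    (V := fun U => 1 * onQuery Λ U⁻¹ * D * onQuery Λ U * R) (.step D 1 (.const R)) j
  refine ⟨Σ _ : Fin T, Λ, inferInstance, inferInstance, start, E, acc, hE, fun i => ?_⟩
  have hsum := sum_norm_sq_column (E (U i)) start
  have hacc := hacc (U i)
  simp only [one_mul] at hacc
  set V := unitaryAction (onQuery Λ (U i)⁻¹ * D * onQuery Λ (U i) * R)
  have hVR : ∀ x, V x =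
      unitaryAction (onQuery Λ (U i)⁻¹ * D * onQuery Λ (U i)) (A.reflection x) := by
    intro x
    rw [← hR]
    simp only [V, map_mul]
    rfl
  set avg := (T : ℂ)⁻¹ • ∑ t ∈ Finset.range T, (V ^ t) (EuclideanSpace.single j (1 : ℂ))
  have hT' : (0 : ℝ) < T := Nat.cast_pos.2 hT
  have hpos : false ∉ G i → 15 / 16 ≤ ‖avg‖ ^ 2 := by
    intro hi
    obtain ⟨h1, h2, h3⟩ := hφ i hi
    have hA : A.reflection (φ i) = φ i :=
      Submodule.reflection_mem_subspace_eq_self (Submodule.subset_span ⟨i, hi, rfl⟩)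
    -- The witness is fixed by both reflections, hence by `V`, and overlaps the initial state by
    -- `1`.
    have := norm_inner_le_average V hT (EuclideanSpace.single j 1) (φ i) (by rw [hVR, hA, h1])
    rw [EuclideanSpace.inner_single_right, h2] at this
    simp only [map_one, mul_one, norm_one] at this
    have h4 : 1 ≤ (‖φ i‖ * ‖avg‖) ^ 2 := by
      rw [← one_pow 2]
      exact pow_le_pow_left₀ zero_le_one this 2
    rw [mul_pow] at h4
    nlinarith [sq_nonneg ‖avg‖]
  have hneg : true ∉ G i → ‖avg‖ ^ 2 ≤ 1 / 16 := by
    intro hi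
    obtain ⟨h1, h2⟩ := hu i hi
    have hA : A.reflection (u i) = -u i := by
      refine Submodule.reflection_mem_subspace_orthogonalComplement_eq_neg ?_
      have : A ⟂ Submodule.span ℂ {u i} := by
        rw [Submodule.isOrtho_span]
        rintro _ ⟨i', hi', rfl⟩ _ rfl
        exact horth i' i hi' hi
      exact this.symm (Submodule.mem_span_singleton_self _)
    -- As `u` is orthogonal to `A`, `V u = -U⁻¹ D U u`; hence `(u - V u) / 2` is the vector assumed
    -- to be close to the initial state. The two errors of `1/8` give `1/16` after squaring.
    have := norm_average_le V (T := T) (EuclideanSpace.single j 1) (u i)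
    rw [hVR, hA, map_neg, sub_neg_eq_add, norm_sub_rev] at this
    have h3 : ‖u i‖ / T ≤ 1 / 8 := by
      rw [div_le_iff₀ hT']
      linarith
    have h4 : ‖avg‖ ≤ 1 / 4 := by linarith
    calc ‖avg‖ ^ 2 ≤ (1 / 4) ^ 2 := pow_le_pow_left₀ (norm_nonneg _) h4 2
      _ = 1 / 16 := by norm_num
  by_cases ht : true ∈ G i <;> by_cases hf : false ∈ G i
  · have : ∀ b, b ∉ (G i)ᶜ := by rintro (_ | _) <;> simpa
    simp [Set.indicator, this]
  · have hb : ∀ x, ‖(E (U i)).1 x start‖ ^ 2 * (G i)ᶜ.indicator 1 (acc x) =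
        ‖(E (U i)).1 x start‖ ^ 2 - if acc x then ‖(E (U i)).1 x start‖ ^ 2 else 0 := by
      intro x
      cases acc x <;> simp [ht, hf]
    rw [Finset.sum_congr rfl fun x _ => hb x, Finset.sum_sub_distrib, hsum, hacc]
    linarith [hpos hf]
  · have hb : ∀ x, ‖(E (U i)).1 x start‖ ^ 2 * (G i)ᶜ.indicator 1 (acc x) =
        if acc x then ‖(E (U i)).1 x start‖ ^ 2 else 0 := by
      intro x
      cases acc x <;> simp [ht, hf]
    rw [Finset.sum_congr rfl fun x _ => hb x, hacc]
    exact hneg ht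
  -- No instance can forbid both answers: the acceptance probability would be at least `15/16` and
  -- at most `1/16`.
  · linarith [hpos hf, hneg ht]

end Test

/-! ### Witnesses for the threshold problem -/

section Reflection

variable {E : Type*} [NormedAddCommGroup E] [InnerProductSpace ℂ E] (R R' : E ≃ₗᵢ[ℂ] E)

/-- The projection of `e` to the vectors that are fixed by the reflection `R`. -/
def fixedPart (e : E) : E := (2 : ℂ)⁻¹ • (e + R e)

/-- The projection of `e` to the vectors that are negated by the reflection `R`. -/
def negatedPart (e : E) : E := (2 : ℂ)⁻¹ • (e - R e)

theorem fixedPart_add_negatedPart (e : E) : fixedPart R e + negatedPart R e = e := by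
  unfold fixedPart negatedPart
  module

variable {R R'}

theorem map_fixedPart (hR : ∀ x, R (R x) = x) (e : E) : R (fixedPart R e) = fixedPart R e := by
  simp only [fixedPart, map_smul, map_add, hR]
  rw [add_comm]

theorem map_negatedPart (hR : ∀ x, R (R x) = x) (e : E) :
    R (negatedPart R e) = -negatedPart R e := by
  simp only [negatedPart, map_smul, map_sub, hR]
  module

theorem inner_fixedPart_right {e : E} (he : ‖e‖ = 1) {x : ℝ}
    (hx : inner ℂ e (R e) = ((2 * x - 1 : ℝ) : ℂ)) : inner ℂ e (fixedPart R e) = (x : ℂ) := by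
  rw [fixedPart, inner_smul_right, inner_add_right, hx, inner_self_eq_norm_sq_to_K, he]
  push_cast
  ring

theorem inner_fixedPart_left {e : E} (he : ‖e‖ = 1) {x : ℝ}
    (hx : inner ℂ e (R e) = ((2 * x - 1 : ℝ) : ℂ)) : inner ℂ (fixedPart R e) e = (x : ℂ) := by
  rw [← inner_conj_symm, inner_fixedPart_right he hx, Complex.conj_ofReal]

/-- This is the parallelogram law for `e` and `R e`; it needs only that `R` is isometric. -/
theorem norm_sq_fixedPart_add {e : E} (he : ‖e‖ = 1) :
    ‖fixedPart R e‖ ^ 2 + ‖negatedPart R e‖ ^ 2 = 1 := by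
  have h := parallelogram_law_with_norm ℂ e (R e)
  rw [LinearIsometryEquiv.norm_map, he] at h
  simp only [fixedPart, negatedPart, norm_smul, mul_pow, norm_inv, Complex.norm_ofNat]
  linarith

/-- The difference of the values is a difference of inner products between fixed and negated
vectors. -/
theorem inner_fixedPart_negatedPart_sub {e : E} (he : ‖e‖ = 1) {x x' : ℝ}
    (hx : inner ℂ e (R e) = ((2 * x - 1 : ℝ) : ℂ))
    (hx' : inner ℂ e (R' e) = ((2 * x' - 1 : ℝ) : ℂ)) :
    inner ℂ (fixedPart R e) (negatedPart R' e) - inner ℂ (negatedPart R e) (fixedPart R' e) =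
      ((x - x' : ℝ) : ℂ) := by
  have h1 : negatedPart R' e = e - fixedPart R' e :=
    eq_sub_of_add_eq' (fixedPart_add_negatedPart R' e)
  have h2 : negatedPart R e = e - fixedPart R e :=
    eq_sub_of_add_eq' (fixedPart_add_negatedPart R e)
  rw [h1, h2, inner_sub_left, inner_sub_right, inner_fixedPart_left he hx,
    inner_fixedPart_right he hx']
  push_cast
  ring

end Reflection

/-! ### Factorization of `1 / (s + t)` -/

section Cayley

/-- The Cayley transform of the positive half-line to `(-1, 1)`. -/
def cayley (s : ℝ) : ℝ := (s - 1) / (s + 1)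

/-- This identity makes the geometric series in `cayley s * cayley t` sum to a multiple of `1 / (s +
t)`, with each term a product of a factor in `s` and a factor in `t`. -/
theorem one_sub_cayley_mul {s t : ℝ} (hs : 0 < s) (ht : 0 < t) :
    1 - cayley s * cayley t = 2 * (s + t) / ((s + 1) * (t + 1)) := by
  unfold cayley
  field_simp
  ring

theorem cayley_sq_lt_one {s : ℝ} (hs : 0 < s) : cayley s ^ 2 < 1 := by
  have := one_sub_cayley_mul hs hs
  have h2 : 0 < 2 * (s + s) / ((s + 1) * (s + 1)) := by positivity
  nlinarith

theorem abs_cayley_le {s m B : ℝ} (hm : 0 < m) (hm1 : m ≤ 1) (hB : 1 ≤ B) (h1 : m ≤ s)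
    (h2 : s ≤ B) : |cayley s| ≤ 1 - 2 * m / (B + 1) := by
  have hs : 0 < s + 1 := by linarith
  have hB' : 0 < B + 1 := by linarith
  have e1 : 1 - 2 * m / (B + 1) = (B + 1 - 2 * m) / (B + 1) := by field_simp
  rw [abs_le, e1, cayley]
  constructor
  · rw [neg_le_iff_add_nonneg, div_add_div _ _ hs.ne' hB'.ne']
    apply div_nonneg _ (by positivity)
    nlinarith
  · rw [div_le_div_iff₀ hs hB']
    nlinarith

/-- The diagonal case `t = s` of the factorization. The bound is uniform in `N`, so the truncation
length never enters the query count. -/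
theorem sum_cayley_sq_le {s : ℝ} (hs : 0 < s) (N : ℕ) :
    ∑ k ∈ Finset.range N, (cayley s ^ k / (s + 1)) ^ 2 ≤ 1 / (4 * s) := by
  have h1 := cayley_sq_lt_one hs
  have h0 := one_sub_cayley_mul hs hs
  have h2 : ∑ k ∈ Finset.range N, (cayley s ^ k / (s + 1)) ^ 2 =
      (∑ k ∈ Finset.range N, (cayley s ^ 2) ^ k) / (s + 1) ^ 2 := by
    rw [Finset.sum_div]
    refine Finset.sum_congr rfl fun k _ => ?_
    rw [div_pow, ← pow_mul, ← pow_mul, mul_comm]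
  have h3 : (∑ k ∈ Finset.range N, (cayley s ^ 2) ^ k) * (1 - cayley s ^ 2) =
      1 - (cayley s ^ 2) ^ N := geom_sum_mul_neg _ _
  have h4 : 1 - cayley s ^ 2 = 4 * s / (s + 1) ^ 2 := by
    rw [pow_two, h0]
    field_simp
    ring
  rw [h4] at h3
  have h5 : 0 ≤ (cayley s ^ 2) ^ N := by positivity
  rw [h2, div_le_div_iff₀ (by positivity) (by positivity)]
  have h6 : (∑ k ∈ Finset.range N, (cayley s ^ 2) ^ k) * (4 * s) =
      (1 - (cayley s ^ 2) ^ N) * (s + 1) ^ 2 := by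
    rw [← h3]
    field_simp
  rw [h6]
  nlinarith [sq_nonneg (s + 1)]

end Cayley

/-! ### Means as expectations of a reflection -/

section Coin

open Matrix (unitaryGroup)

variable {Q : Type} [Fintype Q] [DecidableEq Q]

/-- The average of `ν` over the result of a measurement of `U |q⟩`. -/
def bornMean (U : unitaryGroup Q ℂ) (ν : Q → ℝ) (q : Q) : ℝ := ∑ q', ‖U.1 q' q‖ ^ 2 * ν q'

/-- The reflection of a coin about the state `√ν |0⟩ + √(1 - ν) |1⟩`. -/
def coinEntry (ν : ℝ) : Bool → Bool → ℝ
  | false, false => 2 * ν - 1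
  | true, true => 1 - 2 * ν
  | _, _ => 2 * Real.sqrt (ν * (1 - ν))

theorem sum_coinEntry_mul {ν : ℝ} (h0 : 0 ≤ ν) (h1 : ν ≤ 1) (b b' : Bool) :
    ∑ c, coinEntry ν b c * coinEntry ν c b' = if b = b' then 1 else 0 := by
  have h := Real.mul_self_sqrt (mul_nonneg h0 (sub_nonneg.2 h1))
  cases b <;> cases b' <;> simp [coinEntry] <;> nlinarith

/-- The coin reflections, controlled by the query register. -/
def coinGate (ν : Q → ℝ) (hν : ∀ q, 0 ≤ ν q ∧ ν q ≤ 1) : unitaryGroup (Q × Bool) ℂ :=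
  ⟨Matrix.of fun x y => if x.1 = y.1 then (coinEntry (ν x.1) x.2 y.2 : ℂ) else 0, by
    rw [Matrix.mem_unitaryGroup_iff]
    ext ⟨q, b⟩ ⟨q', b'⟩
    rw [Matrix.mul_apply, Fintype.sum_prod_type, Finset.sum_eq_single q]
    · by_cases h : q = q'
      · subst h
        have := sum_coinEntry_mul (hν q).1 (hν q).2 b b'
        have hs : ∀ c, coinEntry (ν q) b' c = coinEntry (ν q) c b' := by
          intro c
          cases b' <;> cases c <;> rfl
        simp only [Matrix.of_apply, if_true, Matrix.star_apply, RCLike.star_def,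
          Complex.conj_ofReal, Matrix.one_apply, Prod.mk.injEq, true_and, hs]
        rw [show (if b = b' then (1 : ℂ) else 0) = ((if b = b' then (1 : ℝ) else 0 : ℝ) : ℂ) by
          split_ifs <;> simp, ← this]
        push_cast
        rfl
      · simp [h, Ne.symm h]
    · intro q'' _ h
      simp [h.symm]
    · simp⟩

theorem onQuery_inv (W : Type) [Fintype W] [DecidableEq W] (U : unitaryGroup Q ℂ) :
    onQuery W U⁻¹ = (onQuery W U)⁻¹ :=
  eq_inv_of_mul_eq_one_left (onQuery_inv_mul W U)

/-- The reflection `U⁻¹ D U`, for `D` the coin reflections. -/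
def coinReflection (ν : Q → ℝ) (hν : ∀ q, 0 ≤ ν q ∧ ν q ≤ 1) (U : unitaryGroup Q ℂ) :
    unitaryGroup (Q × Bool) ℂ :=
  onQuery Bool U⁻¹ * coinGate ν hν * onQuery Bool U

theorem coinGate_mul_self (ν : Q → ℝ) (hν : ∀ q, 0 ≤ ν q ∧ ν q ≤ 1) :
    coinGate ν hν * coinGate ν hν = 1 := by
  have : star (coinGate ν hν) = coinGate ν hν := by
    apply Subtype.ext
    ext ⟨q, b⟩ ⟨q', b'⟩
    by_cases h : q = q'
    · subst h
      cases b <;> cases b' <;>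
        simp [coinGate, coinEntry, Matrix.star_apply]
    · simp [coinGate, Matrix.star_apply, h, Ne.symm h]
  nth_rewrite 1 [← this]
  exact Unitary.star_mul_self (coinGate ν hν)

variable (ν : Q → ℝ) (hν : ∀ q, 0 ≤ ν q ∧ ν q ≤ 1) (U : unitaryGroup Q ℂ)

theorem coinReflection_involutive (x : EuclideanSpace ℂ (Q × Bool)) :
    unitaryAction (coinReflection ν hν U) (unitaryAction (coinReflection ν hν U) x) = x := by
  have : coinReflection ν hν U * coinReflection ν hν U = 1 := by
    rw [coinReflection, onQuery_inv]
    calc _ = (onQuery Bool U)⁻¹ * (coinGate ν hν * coinGate ν hν) * onQuery Bool U := by group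
      _ = 1 := by rw [coinGate_mul_self]; group
  have h2 := congrArg (fun G => unitaryAction G x) this
  simp only [map_mul, map_one] at h2
  exact h2

/-- After the query the coin is still in its state `false`, where the diagonal entry of the coin
reflection is `2 ν - 1`; averaging it with the Born weights leaves the mean. -/
theorem inner_coinReflection (q : Q) :
    inner ℂ (EuclideanSpace.single (q, false) 1)
      (unitaryAction (coinReflection ν hν U) (EuclideanSpace.single (q, false) 1)) =
      ((2 * bornMean U ν q - 1 : ℝ) : ℂ) := by
  set e : EuclideanSpace ℂ (Q × Bool) := EuclideanSpace.single (q, false) 1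
  set f := unitaryAction (onQuery Bool U) e
  have hf : ∀ q' b, f (q', b) = if b = false then U.1 q' q else 0 := by
    intro q' b
    simp only [f, e, unitaryAction_single, onQuery, Matrix.kroneckerMap_apply, Matrix.one_apply]
    simp
  have h1 : inner ℂ e (unitaryAction (coinReflection ν hν U) e) =
      inner ℂ f (unitaryAction (coinGate ν hν) f) := by
    rw [← LinearIsometryEquiv.inner_map_map (unitaryAction (onQuery Bool U)) e]
    have : unitaryAction (onQuery Bool U) (unitaryAction (coinReflection ν hν U) e) =
        unitaryAction (onQuery Bool U * coinReflection ν hν U) e := by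
      rw [map_mul]
      rfl
    rw [this, coinReflection, onQuery_inv, ← mul_assoc, ← mul_assoc, mul_inv_cancel, one_mul,
      map_mul]
    rfl
  have h2 : ∀ q', (unitaryAction (coinGate ν hν) f) (q', false) =
      ((2 * ν q' - 1 : ℝ) : ℂ) * U.1 q' q := by
    intro q'
    rw [unitaryAction_apply]
    simp only [Matrix.mulVec, dotProduct, Fintype.sum_prod_type]
    rw [Finset.sum_eq_single q']
    · simp [coinGate, hf, coinEntry]
    · intro q'' _ h
      simp [coinGate, h.symm]
    · simp
  rw [h1, PiLp.inner_apply, Fintype.sum_prod_type]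
  simp only [Fintype.sum_bool, hf, h2, RCLike.inner_apply]
  simp only [Bool.true_eq_false, if_false, map_zero, mul_zero, if_true, zero_add]
  have h3 : ∀ q', ((2 * ν q' - 1 : ℝ) : ℂ) * U.1 q' q * (starRingEnd ℂ) (U.1 q' q) =
      ((2 * (‖U.1 q' q‖ ^ 2 * ν q') - ‖U.1 q' q‖ ^ 2 : ℝ) : ℂ) := by
    intro q'
    rw [mul_assoc, Complex.mul_conj']
    push_cast
    ring
  rw [Finset.sum_congr rfl fun q' _ => h3 q', ← Complex.ofReal_sum, Finset.sum_sub_distrib,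
    sum_norm_sq_column, ← Finset.mul_sum, bornMean]

theorem bornMean_nonneg {ν : Q → ℝ} (hν : ∀ q, 0 ≤ ν q) (q : Q) : 0 ≤ bornMean U ν q :=
  Finset.sum_nonneg fun q' _ => mul_nonneg (sq_nonneg _) (hν q')

theorem bornMean_le_one {ν : Q → ℝ} (hν : ∀ q, ν q ≤ 1) (q : Q) : bornMean U ν q ≤ 1 := by
  rw [← sum_norm_sq_column U q]
  exact Finset.sum_le_sum fun q' _ => mul_le_of_le_one_right (sq_nonneg _) (hν q')

end Coin

/-! ### Vectors assembled from workspace sectors -/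

section Glue

open Matrix (unitaryGroup)

variable {Q W C : Type}

/-- The vector with components `f c` in the sectors `c` of the workspace. -/
def glue (f : C → EuclideanSpace ℂ (Q × W)) : EuclideanSpace ℂ (Q × Σ _ : C, W) :=
  WithLp.toLp 2 fun x => f x.2.1 (x.1, x.2.2)

theorem sum_sectors {Q W C α : Type*} [Fintype Q] [Fintype W] [Fintype C] [AddCommMonoid α]
    (f : Q × (Σ _ : C, W) → α) :
    ∑ x, f x = ∑ c : C, ∑ z : Q × W, f (z.1, ⟨c, z.2⟩) := by
  rw [Fintype.sum_prod_type]
  simp only [Fintype.sum_sigma, Fintype.sum_prod_type]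
  rw [Finset.sum_comm]

variable [Fintype Q] [Fintype W] [Fintype C]

theorem inner_glue (f g : C → EuclideanSpace ℂ (Q × W)) :
    inner ℂ (glue f) (glue g) = ∑ c, inner ℂ (f c) (g c) := by
  simp only [PiLp.inner_apply]
  rw [sum_sectors]
  rfl

theorem norm_sq_glue (f : C → EuclideanSpace ℂ (Q × W)) : ‖glue f‖ ^ 2 = ∑ c, ‖f c‖ ^ 2 := by
  simp only [EuclideanSpace.norm_sq_eq]
  rw [sum_sectors]
  rfl

variable [DecidableEq Q] [DecidableEq W] [DecidableEq C]

theorem unitaryAction_glue (E : C → unitaryGroup (Q × W) ℂ) (f : C → EuclideanSpace ℂ (Q × W)) :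
    unitaryAction (sigmaBlock E) (glue f) = glue fun c => unitaryAction (E c) (f c) := by
  ext ⟨q, c, w⟩
  rw [unitaryAction_apply]
  simp only [Matrix.mulVec, dotProduct]
  rw [sum_sectors, Finset.sum_eq_single c]
  · simp only [sigmaBlock_apply_same, glue, unitaryAction_apply, Matrix.mulVec, dotProduct]
  · intro c' _ h
    refine Finset.sum_eq_zero fun z _ => ?_
    rw [sigmaBlock_apply_ne _ _ _ h.symm, zero_mul]
  · simp

theorem single_eq_glue (q : Q) (c : C) (w : W) :
    EuclideanSpace.single (q, ⟨c, w⟩) (1 : ℂ) =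
      glue fun c' => if c' = c then EuclideanSpace.single (q, w) 1 else 0 := by
  ext ⟨q', c', w'⟩
  by_cases h : c' = c
  · subst h
    simp [glue]
  · simp [glue, h]

end Glue

/-! ### The threshold test -/

section Threshold

open Matrix (unitaryGroup)

variable {Q K : Type} [Fintype Q] [DecidableEq Q] [Fintype K] [DecidableEq K]

/-- The sectors of the workspace of the threshold test: the initial sector, one sector per arm,
and `2 N` sectors per arm for the geometric series. -/
abbrev Sector (K : Type) (N : ℕ) : Type := Option K ⊕ K × Bool × Fin N

instance sectorDecidableEq (N : ℕ) : DecidableEq (Sector K N) :=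
  inferInstance

theorem sum_sector {K α : Type*} [Fintype K] [AddCommMonoid α] {N : ℕ}
    (f : Option K ⊕ K × Bool × Fin N → α) :
    ∑ c, f c = f (.inl none) + ∑ a, f (.inl (some a)) +
      ∑ a, (∑ k, f (.inr (a, true, k)) + ∑ k, f (.inr (a, false, k))) := by
  simp only [Fintype.sum_sum_type, Fintype.sum_option, Fintype.sum_prod_type, Fintype.sum_bool]

/-- The gate between the two queries, in each sector. -/
def sectorGate {N : ℕ} (D : unitaryGroup (Q × Bool) ℂ) :
    Sector K N → unitaryGroup (Q × Bool) ℂ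
  | .inl _ => 1
  | .inr (_, false, _) => D
  | .inr (_, true, _) => -D

theorem conj_sectorGate {N : ℕ} (D : unitaryGroup (Q × Bool) ℂ) (U : unitaryGroup Q ℂ) :
    onQuery (Σ _ : Sector K N, Bool) U⁻¹ * sigmaBlock (sectorGate D) * onQuery _ U =
      sigmaBlock (sectorGate (onQuery Bool U⁻¹ * D * onQuery Bool U)) := by
  rw [onQuery_sigma, onQuery_sigma, sigmaBlock_mul, sigmaBlock_mul]
  congr 1
  funext c
  rcases c with _ | ⟨_, _ | _, _⟩
  · simp [sectorGate, onQuery_inv_mul]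
  · rfl
  · simp [sectorGate]

variable {H : Type*} [NormedAddCommGroup H] [InnerProductSpace ℂ H]

/-- The positive witness of the arm `a`. -/
def positiveWitness (N : ℕ) (κ s : ℝ) (a : K) (e g b : H) : Sector K N → H
  | .inl none => e
  | .inl (some a') => if a' = a then ((-cayley s ^ N : ℝ) : ℂ) • e else 0
  | .inr (a', false, k) =>
    if a' = a then ((-(κ * (cayley s ^ (k : ℕ) / (s + 1))) : ℝ) : ℂ) • g else 0
  | .inr (a', true, k) => if a' = a then ((κ * (cayley s ^ (k : ℕ) / (s + 1)) : ℝ) : ℂ) • b else 0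

/-- The negative witness. -/
def negativeWitness (N : ℕ) (κ : ℝ) (t : K → ℝ) (e : H) (g b : K → H) : Sector K N → H
  | .inl none => e
  | .inl (some a) => ((cayley (t a) ^ N : ℝ) : ℂ) • e
  | .inr (a, false, k) => ((2 * κ⁻¹ * (cayley (t a) ^ (k : ℕ) / (t a + 1)) : ℝ) : ℂ) • b a
  | .inr (a, true, k) => ((2 * κ⁻¹ * (cayley (t a) ^ (k : ℕ) / (t a + 1)) : ℝ) : ℂ) • g a

/-- The initial sector contributes `1`, the arm sector `-(cayley s * cayley (t a)) ^ N`, and the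
geometric sectors minus the truncated series `1 - (cayley s * cayley (t a)) ^ N`. The arm sector
thus compensates the truncation exactly. -/
theorem sum_inner_witness {N : ℕ} {κ s : ℝ} (hκ : κ ≠ 0) {t : K → ℝ} (a : K) (hs : 0 < s)
    (ht : 0 < t a) {e : H} (he : ‖e‖ = 1) {g b : H} {g' b' : K → H}
    (hgb : inner ℂ g (b' a) - inner ℂ b (g' a) = ((s + t a : ℝ) : ℂ)) :
    ∑ c, inner ℂ (positiveWitness N κ s a e g b c) (negativeWitness N κ t e g' b' c) = 0 := by
  rw [sum_sector, Finset.sum_eq_single a, Finset.sum_eq_single a]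
  · simp only [positiveWitness, negativeWitness, if_true, inner_smul_left, inner_smul_right,
      Complex.conj_ofReal, inner_self_eq_norm_sq_to_K, he]
    rw [← Finset.sum_add_distrib]
    -- The factors `κ` and `κ⁻¹` cancel, and `hgb` supplies the `s + t a` in the numerator of `1 -
    -- cayley s * cayley (t a)`.
    have h1 : ∀ k : Fin N, ((2 * κ⁻¹ * (cayley (t a) ^ (k : ℕ) / (t a + 1)) : ℝ) : ℂ) *
        (((κ * (cayley s ^ (k : ℕ) / (s + 1)) : ℝ) : ℂ) * inner ℂ b (g' a)) +
        ((2 * κ⁻¹ * (cayley (t a) ^ (k : ℕ) / (t a + 1)) : ℝ) : ℂ) *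
        (((-(κ * (cayley s ^ (k : ℕ) / (s + 1))) : ℝ) : ℂ) * inner ℂ g (b' a)) =
        ((-((1 - cayley s * cayley (t a)) * (cayley s * cayley (t a)) ^ (k : ℕ)) : ℝ) : ℂ) := by
      intro k
      rw [one_sub_cayley_mul hs ht]
      have : ((2 * (s + t a) / ((s + 1) * (t a + 1)) : ℝ) : ℂ) =
          ((2 / ((s + 1) * (t a + 1)) : ℝ) : ℂ) *
            (inner ℂ g (b' a) - inner ℂ b (g' a)) := by
        rw [hgb, ← Complex.ofReal_mul]
        congr 1
        ring
      rw [mul_pow]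
      simp only [Complex.ofReal_mul, Complex.ofReal_neg, Complex.ofReal_pow] at this ⊢
      rw [this]
      have h2 : (κ : ℂ) ≠ 0 := Complex.ofReal_ne_zero.2 hκ
      have h3 : ((s : ℂ) + 1) ≠ 0 := by exact_mod_cast (show s + 1 ≠ 0 by linarith)
      have h4 : ((t a : ℂ) + 1) ≠ 0 := by exact_mod_cast (show t a + 1 ≠ 0 by linarith)
      push_cast
      field_simp
      ring
    rw [Finset.sum_congr rfl fun k _ => h1 k, ← Complex.ofReal_sum, Finset.sum_neg_distrib,
      ← Finset.mul_sum, Fin.sum_univ_eq_sum_range (fun k => (cayley s * cayley (t a)) ^ k),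
      mul_neg_geom_sum, mul_pow]
    push_cast
    ring
  · intro a' _ h
    simp [positiveWitness, h]
  · simp
  · intro a' _ h
    simp [positiveWitness, h]
  · simp

theorem sum_norm_sq_positiveWitness_le {N : ℕ} {κ s : ℝ} (a : K) (hs : 0 < s)
    {e g b : H} (he : ‖e‖ = 1) (hgb : ‖g‖ ^ 2 + ‖b‖ ^ 2 = 1) :
    ∑ c, ‖positiveWitness N κ s a e g b c‖ ^ 2 ≤ 1 + (cayley s ^ N) ^ 2 + κ ^ 2 / (4 * s) := by
  rw [sum_sector, Finset.sum_eq_single a, Finset.sum_eq_single a]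
  · simp only [positiveWitness, if_true, norm_smul, mul_pow, he, Complex.norm_real, Real.norm_eq_abs,
      sq_abs, neg_sq]
    rw [← Finset.sum_mul, ← Finset.sum_mul, ← mul_add, add_comm (‖b‖ ^ 2), hgb, ← Finset.mul_sum,
      Fin.sum_univ_eq_sum_range (fun k => (cayley s ^ k / (s + 1)) ^ 2)]
    have := mul_le_mul_of_nonneg_left (sum_cayley_sq_le hs N) (sq_nonneg κ)
    rw [mul_one_div] at this
    linarith
  · intro a' _ h
    simp [positiveWitness, h]
  · simp
  · intro a' _ h
    simp [positiveWitness, h]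
  · simp

theorem sum_norm_sq_negativeWitness_le {N : ℕ} {κ : ℝ} {t : K → ℝ} (ht : ∀ a, 0 < t a)
    {e : H} {g b : K → H} (he : ‖e‖ = 1) (hgb : ∀ a, ‖g a‖ ^ 2 + ‖b a‖ ^ 2 = 1) :
    ∑ c, ‖negativeWitness N κ t e g b c‖ ^ 2 ≤
      1 + ∑ a, (cayley (t a) ^ N) ^ 2 + ∑ a, (κ⁻¹) ^ 2 / t a := by
  rw [sum_sector]
  have h1 : ∀ a, (∑ k, ‖negativeWitness N κ t e g b (.inr (a, true, k))‖ ^ 2 +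
      ∑ k, ‖negativeWitness N κ t e g b (.inr (a, false, k))‖ ^ 2) ≤ (κ⁻¹) ^ 2 / t a := by
    intro a
    simp only [negativeWitness, norm_smul, mul_pow, Complex.norm_real, Real.norm_eq_abs, sq_abs]
    rw [← Finset.sum_mul, ← Finset.sum_mul, ← mul_add, hgb, ← Finset.mul_sum,
      Fin.sum_univ_eq_sum_range (fun k => (cayley (t a) ^ k / (t a + 1)) ^ 2)]
    have := mul_le_mul_of_nonneg_left (sum_cayley_sq_le (ht a) N)
      (show 0 ≤ 2 ^ 2 * (κ⁻¹) ^ 2 by positivity)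
    have h2 : 2 ^ 2 * (κ⁻¹) ^ 2 * (1 / (4 * t a)) = (κ⁻¹) ^ 2 / t a := by
      have := (ht a).ne'
      field_simp
      norm_num
    linarith
  refine add_le_add (le_of_eq ?_) (Finset.sum_le_sum fun a _ => h1 a)
  simp only [negativeWitness, norm_smul, Complex.norm_real, Real.norm_eq_abs, sq_abs, he, mul_one,
    one_pow]

theorem unitaryAction_positiveWitness {N : ℕ} {κ s : ℝ} (a : K) (R : unitaryGroup (Q × Bool) ℂ)
    {e g b : EuclideanSpace ℂ (Q × Bool)} (hg : unitaryAction R g = g)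
    (hb : unitaryAction R b = -b) (c : Sector K N) :
    unitaryAction (sectorGate R c) (positiveWitness N κ s a e g b c) =
      positiveWitness N κ s a e g b c := by
  rcases c with (_ | a') | ⟨a', _ | _, k⟩
  · simp [sectorGate]
  · simp [sectorGate]
  · simp only [sectorGate, positiveWitness]
    split_ifs
    · rw [map_smul, hg]
    · exact map_zero _
  · simp only [sectorGate, positiveWitness]
    split_ifs
    · rw [map_smul, unitaryAction_neg, hb, neg_neg]
    · exact map_zero _

/-- The signs in `sectorGate` are chosen so that the geometric sectors of the positive witness are
fixed while those of the negative witness are negated; they then disappear from `u + U⁻¹ D U u`. -/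
theorem unitaryAction_negativeWitness {N : ℕ} {κ : ℝ} {t : K → ℝ}
    (R : unitaryGroup (Q × Bool) ℂ) {e : EuclideanSpace ℂ (Q × Bool)}
    {g b : K → EuclideanSpace ℂ (Q × Bool)} (hg : ∀ a, unitaryAction R (g a) = g a)
    (hb : ∀ a, unitaryAction R (b a) = -b a) (c : Sector K N) :
    unitaryAction (sectorGate R c) (negativeWitness N κ t e g b c) =
      match c with
      | .inl o => negativeWitness N κ t e g b (.inl o)
      | .inr x => -negativeWitness N κ t e g b (.inr x) := by
  rcases c with (_ | a') | ⟨a', _ | _, k⟩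
  · simp [sectorGate]
  · simp [sectorGate]
  · simp only [sectorGate, negativeWitness]
    rw [map_smul, hb, smul_neg]
  · simp only [sectorGate, negativeWitness]
    rw [map_smul, unitaryAction_neg, hg, smul_neg]

/-- The part of the negative witness that is not seen by the initial state is small. -/
theorem norm_sq_negativeWitness_error {N : ℕ} {κ : ℝ} {t : K → ℝ}
    (R : unitaryGroup (Q × Bool) ℂ) {q : Q} {g b : K → EuclideanSpace ℂ (Q × Bool)}
    (hg : ∀ a, unitaryAction R (g a) = g a) (hb : ∀ a, unitaryAction R (b a) = -b a) :
    ‖(2 : ℂ)⁻¹ • (glue (negativeWitness N κ t (EuclideanSpace.single (q, false) 1) g b) +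
        unitaryAction (sigmaBlock (sectorGate R))
          (glue (negativeWitness N κ t (EuclideanSpace.single (q, false) 1) g b))) -
      EuclideanSpace.single (q, ⟨.inl none, false⟩) 1‖ ^ 2 = ∑ a, (cayley (t a) ^ N) ^ 2 := by
  have h1 : (2 : ℂ)⁻¹ • (glue (negativeWitness N κ t (EuclideanSpace.single (q, false) 1) g b) +
        unitaryAction (sigmaBlock (sectorGate R))
          (glue (negativeWitness N κ t (EuclideanSpace.single (q, false) 1) g b))) -
      EuclideanSpace.single (q, ⟨.inl none, false⟩) (1 : ℂ) =
      glue fun c : Sector K N => match c with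
        | .inl (some a) =>
          ((cayley (t a) ^ N : ℝ) : ℂ) • EuclideanSpace.single (q, false) (1 : ℂ)
        | _ => 0 := by
    rw [unitaryAction_glue, single_eq_glue]
    ext ⟨q', c, w⟩
    simp only [glue, unitaryAction_negativeWitness R hg hb, PiLp.sub_apply, PiLp.smul_apply,
      PiLp.add_apply]
    rcases c with (_ | a') | ⟨a', _ | _, k⟩
    · simp [negativeWitness, ← two_mul]
    · simp [negativeWitness, ← two_mul]
    · simp
    · simp
  rw [h1, norm_sq_glue, sum_sector]
  simp only [norm_smul, Complex.norm_real, Real.norm_eq_abs, PiLp.norm_single, norm_one,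
    mul_one, sq_abs, norm_zero, ne_eq, OfNat.ofNat_ne_zero, not_false_eq_true, zero_pow,
    Finset.sum_const_zero, add_zero, zero_add]

/-- On a compact interval of positive gaps the Cayley transform stays away from `±1`. The factor
`card K` allows the errors to be summed over all arms. -/
theorem exists_pow_cayley_le [Nonempty K] {m B : ℝ} (hm : 0 < m) (hm1 : m ≤ 1) (hB : 1 ≤ B) :
    ∃ N : ℕ, ∀ s, m ≤ s → s ≤ B → (cayley s ^ N) ^ 2 ≤ 1 / (64 * Fintype.card K) := by
  have hK : (1 : ℝ) ≤ Fintype.card K := by exact_mod_cast Fintype.card_pos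
  have hρ : 1 - 2 * m / (B + 1) < 1 := by
    have : 0 < 2 * m / (B + 1) := by positivity
    linarith
  obtain ⟨N, hN⟩ := exists_pow_lt_of_lt_one
    (show (0 : ℝ) < 1 / (8 * Fintype.card K) by positivity) hρ
  refine ⟨N, fun s h1 h2 => ?_⟩
  have h3 : |cayley s ^ N| ≤ 1 / (8 * Fintype.card K) := by
    rw [abs_pow]
    exact (pow_le_pow_left₀ (abs_nonneg _) (abs_cayley_le hm hm1 hB h1 h2) N).trans hN.le
  rw [← sq_abs]
  refine (pow_le_pow_left₀ (abs_nonneg _) h3 2).trans ?_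
  rw [div_pow, one_pow, mul_pow]
  apply one_div_le_one_div_of_le (by positivity)
  nlinarith

/-- To decide whether some mean is at least `τ a + h` or all of them are at most `τ a` takes
`O(√K / h)` queries. -/
theorem solves_threshold [Nonempty K] (q : K → Q) (ν : Q → ℝ) (hν : ∀ x, 0 ≤ ν x ∧ ν x ≤ 1)
    (τ : K → ℝ) {h : ℝ} (hh : 0 < h) (hh1 : h ≤ 1) :
    ∃ n : ℕ, (n : ℝ) ≤ 49 * Real.sqrt (Fintype.card K) / h ∧
      Solves (fun U : unitaryGroup Q ℂ => U) n (1 / 16) fun U =>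
        {b : Bool | (b = true → ∃ a, τ a < bornMean U ν (q a)) ∧
          (b = false → ∀ a, bornMean U ν (q a) < τ a + h)} := by
  classical
  have hK : (1 : ℝ) ≤ Fintype.card K := by exact_mod_cast Fintype.card_pos
  have hsK : 1 ≤ Real.sqrt (Fintype.card K) := Real.one_le_sqrt.2 hK
  have hsK2 : Real.sqrt (Fintype.card K) ^ 2 = Fintype.card K := Real.sq_sqrt (by linarith)
  -- Taking the midpoint as the threshold gives a gap of at least `h / 2` whenever one of the
  -- answers is forbidden.
  let σ : K → ℝ := fun a => τ a + h / 2
  let B : ℝ := 1 + ∑ a, |σ a|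
  have hσB : ∀ a, |σ a| ≤ ∑ a, |σ a| := fun a =>
    Finset.single_le_sum (f := fun a => |σ a|) (fun _ _ => abs_nonneg _) (Finset.mem_univ a)
  have hB1 : 1 ≤ B := le_add_of_nonneg_right (Finset.sum_nonneg fun _ _ => abs_nonneg _)
  obtain ⟨N, hN⟩ := exists_pow_cayley_le (K := K) (half_pos hh) (by linarith) hB1
  have hx0 : ∀ U a, 0 ≤ bornMean U ν (q a) := fun U a => bornMean_nonneg U (fun x => (hν x).1) _
  have hx1 : ∀ U a, bornMean U ν (q a) ≤ 1 := fun U a => bornMean_le_one U (fun x => (hν x).2) _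
  have hNs : ∀ U a, h / 2 ≤ bornMean U ν (q a) - σ a →
      (cayley (bornMean U ν (q a) - σ a) ^ N) ^ 2 ≤ 1 / (64 * Fintype.card K) := fun U a hs =>
    hN _ hs (by linarith [hσB a, neg_abs_le (σ a), hx1 U a])
  have hNt : ∀ U a, h / 2 ≤ σ a - bornMean U ν (q a) →
      (cayley (σ a - bornMean U ν (q a)) ^ N) ^ 2 ≤ 1 / (64 * Fintype.card K) := fun U a hs =>
    hN _ hs (by linarith [hσB a, le_abs_self (σ a), hx0 U a])
  -- `κ` shifts the weight to the negative witnesses: the positive norm squared stays below `1 +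
  -- 1/64 + 1/32`, while the negative norm is at most `6 √K / h`, an eighth of the lower bound on
  -- `T`.
  set κ := Real.sqrt (h / 16)
  have hκ2 : κ ^ 2 = h / 16 := Real.sq_sqrt (by positivity)
  have hκ : κ ≠ 0 := (Real.sqrt_pos.2 (by positivity)).ne'
  set T := ⌈48 * Real.sqrt (Fintype.card K) / h⌉₊
  have hKh : 1 ≤ Real.sqrt (Fintype.card K) / h := by
    rw [one_le_div hh]
    linarith
  have hT1 : 48 * (Real.sqrt (Fintype.card K) / h) ≤ T := by
    rw [← mul_div_assoc]
    exact Nat.le_ceil _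
  have hT2 : (T : ℝ) ≤ 49 * Real.sqrt (Fintype.card K) / h := by
    have h1 := (Nat.ceil_lt_add_one
      (show 0 ≤ 48 * Real.sqrt (Fintype.card K) / h by positivity)).le
    have h2 : 49 * Real.sqrt (Fintype.card K) / h =
      48 * Real.sqrt (Fintype.card K) / h + Real.sqrt (Fintype.card K) / h := by ring
    rw [h2]
    linarith
  have hT0 : 0 < T := by
    have : (0 : ℝ) < T := by linarith
    exact_mod_cast this
  refine ⟨T, hT2, ?_⟩
  set G : unitaryGroup Q ℂ → Set Bool := fun U =>
    {b : Bool | (b = true → ∃ a, τ a < bornMean U ν (q a)) ∧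
      (b = false → ∀ a, bornMean U ν (q a) < τ a + h)} with hG
  have hfalse : ∀ U, false ∉ G U → ∃ a, h / 2 ≤ bornMean U ν (q a) - σ a := by
    intro U hU
    by_contra! hc
    refine hU ⟨by simp, fun _ a => ?_⟩
    have := hc a
    simp only [σ] at this
    linarith
  have htrue : ∀ U, true ∉ G U → ∀ a, h / 2 ≤ σ a - bornMean U ν (q a) := by
    intro U hU a
    by_contra! hc
    refine hU ⟨fun _ => ⟨a, ?_⟩, by simp⟩
    simp only [σ] at hc
    linarith
  -- For a positive instance, an arm above its threshold with gap at least `h / 2`; otherwise a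
  -- default value that is never used.
  let arm : unitaryGroup Q ℂ → K := fun U =>
    if hU : false ∉ G U then (hfalse U hU).choose else Classical.arbitrary K
  have harm : ∀ U, false ∉ G U → h / 2 ≤ bornMean U ν (q (arm U)) - σ (arm U) := by
    intro U hU
    simp only [arm, dif_pos hU]
    exact (hfalse U hU).choose_spec
  let q₀ : Q := q (Classical.arbitrary K)
  let e : Q → EuclideanSpace ℂ (Q × Bool) := fun x => EuclideanSpace.single (x, false) 1
  have he : ∀ x, ‖e x‖ = 1 := fun x => by simp [e]
  let R : unitaryGroup Q ℂ → unitaryGroup (Q × Bool) ℂ := coinReflection ν hν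
  let g : unitaryGroup Q ℂ → K → EuclideanSpace ℂ (Q × Bool) := fun U a =>
    fixedPart (unitaryAction (R U)) (e (q a))
  let b : unitaryGroup Q ℂ → K → EuclideanSpace ℂ (Q × Bool) := fun U a =>
    negatedPart (unitaryAction (R U)) (e (q a))
  have hg : ∀ U a, unitaryAction (R U) (g U a) = g U a := fun U a =>
    map_fixedPart (coinReflection_involutive ν hν U) _
  have hb : ∀ U a, unitaryAction (R U) (b U a) = -b U a := fun U a =>
    map_negatedPart (coinReflection_involutive ν hν U) _
  have hgb : ∀ U a, ‖g U a‖ ^ 2 + ‖b U a‖ ^ 2 = 1 := fun U a => norm_sq_fixedPart_add (he _)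
  refine solves_of_witnesses (sigmaBlock (sectorGate (K := K) (N := N) (coinGate ν hν)))
    (q₀, ⟨.inl none, false⟩) hT0
    (fun U => glue (positiveWitness N κ (bornMean U ν (q (arm U)) - σ (arm U)) (arm U) (e q₀)
      (g U (arm U)) (b U (arm U))))
    (fun U => glue (negativeWitness N κ (fun a => σ a - bornMean U ν (q a)) (e q₀) (g U) (b U)))
    (fun U hU => ⟨?_, ?_, ?_⟩) (fun U hU => ⟨?_, ?_⟩) fun U U' hU hU' => ?_
  · rw [conj_sectorGate, unitaryAction_glue]
    congr 1
    funext c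
    exact unitaryAction_positiveWitness _ _ (hg _ _) (hb _ _) c
  · simp [glue, positiveWitness, e]
  · rw [norm_sq_glue]
    have hs := harm U hU
    refine (sum_norm_sq_positiveWitness_le _ (by linarith) (he _) (hgb _ _)).trans ?_
    have h1 := hNs U _ hs
    have h2 : 1 / (64 * (Fintype.card K : ℝ)) ≤ 1 / 64 :=
      one_div_le_one_div_of_le (by norm_num) (by linarith)
    have h3 : κ ^ 2 / (4 * (bornMean U ν (q (arm U)) - σ (arm U))) ≤ 1 / 32 := by
      rw [hκ2, div_le_div_iff₀ (by linarith) (by norm_num)]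
      linarith
    linarith
  · rw [conj_sectorGate, ← sq_le_sq₀ (norm_nonneg _) (by norm_num)]
    have h1 := norm_sq_negativeWitness_error (N := N) (κ := κ)
      (t := fun a => σ a - bornMean U ν (q a)) (R U) (q := q₀) (hg U) (hb U)
    refine (le_of_eq h1).trans ((Finset.sum_le_sum fun a _ => hNt U a (htrue U hU a)).trans ?_)
    rw [Finset.sum_const, Finset.card_univ, nsmul_eq_mul]
    apply le_of_eq
    field_simp
    norm_num
  · have h0 : ∀ a, 0 < σ a - bornMean U ν (q a) := fun a => by linarith [htrue U hU a]
    have h1 := sum_norm_sq_negativeWitness_le (N := N) (κ := κ) h0 (he q₀) (hgb U)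
    rw [← norm_sq_glue] at h1
    have h2 : ∑ a, (cayley (σ a - bornMean U ν (q a)) ^ N) ^ 2 ≤ 1 / 64 := by
      refine (Finset.sum_le_sum fun a _ => hNt U a (htrue U hU a)).trans (le_of_eq ?_)
      rw [Finset.sum_const, Finset.card_univ, nsmul_eq_mul]
      field_simp
    have h3 : ∑ a, (κ⁻¹) ^ 2 / (σ a - bornMean U ν (q a)) ≤
        32 * (Real.sqrt (Fintype.card K) / h) ^ 2 := by
      have : ∀ a, (κ⁻¹) ^ 2 / (σ a - bornMean U ν (q a)) ≤ 32 / h ^ 2 := by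
        intro a
        rw [inv_pow, hκ2, inv_div, div_div, div_le_div_iff₀ (mul_pos hh (h0 a)) (by positivity)]
        have := mul_le_mul_of_nonneg_left (htrue U hU a) hh.le
        nlinarith
      refine (Finset.sum_le_sum fun a _ => this a).trans (le_of_eq ?_)
      rw [Finset.sum_const, Finset.card_univ, nsmul_eq_mul, div_pow, hsK2]
      ring
    have h4 : ‖glue (negativeWitness N κ (fun a => σ a - bornMean U ν (q a)) (e q₀) (g U)
        (b U))‖ ^ 2 ≤ (6 * (Real.sqrt (Fintype.card K) / h)) ^ 2 := by
      nlinarith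
    have h5 := (sq_le_sq₀ (norm_nonneg _) (by positivity)).1 h4
    linarith
  · rw [inner_glue]
    have hs := harm U hU
    have ht := htrue U' hU' (arm U)
    refine sum_inner_witness hκ _ (by linarith) (by linarith) (he q₀) ?_
    -- The threshold `σ` cancels in `s + t`, leaving the difference of the means under the two
    -- oracles.
    rw [inner_fixedPart_negatedPart_sub (he _) (inner_coinReflection ν hν U _)
      (inner_coinReflection ν hν U' _)]
    congr 1
    ring

end Threshold

/-! ### Search for the maximum -/

section Search

open Matrix (unitaryGroup)

variable {Q Out Out' : Type} [Fintype Q] [DecidableEq Q]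

/-- For every oracle `U` an output in `G U` is found with probability at least `1 - f`, with at
most `c` pairs of queries. -/
def SolvesIn (c f : ℝ) (G : unitaryGroup Q ℂ → Set Out) : Prop :=
  Solves (fun U : unitaryGroup Q ℂ => U) ⌊c⌋₊ f G

/-- The factor `log (1 / f) + 10`. -/
def logFactor (f : ℝ) : ℝ := 10 - Real.log f

theorem ten_le_logFactor {f : ℝ} (hf : 0 < f) (hf1 : f ≤ 1) : 10 ≤ logFactor f := by
  have := Real.log_nonpos hf.le hf1
  unfold logFactor
  linarith

/-- Halving `f` adds `log 2 < 0.7`, at most 7 percent of a quantity that is at least `10`. The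
summand `10` in `logFactor` is there to make this ratio small compared with the growth rates of the
recursions below. -/
theorem logFactor_half_le {f : ℝ} (hf : 0 < f) (hf1 : f ≤ 1) :
    logFactor (f / 2) ≤ 1.07 * logFactor f := by
  have h1 := ten_le_logFactor hf hf1
  have h2 := Real.log_two_lt_d9
  unfold logFactor at *
  rw [Real.log_div hf.ne' two_ne_zero]
  linarith

namespace SolvesIn

variable {c c₁ c₂ f f₁ f₂ : ℝ} {G : unitaryGroup Q ℂ → Set Out}

theorem of_solves {n : ℕ} (h : Solves (fun U : unitaryGroup Q ℂ => U) n f G) (hn : (n : ℝ) ≤ c) :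
    SolvesIn c f G :=
  h.mono (Nat.le_floor hn) (fun _ => subset_rfl) le_rfl

theorem mono (h : SolvesIn c₁ f G) {G' : unitaryGroup Q ℂ → Set Out} (hc : c₁ ≤ c₂)
    (hG : ∀ U, G U ⊆ G' U) : SolvesIn c₂ f G' :=
  Solves.mono h (Nat.floor_mono hc) hG le_rfl

theorem pure [Nonempty Q] (o : Out) (hf : 0 ≤ f) (h : ∀ U, o ∈ G U) : SolvesIn c f G :=
  (Solves.pure o hf h).mono (Nat.zero_le _) (fun _ => subset_rfl) le_rfl

theorem map (g : Out → Out') {G' : unitaryGroup Q ℂ → Set Out'}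
    (h : SolvesIn c f fun U => g ⁻¹' G' U) : SolvesIn c f G' :=
  Solves.map g h

theorem bind (hc₁ : 0 ≤ c₁) (hc₂ : 0 ≤ c₂) (h₁ : SolvesIn c₁ f₁ G)
    {G₂ : unitaryGroup Q ℂ → Set Out'} (hf₂ : 0 ≤ f₂)
    (h₂ : ∀ o, SolvesIn c₂ f₂ fun U => {o' | o ∈ G U → o' ∈ G₂ U}) :
    SolvesIn (c₁ + c₂) (f₁ + f₂) G₂ := by
  refine (Solves.bind h₁ hf₂ h₂).mono ?_ (fun _ => subset_rfl) le_rfl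
  apply Nat.le_floor
  push_cast
  exact add_le_add (Nat.floor_le hc₁) (Nat.floor_le hc₂)

end SolvesIn

variable {𝒜 : Type} [Fintype 𝒜] [DecidableEq 𝒜] (q : 𝒜 → Q)

/-- The value of the arm `a`: a known offset plus an unknown mean. -/
def armValue (ρ : 𝒜 → ℝ) (ν : Q → ℝ) (U : unitaryGroup Q ℂ) (a : 𝒜) : ℝ := ρ a + bornMean U ν (q a)

theorem solvesIn_threshold {ν : Q → ℝ} (hν : ∀ x, 0 ≤ ν x ∧ ν x ≤ 1) (ρ : 𝒜 → ℝ)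
    (X : Finset 𝒜) (hX : X.Nonempty) (θ : ℝ) {h f : ℝ} (hh : 0 < h)
    (hh1 : h ≤ 1) (hf : 0 < f) (hf1 : f ≤ 1) :
    SolvesIn (98 * (Real.sqrt X.card / h) * logFactor f) f fun U : unitaryGroup Q ℂ =>
      {b : Bool | (b = true → ∃ a ∈ X, θ < armValue q ρ ν U a) ∧
        (b = false → ∀ a ∈ X, armValue q ρ ν U a < θ + h)} := by
  have : Nonempty X := hX.to_subtype
  have : Nonempty Q := ⟨q hX.choose⟩
  obtain ⟨n, hn, hs⟩ := solves_threshold (fun a : X => q a) ν hν (fun a => θ - ρ a) hh hh1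
  obtain ⟨k, hk, hs⟩ := hs.amplify hf hf1
  refine (SolvesIn.of_solves hs (c := 98 * (Real.sqrt X.card / h) * logFactor f) ?_).mono le_rfl
    fun U b hb => ⟨fun h => ?_, fun h a ha => ?_⟩
  · rw [Fintype.card_coe] at hn
    have h1 : (k : ℝ) ≤ 2 * logFactor f := by
      unfold logFactor
      linarith
    push_cast
    calc (n : ℝ) * k ≤ (49 * Real.sqrt X.card / h) * (2 * logFactor f) := by gcongr
      _ = _ := by ring
  · obtain ⟨a, ha⟩ := hb.1 h
    exact ⟨a, a.2, by unfold armValue; linarith⟩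
  · have := hb.2 h ⟨a, ha⟩
    unfold armValue
    linarith

/-- Each threshold test at one third of the current interval, with tolerance one third, discards a
third of it. The cost grows by `3/2` per step, faster than the `1.07` of the log factor, so the sum
over all steps stays proportional to the last term. -/
theorem solvesIn_value [Nonempty 𝒜] {ν : Q → ℝ} (hν : ∀ x, 0 ≤ ν x ∧ ν x ≤ 1) (ρ : 𝒜 → ℝ)
    (j : ℕ) {f : ℝ} (hf : 0 < f) (hf1 : f ≤ 1) :
    SolvesIn (800 * (Real.sqrt (Fintype.card 𝒜) * (3 / 2) ^ j) * logFactor f) f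
      fun U : unitaryGroup Q ℂ => {lo : ℝ | (∀ a, armValue q ρ ν U a ≤ lo + (2 / 3) ^ j) ∧
        ∃ a, lo ≤ armValue q ρ ν U a} := by
  have : Nonempty Q := Nonempty.map q inferInstance
  induction j generalizing f with
  | zero =>
    obtain ⟨a₀, ha₀⟩ := Finite.exists_max ρ
    -- All means lie in `[0, 1]`, so the largest offset already locates the maximum within `1`,
    -- without a query.
    refine SolvesIn.pure (ρ a₀) hf.le fun U => ⟨fun a => ?_, a₀, ?_⟩
    · have := bornMean_le_one U (fun x => (hν x).2) (q a)
      simp only [armValue, pow_zero]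
      linarith [ha₀ a]
    · have := bornMean_nonneg U (fun x => (hν x).1) (q a₀)
      simp only [armValue]
      linarith
  | succ j ih =>
    set d : ℝ := (2 / 3) ^ j with hd
    have hd0 : 0 < d := by positivity
    have hd1 : d ≤ 1 := pow_le_one₀ (by norm_num) (by norm_num)
    have hdi : (3 / 2 : ℝ) ^ j = d⁻¹ := by
      rw [hd, ← inv_pow]
      norm_num
    have hl0 : 10 ≤ logFactor (f / 2) := ten_le_logFactor (by linarith) (by linarith)
    have h1 := ih (half_pos hf) (by linarith)
    have h2 := fun lo : ℝ => solvesIn_threshold q hν ρ Finset.univ Finset.univ_nonempty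
      (lo + d / 3) (h := d / 3) (by positivity) (by linarith) (half_pos hf) (by linarith)
    rw [← add_halves f]
    refine (SolvesIn.bind (c₂ := 98 * (Real.sqrt (Finset.univ : Finset 𝒜).card / (d / 3)) *
      logFactor (f / 2)) (by positivity) (by positivity) h1 (half_pos hf).le fun lo => ?_).mono ?_
      fun U => subset_rfl
    · refine SolvesIn.map (fun b : Bool => if b then lo + d / 3 else lo) ((h2 lo).mono le_rfl
        fun U b hb => ?_)
      rintro ⟨hlo1, hlo2⟩
      rw [pow_succ, ← hd]
      rcases b with _ | _
      · refine ⟨fun a => ?_, ?_⟩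
        · have := hb.2 rfl a (Finset.mem_univ a)
          simp only [Bool.false_eq_true, if_false]
          linarith
        · simpa using hlo2
      · refine ⟨fun a => ?_, ?_⟩
        · have := hlo1 a
          simp only [if_true]
          linarith
        · obtain ⟨a, -, ha⟩ := hb.1 rfl
          exact ⟨a, by simpa using ha.le⟩
    · rw [add_halves, Finset.card_univ, pow_succ, hdi]
      have h3 := logFactor_half_le hf hf1
      set S := Real.sqrt (Fintype.card 𝒜)
      calc 800 * (S * d⁻¹) * logFactor (f / 2) + 98 * (S / (d / 3)) * logFactor (f / 2)
          = 1094 * (S * d⁻¹) * logFactor (f / 2) := by field_simp; ring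
        _ ≤ 1094 * (S * d⁻¹) * (1.07 * logFactor f) := by gcongr
        _ ≤ 800 * (S * (d⁻¹ * (3 / 2))) * logFactor f := by
          have : 0 ≤ S * d⁻¹ * logFactor f :=
            mul_nonneg (by positivity) (by linarith [ten_le_logFactor hf hf1])
          linarith

/-- Binary search over arms: a test on `2 ^ n` of them decides which part to keep. The slack shrinks
by `9/10` per level to pay for the tolerance of the test, so costs are multiplied by `10/9 · 1.07`
going down, still less than the `√2` gained by halving the set. -/
theorem solvesIn_arm {ν : Q → ℝ} (hν : ∀ x, 0 ≤ ν x ∧ ν x ≤ 1) (ρ : 𝒜 → ℝ)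
    (n : ℕ) (X : Finset 𝒜) (hX : X.Nonempty) (hn : X.card ≤ 2 ^ n) (lo : ℝ)
    {h f : ℝ} (hh : 0 < h) (hh1 : h ≤ 1) (hf : 0 < f) (hf1 : f ≤ 1) :
    SolvesIn (5000 * (Real.sqrt 2 ^ n / h) * logFactor f) f
      fun U : unitaryGroup Q ℂ => {a : 𝒜 | (∃ a' ∈ X, lo ≤ armValue q ρ ν U a') →
        lo - h < armValue q ρ ν U a} := by
  have : Nonempty Q := ⟨q hX.choose⟩
  have hs2 : (1.41 : ℝ) ≤ Real.sqrt 2 := Real.le_sqrt_of_sq_le (by norm_num)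
  induction n generalizing X lo h f with
  | zero =>
    obtain ⟨a, rfl⟩ := Finset.card_eq_one.1 (le_antisymm hn hX.card_pos)
    refine SolvesIn.pure a hf.le fun U hU => ?_
    obtain ⟨a', ha', h2⟩ := hU
    rw [Finset.mem_singleton.1 ha'] at h2
    linarith
  | succ n ih =>
    by_cases hXn : X.card ≤ 2 ^ n
    · refine (ih X hX hXn lo hh hh1 hf hf1).mono ?_ fun U => subset_rfl
      have := ten_le_logFactor hf hf1
      gcongr
      · linarith
      · exact n.le_succ
    obtain ⟨Y, hYX, hY⟩ := Finset.exists_subset_card_eq (le_of_not_ge hXn)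
    have hYne : Y.Nonempty := Finset.card_pos.1 (by rw [hY]; positivity)
    have hZ : (X \ Y).card = X.card - 2 ^ n := by rw [Finset.card_sdiff_of_subset hYX, hY]
    have hZne : (X \ Y).Nonempty := Finset.card_pos.1 (by omega)
    have hl0 : 10 ≤ logFactor (f / 2) := ten_le_logFactor (by linarith) (by linarith)
    have h1 := solvesIn_threshold q hν ρ Y hYne (lo - h / 10) (h := h / 10) (by positivity)
      (by linarith) (half_pos hf) (by linarith)
    have h2 := ih Y hYne hY.le (lo - h / 10) (h := 9 / 10 * h) (by positivity)
      (by linarith) (half_pos hf) (by linarith)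
    have h3 := ih (X \ Y) hZne (by rw [hZ, pow_succ] at *; omega) (lo - h / 10) (h := 9 / 10 * h)
      (by positivity) (by linarith) (half_pos hf) (by linarith)
    rw [← add_halves f]
    refine (SolvesIn.bind (c₂ := 5000 * (Real.sqrt 2 ^ n / (9 / 10 * h)) * logFactor (f / 2))
      (by positivity) (by positivity) h1 (half_pos hf).le fun b => ?_).mono ?_ fun U => subset_rfl
    · cases b
      · refine h3.mono le_rfl fun U a ha hb hlo => ?_
        obtain ⟨a', ha', hlo⟩ := hlo
        have hbY := hb.2 rfl
        -- The answer `false` puts all of `Y` strictly below `lo`, so the promised arm is in the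
        -- other part.
        have : a' ∈ X \ Y := by
          refine Finset.mem_sdiff.2 ⟨ha', fun hY => ?_⟩
          linarith [hbY a' hY]
        have := ha ⟨a', this, by linarith⟩
        linarith
      · refine h2.mono le_rfl fun U a ha hb hlo => ?_
        obtain ⟨a', ha', hlt⟩ := hb.1 rfl
        have := ha ⟨a', ha', hlt.le⟩
        linarith
    · rw [add_halves, hY]
      have hsn : Real.sqrt ((2 ^ n : ℕ) : ℝ) = Real.sqrt 2 ^ n := by
        rw [Nat.cast_pow, Nat.cast_ofNat, Real.sqrt_eq_iff_mul_self_eq (by positivity)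
          (by positivity), ← mul_pow, Real.mul_self_sqrt (by norm_num)]
      rw [hsn, pow_succ]
      have h4 := logFactor_half_le hf hf1
      set S := Real.sqrt 2 ^ n
      have hS : 0 < S := by positivity
      calc 98 * (S / (h / 10)) * logFactor (f / 2) +
            5000 * (S / (9 / 10 * h)) * logFactor (f / 2)
          = (980 + 50000 / 9) * (S / h) * logFactor (f / 2) := by field_simp; ring
        _ ≤ (980 + 50000 / 9) * (S / h) * (1.07 * logFactor f) := by gcongr
        -- Numerically `(980 + 50000/9) · 1.07 < 6994 < 7050`; this is what fixes the constant
        -- `5000`.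
        _ ≤ 5000 * (S / h) * 1.41 * logFactor f := by
          have : 0 ≤ S / h * logFactor f :=
            mul_nonneg (by positivity) (by linarith [ten_le_logFactor hf hf1])
          linarith
        _ ≤ 5000 * (S / h) * Real.sqrt 2 * logFactor f := by
          have := ten_le_logFactor hf hf1
          gcongr
        _ = 5000 * (S * Real.sqrt 2 / h) * logFactor f := by ring

/-- An arm whose value is at least the maximum up to `β`, and a lower bound for its value with
this accuracy, are found with `O(√A / β)` queries. -/
theorem solvesIn_maximum [Nonempty 𝒜] {ν : Q → ℝ} (hν : ∀ x, 0 ≤ ν x ∧ ν x ≤ 1) (ρ : 𝒜 → ℝ)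
    {β f : ℝ} (hβ : 0 < β) (hβ1 : β ≤ 1) (hf : 0 < f)
    (hf1 : f ≤ 1) :
    SolvesIn (28000 * (Real.sqrt (Fintype.card 𝒜) / β) * logFactor f) f
      fun U : unitaryGroup Q ℂ => {o : 𝒜 × ℝ | (∀ a, armValue q ρ ν U a < o.2 + β) ∧
        o.2 < armValue q ρ ν U o.1} := by
  obtain ⟨j, hj1, hj2⟩ : ∃ j : ℕ, (2 / 3 : ℝ) ^ j ≤ β / 3 ∧ (3 / 2 : ℝ) ^ j ≤ 9 / (2 * β) := by
    obtain ⟨j, hj1, hj2⟩ := exists_nat_pow_near_of_lt_one (show (0 : ℝ) < β / 3 by positivity)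
      (by linarith) (show (0 : ℝ) < 2 / 3 by norm_num) (by norm_num)
    refine ⟨j + 1, hj1.le, ?_⟩
    have h1 : (3 / 2 : ℝ) ^ j = ((2 / 3) ^ j)⁻¹ := by rw [← inv_pow]; norm_num
    have h2 : ((2 / 3 : ℝ) ^ j)⁻¹ ≤ (β / 3)⁻¹ := inv_anti₀ (by positivity) hj2
    rw [pow_succ, h1]
    calc ((2 / 3 : ℝ) ^ j)⁻¹ * (3 / 2) ≤ (β / 3)⁻¹ * (3 / 2) := by gcongr
      _ = 9 / (2 * β) := by field_simp; ring
  set S := Real.sqrt (Fintype.card 𝒜) with hS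
  obtain ⟨n, hn1, hn2⟩ : ∃ n : ℕ, Fintype.card 𝒜 ≤ 2 ^ n ∧ Real.sqrt 2 ^ n ≤ 3 / 2 * S := by
    refine ⟨Nat.clog 2 (Fintype.card 𝒜), Nat.le_pow_clog one_lt_two _, ?_⟩
    have hA : 0 < Fintype.card 𝒜 := Fintype.card_pos
    have h1 : 2 ^ Nat.clog 2 (Fintype.card 𝒜) ≤ 2 * Fintype.card 𝒜 := by
      rcases Nat.lt_or_ge 1 (Fintype.card 𝒜) with h | h
      · have h2 := Nat.pow_pred_clog_lt_self one_lt_two h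
        have h3 : 0 < Nat.clog 2 (Fintype.card 𝒜) := Nat.clog_pos one_lt_two h
        obtain ⟨m, hm⟩ := Nat.exists_eq_succ_of_ne_zero h3.ne'
        rw [hm, Nat.succ_eq_add_one, pow_succ]
        rw [hm, Nat.pred_succ] at h2
        omega
      · have : Fintype.card 𝒜 = 1 := by omega
        rw [this]
        norm_num
    have h2 : (Real.sqrt 2 ^ Nat.clog 2 (Fintype.card 𝒜)) ^ 2 ≤ 2 * Fintype.card 𝒜 := by
      rw [← pow_mul, mul_comm, pow_mul, Real.sq_sqrt (by norm_num)]
      exact_mod_cast h1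
    have h3 : S ^ 2 = Fintype.card 𝒜 := Real.sq_sqrt (Nat.cast_nonneg _)
    refine le_of_sq_le_sq ?_ (by positivity)
    nlinarith [sq_nonneg S]
  have hl0 : 10 ≤ logFactor (f / 2) := ten_le_logFactor (by linarith) (by linarith)
  have h1 := solvesIn_value q hν ρ j (half_pos hf) (by linarith)
  have h2 := fun lo => solvesIn_arm q hν ρ n Finset.univ Finset.univ_nonempty
    (by rwa [Finset.card_univ]) lo (h := β / 3) (by positivity) (by linarith) (half_pos hf)
    (by linarith)
  rw [← add_halves f]
  refine (SolvesIn.bind (c₂ := 5000 * (Real.sqrt 2 ^ n / (β / 3)) * logFactor (f / 2))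
    (by positivity) (by positivity) h1 (half_pos hf).le fun lo => ?_).mono ?_ fun U => subset_rfl
  -- Lowering `lo` by `β / 3` keeps it strictly below the value of the arm found; the maximum is
  -- then at most `2 β / 3` above the reported bound.
  · refine SolvesIn.map (fun a => (a, lo - β / 3)) ((h2 lo).mono le_rfl fun U a ha => ?_)
    rintro ⟨hlo1, a', ha'⟩
    refine ⟨fun a => ?_, ha ⟨a', Finset.mem_univ _, ha'⟩⟩
    have := hlo1 a
    simp only
    linarith
  · rw [add_halves]
    have h4 := logFactor_half_le hf hf1
    calc 800 * (S * (3 / 2) ^ j) * logFactor (f / 2) +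
          5000 * (Real.sqrt 2 ^ n / (β / 3)) * logFactor (f / 2)
        ≤ 800 * (S * (9 / (2 * β))) * logFactor (f / 2) +
          5000 * (3 / 2 * S / (β / 3)) * logFactor (f / 2) := by gcongr
      _ = 26100 * (S / β) * logFactor (f / 2) := by field_simp; ring
      _ ≤ 26100 * (S / β) * (1.07 * logFactor f) := by gcongr
      _ ≤ 28000 * (S / β) * logFactor f := by
        have : 0 ≤ S / β * logFactor f :=
          mul_nonneg (by positivity) (by linarith [ten_le_logFactor hf hf1])
        linarith

end Search

/-! ### Values of policies -/

section Horizon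

variable {𝒮 𝒜 : Type} (M : RewardModel 𝒮 𝒜)

theorem summable_discounted {f : ℕ → ℝ} (hf : ∀ t, 0 ≤ f t ∧ f t ≤ 1) :
    Summable fun t => M.γ ^ t * f t :=
  Summable.of_nonneg_of_le (fun t => mul_nonneg (pow_nonneg M.γ_nonneg t) (hf t).1)
    (fun t => mul_le_of_le_one_right (pow_nonneg M.γ_nonneg t) (hf t).2)
    (summable_geometric_of_lt_one M.γ_nonneg M.γ_lt_one)

theorem gamma_mul_horizon_add_one : M.γ * M.horizon + 1 = M.horizon := by
  have : 1 - M.γ ≠ 0 := by linarith [M.γ_lt_one]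
  unfold RewardModel.horizon
  field_simp
  ring

theorem one_le_horizon : 1 ≤ M.horizon :=
  (one_le_inv₀ (by linarith [M.γ_lt_one])).2 (by linarith [M.γ_nonneg])

end Horizon

/-! ### Comparison principle and Bellman equation -/

section Bellman

variable {𝒮 𝒜 : Type} [Fintype 𝒮]

/-- The mean of `v` over the next state. -/
def nextMean (p : 𝒮 → 𝒜 → PMF 𝒮) (v : 𝒮 → ℝ) (s : 𝒮) (a : 𝒜) : ℝ :=
  ∑ s', (p s a s').toReal * v s'

theorem sum_toReal_eq_one (p : PMF 𝒮) : ∑ s, (p s).toReal = 1 := by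
  rw [← ENNReal.toReal_sum fun s _ => p.apply_ne_top s, ← tsum_fintype (L := .unconditional _),
    p.tsum_coe, ENNReal.toReal_one]

theorem nextMean_mono (p : 𝒮 → 𝒜 → PMF 𝒮) {v w : 𝒮 → ℝ} (h : ∀ s, v s ≤ w s) (s : 𝒮) (a : 𝒜) :
    nextMean p v s a ≤ nextMean p w s a :=
  Finset.sum_le_sum fun s' _ => mul_le_mul_of_nonneg_left (h s') ENNReal.toReal_nonneg

theorem nextMean_add_const (p : 𝒮 → 𝒜 → PMF 𝒮) (v : 𝒮 → ℝ) (c : ℝ) (s : 𝒮) (a : 𝒜) :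
    nextMean p (fun s' => v s' + c) s a = nextMean p v s a + c := by
  simp only [nextMean, mul_add, Finset.sum_add_distrib]
  rw [← Finset.sum_mul, sum_toReal_eq_one, one_mul]

theorem nextMean_const (p : 𝒮 → 𝒜 → PMF 𝒮) (c : ℝ) (s : 𝒮) (a : 𝒜) :
    nextMean p (fun _ => c) s a = c := by
  simp only [nextMean]
  rw [← Finset.sum_mul, sum_toReal_eq_one, one_mul]

theorem nextMean_nonneg (p : 𝒮 → 𝒜 → PMF 𝒮) {v : 𝒮 → ℝ} (h : ∀ s, 0 ≤ v s) (s : 𝒮) (a : 𝒜) :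
    0 ≤ nextMean p v s a :=
  Finset.sum_nonneg fun s' _ => mul_nonneg ENNReal.toReal_nonneg (h s')

theorem nextMean_le_of_le (p : 𝒮 → 𝒜 → PMF 𝒮) {v : 𝒮 → ℝ} {c : ℝ} (h : ∀ s, v s ≤ c) (s : 𝒮)
    (a : 𝒜) : nextMean p v s a ≤ c :=
  (nextMean_mono p h s a).trans (nextMean_const p c s a).le

variable (M : RewardModel 𝒮 𝒜) (p : 𝒮 → 𝒜 → PMF 𝒮) (π : 𝒮 → 𝒜)

theorem reward_add_le_horizon {v : 𝒮 → ℝ} (hv : ∀ s, v s ≤ M.horizon) (s : 𝒮) (a : 𝒜) :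
    M.r s a + M.γ * nextMean p v s a ≤ M.horizon := by
  have h1 := mul_le_mul_of_nonneg_left (nextMean_le_of_le p hv s a) M.γ_nonneg
  linarith [M.r_le_one s a, gamma_mul_horizon_add_one M]

/-- Maximum principle: at a state where `v - w` is largest, the two inequalities bound it by `γ`
times itself, so it cannot be positive. -/
theorem le_of_le_bellman {v w : 𝒮 → ℝ}
    (hv : ∀ s, v s ≤ M.r s (π s) + M.γ * nextMean p v s (π s))
    (hw : ∀ s, M.r s (π s) + M.γ * nextMean p w s (π s) ≤ w s) (s : 𝒮) : v s ≤ w s := by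
  have : Nonempty 𝒮 := ⟨s⟩
  obtain ⟨s₁, h₁⟩ := Finite.exists_max fun s => v s - w s
  have h2 : nextMean p v s₁ (π s₁) ≤ nextMean p w s₁ (π s₁) + (v s₁ - w s₁) := by
    rw [← nextMean_add_const]
    exact nextMean_mono p (fun s => by linarith [h₁ s]) _ _
  have h3 := mul_le_mul_of_nonneg_left h2 M.γ_nonneg
  have h4 : v s₁ - w s₁ ≤ M.γ * (v s₁ - w s₁) := by linarith [hv s₁, hw s₁]
  have h5 : v s₁ - w s₁ ≤ 0 := by nlinarith [M.γ_lt_one]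
  linarith [h₁ s]

/-- The expected reward in step `t`. -/
def expectedReward : ℕ → 𝒮 → ℝ
  | 0 => fun s => M.r s (π s)
  | t + 1 => fun s => nextMean p (expectedReward t) s (π s)

theorem expectedReward_mem (t : ℕ) (s : 𝒮) :
    0 ≤ expectedReward M p π t s ∧ expectedReward M p π t s ≤ 1 := by
  induction t generalizing s with
  | zero => exact ⟨M.r_nonneg _ _, M.r_le_one _ _⟩
  | succ t ih =>
    exact ⟨nextMean_nonneg p (fun s => (ih s).1) _ _, nextMean_le_of_le p (fun s => (ih s).2) _ _⟩

variable [MeasurableSpace 𝒮] [DiscreteMeasurableSpace 𝒮]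

theorem integral_policyKernel (f : 𝒮 → ℝ) (x : 𝒮) :
    ∫ y, f y ∂(policyKernel p π x) = nextMean p f x (π x) := by
  change ∫ y, f y ∂(p x (π x)).toMeasure = _
  rw [PMF.integral_eq_sum]
  simp [nextMean]

instance trajectoryLaw_isProbability (s : 𝒮) : IsProbabilityMeasure (trajectoryLaw p π s) := by
  unfold trajectoryLaw
  infer_instance

theorem integrable_coordinate (f : 𝒮 → ℝ) (t : ℕ) {μ : Measure (ℕ → 𝒮)} [IsFiniteMeasure μ] :
    Integrable (fun ω => f (ω t)) μ := by
  have : Integrable f (μ.map fun ω => ω t) := Integrable.of_finite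
  exact this.comp_measurable (measurable_pi_apply t)

/-- Markov property: the law of coordinate `t + 1` is the law of the history up to `t` followed by
one transition. -/
theorem integral_trajectoryLaw_succ (f : 𝒮 → ℝ) (t : ℕ) (s : 𝒮) :
    ∫ ω, f (ω (t + 1)) ∂(trajectoryLaw p π s) =
      ∫ ω, nextMean p f (ω t) (π (ω t)) ∂(trajectoryLaw p π s) := by
  have hm : Measurable f := Measurable.of_discrete
  have h1 : (trajectoryLaw p π s).map (fun ω => ω (t + 1)) =
      (historyKernel p π t ∘ₖ (Kernel.traj (X := fun _ : ℕ => 𝒮) (historyKernel p π) 0).map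
        (Preorder.frestrictLe t)) (fun _ => s) := by
    rw [Kernel.traj_map_frestrictLe, trajectoryLaw, ← Kernel.map_apply _ (by fun_prop)]
    conv_lhs => rw [← Kernel.traj_comp_partialTraj (Nat.zero_le t)]
    rw [Kernel.map_comp]
    congr 2
    exact Kernel.map_traj_succ_self
  rw [← integral_map (φ := fun ω : ℕ → 𝒮 => ω (t + 1)) (f := f)
    (measurable_pi_apply _).aemeasurable hm.aestronglyMeasurable, h1]
  rw [Kernel.integral_comp Integrable.of_finite, Kernel.map_apply _ (by fun_prop), integral_map]
  · refine integral_congr_ae (Filter.Eventually.of_forall fun ω => ?_)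
    simp only [historyKernel, Kernel.comap_apply]
    rw [integral_policyKernel]
    rfl
  · exact (by fun_prop : Measurable _).aemeasurable
  · exact Measurable.aestronglyMeasurable Measurable.of_discrete

theorem integral_trajectoryLaw_zero (f : 𝒮 → ℝ) (s : 𝒮) :
    ∫ ω, f (ω 0) ∂(trajectoryLaw p π s) = f s := by
  have hm : Measurable f := Measurable.of_discrete
  have h1 : (trajectoryLaw p π s).map (fun ω => ω 0) = Measure.dirac s := by
    have h2 := Kernel.traj_map_frestrictLe_apply (X := fun _ : ℕ => 𝒮) (κ := historyKernel p π) 0 0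
      (fun _ => s)
    have h3 : (fun ω : ℕ → 𝒮 => ω 0) =
      (fun h : (i : Finset.Iic 0) → (fun _ : ℕ => 𝒮) i => h ⟨0, Finset.mem_Iic.2 le_rfl⟩) ∘
        (Preorder.frestrictLe 0) := rfl
    rw [h3, ← Measure.map_map (measurable_pi_apply _) (by fun_prop), trajectoryLaw, h2,
      Kernel.partialTraj_self, Kernel.id_apply, Measure.map_dirac' (measurable_pi_apply _)]
  rw [← integral_map (φ := fun ω : ℕ → 𝒮 => ω 0) (f := f)
    (measurable_pi_apply _).aemeasurable hm.aestronglyMeasurable, h1, integral_dirac]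

theorem integral_reward_eq (t k : ℕ) (s : 𝒮) :
    ∫ ω, expectedReward M p π k (ω t) ∂(trajectoryLaw p π s) =
      expectedReward M p π (k + t) s := by
  induction t generalizing k with
  | zero => rw [integral_trajectoryLaw_zero, add_zero]
  | succ t ih =>
    rw [integral_trajectoryLaw_succ]
    have := ih (k + 1)
    rw [show k + 1 + t = k + (t + 1) by ring] at this
    exact this

theorem value_eq_tsum (s : 𝒮) :
    value M p π s = ∑' t, M.γ ^ t * expectedReward M p π t s := by
  unfold value
  have hi : ∀ t, Integrable (fun ω : ℕ → 𝒮 => M.γ ^ t * M.r (ω t) (π (ω t)))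
      (trajectoryLaw p π s) := fun t =>
    integrable_coordinate (fun x => M.γ ^ t * M.r x (π x)) t
  have hn : ∀ t (ω : ℕ → 𝒮), ‖M.γ ^ t * M.r (ω t) (π (ω t))‖ = M.γ ^ t * M.r (ω t) (π (ω t)) := fun t ω =>
    Real.norm_of_nonneg (mul_nonneg (pow_nonneg M.γ_nonneg t) (M.r_nonneg _ _))
  have he : ∀ t, ∫ ω, M.γ ^ t * M.r (ω t) (π (ω t)) ∂(trajectoryLaw p π s) =
      M.γ ^ t * expectedReward M p π t s := by
    intro t
    rw [integral_const_mul]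
    have := integral_reward_eq M p π t 0 s
    rw [zero_add] at this
    rw [← this]
    rfl
  rw [← integral_tsum_of_summable_integral_norm hi]
  · exact tsum_congr he
  · simp only [hn, he]
    exact summable_discounted M fun t => expectedReward_mem M p π t s

/-- The Bellman equation. -/
theorem value_eq (s : 𝒮) :
    value M p π s = M.r s (π s) + M.γ * nextMean p (value M p π) s (π s) := by
  have hs : ∀ s, Summable fun t => M.γ ^ t * expectedReward M p π t s := fun s =>
    summable_discounted M fun t => expectedReward_mem M p π t s
  rw [value_eq_tsum, (hs s).tsum_eq_zero_add]
  simp only [nextMean, value_eq_tsum]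
  simp only [← tsum_mul_left]
  rw [← Summable.tsum_finsetSum fun s' _ => (hs s').mul_left _, ← tsum_mul_left]
  congr 1
  · simp [expectedReward]
  · refine tsum_congr fun t => ?_
    simp only [expectedReward, nextMean, Finset.mul_sum]
    refine Finset.sum_congr rfl fun s' _ => ?_
    ring

theorem le_value {v : 𝒮 → ℝ} (hv : ∀ s, v s ≤ M.r s (π s) + M.γ * nextMean p v s (π s)) (s : 𝒮) :
    v s ≤ value M p π s :=
  le_of_le_bellman M p π hv (fun s => (value_eq M p π s).ge) s

theorem value_le_horizon (s : 𝒮) : value M p π s ≤ M.horizon :=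
  le_of_le_bellman M p π (w := fun _ => M.horizon) (fun s => (value_eq M p π s).le)
    (fun s => reward_add_le_horizon M p (fun _ => le_rfl) s (π s)) s

theorem value_le_optimalValue [Fintype 𝒜] (s : 𝒮) : value M p π s ≤ optimalValue M p s :=
  le_ciSup (f := fun π => value M p π s) ⟨M.horizon, by
    rintro _ ⟨π, rfl⟩
    exact value_le_horizon M p π s⟩ π

end Bellman

/-! ### Correctness of the algorithm -/

section ErrorBound

variable {𝒮 𝒜 : Type} {ε : ℝ} {l : ℕ}

theorem accuracy_pos (M : RewardModel 𝒮 𝒜) (hε : 0 < ε) : 0 < accuracy M ε := by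
  have : 0 < 1 - M.γ := by linarith [M.γ_lt_one]
  unfold accuracy
  positivity

/-- The bound on the distance of `v_l` to the optimal values. -/
def errorBound (M : RewardModel 𝒮 𝒜) (ε : ℝ) (l : ℕ) : ℝ :=
  M.γ ^ (l - 1) * M.horizon + 2 * M.γ * accuracy M ε * M.horizon

theorem errorBound_succ (M : RewardModel 𝒮 𝒜) (ε : ℝ) (hl : l ≠ 0) :
    errorBound M ε (l + 1) = M.γ * errorBound M ε l + 2 * M.γ * accuracy M ε := by
  obtain ⟨k, rfl⟩ := Nat.exists_eq_succ_of_ne_zero hl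
  have := gamma_mul_horizon_add_one M
  simp only [errorBound, Nat.succ_eq_add_one, Nat.add_sub_cancel, pow_succ]
  linear_combination -2 * M.γ * accuracy M ε * this

theorem errorBound_numIter (M : RewardModel 𝒮 𝒜) (hε : 0 < ε) :
    errorBound M ε (numIter M ε) ≤ ε := by
  have hΓ := one_le_horizon M
  have hγ1 := M.γ_lt_one
  have hγ0 := M.γ_nonneg
  have hΓ' : (1 - M.γ) * M.horizon = 1 := by linarith [gamma_mul_horizon_add_one M]
  have h1 : M.γ ^ (numIter M ε - 1) ≤ ε / (4 * M.horizon) := by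
    rw [numIter, Nat.add_sub_cancel]
    set n := ⌈M.horizon * ⌈Real.log (4 * M.horizon / ε)⌉₊⌉₊ with hn
    have h2 : M.horizon * Real.log (4 * M.horizon / ε) ≤ n :=
      (mul_le_mul_of_nonneg_left (Nat.le_ceil _) (by linarith)).trans (Nat.le_ceil _)
    have h3 : Real.log (4 * M.horizon / ε) ≤ (1 - M.γ) * n := by
      have := mul_le_mul_of_nonneg_left h2 (by linarith : 0 ≤ 1 - M.γ)
      rwa [← mul_assoc, hΓ', one_mul] at this
    -- Here `γ ≤ e^(-(1-γ))`, and `n` is at least `Γ log (4Γ/ε)`.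
    calc M.γ ^ n ≤ Real.exp (-(1 - M.γ)) ^ n :=
          pow_le_pow_left₀ hγ0 (by linarith [Real.add_one_le_exp (-(1 - M.γ))]) n
      _ = Real.exp (-((1 - M.γ) * n)) := by rw [← Real.exp_nat_mul]; ring_nf
      _ ≤ Real.exp (-Real.log (4 * M.horizon / ε)) := Real.exp_le_exp.2 (by linarith)
      _ = ε / (4 * M.horizon) := by
        rw [Real.exp_neg, Real.exp_log (by positivity), inv_div]
  have h4 : 2 * M.γ * accuracy M ε * M.horizon = M.γ * ε / 2 := by
    unfold accuracy
    linear_combination M.γ * ε / 2 * hΓ'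
  have h5 := mul_le_mul_of_nonneg_right h1 (by linarith : 0 ≤ M.horizon)
  rw [show ε / (4 * M.horizon) * M.horizon = ε / 4 by field_simp] at h5
  unfold errorBound
  rw [h4]
  nlinarith

end ErrorBound

/-! ### Invariants of one iteration -/

section Iteration

variable {𝒮 𝒜 : Type} [Fintype 𝒮] {M : RewardModel 𝒮 𝒜} {p : 𝒮 → 𝒜 → PMF 𝒮} {ε : ℝ} {l : ℕ}
  {v : 𝒮 → ℝ} {s : 𝒮} {out : 𝒜 × ℝ}

/-- The downward shift makes every `z` an underestimate of the mean, and clipping at `0` is harmless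
because the exact Bellman value is nonnegative. -/
theorem IsCorrectMax.le (h : IsCorrectMax M p ε l v s out) (hv : ∀ s, 0 ≤ v s) :
    out.2 ≤ M.r s out.1 + M.γ * nextMean p v s out.1 := by
  have h0 : 0 ≤ M.r s out.1 + M.γ * nextMean p v s out.1 :=
    add_nonneg (M.r_nonneg _ _) (mul_nonneg M.γ_nonneg (nextMean_nonneg p hv _ _))
  obtain ⟨q, hq, -, h2⟩ := h
  rw [h2]
  unfold IsQVector at hq
  split_ifs at hq with hl
  · simpa [hq] using h0
  · obtain ⟨z, ⟨μ, hμ, hzμ⟩, hz⟩ := hq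
    rw [hz]
    refine max_le ?_ h0
    have h1 := (abs_lt.1 (hμ out.1)).2
    have h3 : z out.1 ≤ nextMean p v s out.1 := by
      rw [hzμ, nextMean]
      linarith
    linarith [mul_le_mul_of_nonneg_left h3 M.γ_nonneg]

theorem IsCorrectMax.ge (h : IsCorrectMax M p ε l v s out) (hl : l ≠ 1) (a : 𝒜) :
    M.r s a + M.γ * (nextMean p v s a - 2 * accuracy M ε) ≤ out.2 := by
  obtain ⟨q, hq, hmax, h2⟩ := h
  rw [h2]
  unfold IsQVector at hq
  rw [if_neg hl] at hq
  obtain ⟨z, ⟨μ, hμ, hzμ⟩, hz⟩ := hq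
  refine le_trans ?_ (hmax a)
  rw [hz]
  refine le_trans ?_ (le_max_left _ _)
  have h1 := (abs_lt.1 (hμ a)).1
  have h3 : nextMean p v s a - 2 * accuracy M ε ≤ z a := by
    rw [hzμ, nextMean]
    linarith
  linarith [mul_le_mul_of_nonneg_left h3 M.γ_nonneg]

variable [MeasurableSpace 𝒮] [DiscreteMeasurableSpace 𝒮]

/-- `v` is a lower bound on the values of `π` that is certified by the Bellman operator, and up to
`e` an upper bound on the values of all policies. -/
structure IsValueBound (M : RewardModel 𝒮 𝒜) (p : 𝒮 → 𝒜 → PMF 𝒮) (e : ℝ) (v : 𝒮 → ℝ)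
    (π : 𝒮 → 𝒜) : Prop where
  nonneg : ∀ s, 0 ≤ v s
  le_horizon : ∀ s, v s ≤ M.horizon
  le_bellman : ∀ s, v s ≤ M.r s (π s) + M.γ * nextMean p v s (π s)
  value_le : ∀ π' s, value M p π' s ≤ v s + e

theorem isValueBound_zero (M : RewardModel 𝒮 𝒜) (p : 𝒮 → 𝒜 → PMF 𝒮) (hε : 0 < ε) (π : 𝒮 → 𝒜) :
    IsValueBound M p (errorBound M ε 0) 0 π where
  nonneg _ := le_rfl
  le_horizon _ := zero_le_one.trans (one_le_horizon M)
  le_bellman s := add_nonneg (M.r_nonneg _ _)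
    (mul_nonneg M.γ_nonneg (nextMean_nonneg p (fun _ => le_rfl) _ _))
  value_le π' s := by
    have h1 := value_le_horizon M p π' s
    have h2 := M.γ_nonneg
    have h3 := accuracy_pos M hε
    have h4 := one_le_horizon M
    have h5 : 0 ≤ 2 * M.γ * accuracy M ε * M.horizon := by positivity
    -- The exponent `l - 1` is truncated at `l = 0`, so the bound starts with the full horizon `Γ`.
    simp only [errorBound, Nat.zero_sub, pow_zero, one_mul, Pi.zero_apply, zero_add]
    linarith

/-- Values never decrease, so the Bellman certificate of a state that keeps its action stays valid
when the other entries are raised; an updated state has a fresh certificate from `IsCorrectMax.le`.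
The upper bound follows from one application of the Bellman equation to the competing policy. -/
theorem IsValueBound.update {π : 𝒮 → 𝒜} (h : IsValueBound M p (errorBound M ε l) v π)
    {out : 𝒮 → 𝒜 × ℝ} (hout : ∀ s, IsCorrectMax M p ε (l + 1) v s (out s)) :
    IsValueBound M p (errorBound M ε (l + 1))
      (fun s => if v s ≤ (out s).2 then (out s).2 else v s)
      (fun s => if v s ≤ (out s).2 then (out s).1 else π s) := by
  set v' : 𝒮 → ℝ := fun s => if v s ≤ (out s).2 then (out s).2 else v s with hv'
  have hle : ∀ s, v s ≤ v' s := fun s => by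
    simp only [hv']
    split_ifs with hs
    exacts [hs, le_rfl]
  have hout_le : ∀ s, (out s).2 ≤ v' s := fun s => by
    simp only [hv']
    split_ifs with hs
    exacts [le_rfl, (not_le.1 hs).le]
  have hmono : ∀ s a, M.r s a + M.γ * nextMean p v s a ≤ M.r s a + M.γ * nextMean p v' s a :=
    fun s a => by linarith [mul_le_mul_of_nonneg_left (nextMean_mono p hle s a) M.γ_nonneg]
  refine ⟨fun s => (h.nonneg s).trans (hle s), fun s => ?_, fun s => ?_, fun π' s => ?_⟩
  · simp only [hv']
    split_ifs with hs
    · exact ((hout s).le h.nonneg).trans (reward_add_le_horizon M p h.le_horizon _ _)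
    · exact h.le_horizon s
  · rcases le_or_gt (v s) (out s).2 with hs | hs
    · simp only [hs, if_true]
      rw [show v' s = (out s).2 from if_pos hs]
      exact ((hout s).le h.nonneg).trans (hmono _ _)
    · simp only [not_le.2 hs, if_false]
      rw [show v' s = v s from if_neg (not_le.2 hs)]
      exact (h.le_bellman s).trans (hmono _ _)
  · rcases eq_or_ne l 0 with rfl | hl
    -- The first iteration uses `q = 0` and makes no progress; accordingly the error bounds for `0`
    -- and `1` coincide.
    · exact (h.value_le π' s).trans (add_le_add (hle s) le_rfl)
    · rw [errorBound_succ M ε hl, value_eq]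
      have h1 := (hout s).ge (by omega) (π' s)
      have h2 := nextMean_mono p (h.value_le π') s (π' s)
      rw [nextMean_add_const] at h2
      have h3 := mul_le_mul_of_nonneg_left h2 M.γ_nonneg
      have h4 := hout_le s
      linarith

theorem IsValueBound.conclusion [Fintype 𝒜] [Nonempty 𝒜] {π : 𝒮 → 𝒜}
    (h : IsValueBound M p ε v π) (s : 𝒮) :
    optimalValue M p s - ε ≤ v s ∧ v s ≤ value M p π s ∧
      value M p π s ≤ optimalValue M p s := by
  refine ⟨?_, le_value M p π h.le_bellman s, value_le_optimalValue M p π s⟩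
  have : optimalValue M p s ≤ v s + ε := ciSup_le fun π' => h.value_le π' s
  linarith

end Iteration

/-! ### Failure probability and query count of a run -/

section Run

variable {Q : Type} [Fintype Q] [DecidableEq Q]

/-- Independent runs give a product of success probabilities, bounded below by Bernoulli's
inequality. -/
theorem one_sub_card_mul_le_runAll {ι Out : Type} [Fintype ι] [DecidableEq ι]
    (c : ι → QueryCircuit Q Out) (U : Matrix.unitaryGroup Q ℂ) (B : ι → Set Out) {f : ℝ}
    (hf1 : f ≤ 1)
    (h : ∀ i, ENNReal.ofReal (1 - f) ≤ ((c i).output U).toOuterMeasure (B i)) :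
    ENNReal.ofReal (1 - Fintype.card ι * f) ≤
      (runAll c U).toOuterMeasure {out | ∀ i, out i ∈ B i} := by
  classical
  have h1 : (runAll c U).toOuterMeasure {out | ∀ i, out i ∈ B i} =
      ∏ i, ((c i).output U).toOuterMeasure (B i) := by
    rw [runAll, PMF.toOuterMeasure_map_apply, PMF.toOuterMeasure_apply_fintype]
    simp only [QueryCircuit.output, PMF.toOuterMeasure_map_apply,
      PMF.toOuterMeasure_apply_fintype]
    rw [Finset.prod_univ_sum, Fintype.piFinset_univ]
    refine Finset.sum_congr rfl fun x _ => ?_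
    by_cases hx : ∀ i, (c i).readout (x i) ∈ B i
    · rw [Set.indicator_of_mem (by exact hx), PMF.ofFintype_apply]
      exact Finset.prod_congr rfl fun i _ => (Set.indicator_of_mem (by exact hx i) _).symm
    · rw [Set.indicator_of_notMem (by exact hx)]
      obtain ⟨i, hi⟩ := not_forall.1 hx
      exact (Finset.prod_eq_zero (Finset.mem_univ i) (Set.indicator_of_notMem (by exact hi) _)).symm
  rw [h1]
  calc ENNReal.ofReal (1 - Fintype.card ι * f)
      ≤ ENNReal.ofReal ((1 - f) ^ Fintype.card ι) := by
        refine ENNReal.ofReal_le_ofReal ?_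
        have := one_add_mul_le_pow (a := -f) (by linarith) (Fintype.card ι)
        rw [← sub_eq_add_neg] at this
        linarith
    _ = ∏ _i : ι, ENNReal.ofReal (1 - f) := by
        rw [Finset.prod_const, Finset.card_univ, ENNReal.ofReal_pow (by linarith)]
    _ ≤ _ := Finset.prod_le_prod' fun i _ => h i

theorem mul_le_toOuterMeasure_bind {α β : Type} (P : PMF α) (F : α → PMF β) {A : Set α}
    {B : Set β} {c : ENNReal} (h : ∀ a ∈ A, c ≤ (F a).toOuterMeasure B) :
    P.toOuterMeasure A * c ≤ (P.bind F).toOuterMeasure B := by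
  rw [PMF.toOuterMeasure_bind_apply, PMF.toOuterMeasure_apply, ← ENNReal.tsum_mul_right]
  refine ENNReal.tsum_le_tsum fun a => ?_
  by_cases ha : a ∈ A
  · rw [Set.indicator_of_mem ha]
    gcongr
    exact h a ha
  · rw [Set.indicator_of_notMem ha, zero_mul]
    exact zero_le

variable {𝒮 𝒜 : Type} [Fintype 𝒮] [DecidableEq 𝒮] {R : MaxRoutine 𝒮 𝒜 Q}
  {U : Matrix.unitaryGroup Q ℂ} {π₀ : 𝒮 → 𝒜}

theorem queries_le_of_mem_support {T : ℕ} (hT : ∀ l v s, (R l v s).queries ≤ T) (l : ℕ)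
    {x : State 𝒮 𝒜} (hx : x ∈ (iterations R U π₀ l).support) :
    x.queries ≤ l * (Fintype.card 𝒮 * T) := by
  induction l generalizing x with
  | zero =>
    rw [iterations, PMF.support_pure, Set.mem_singleton_iff] at hx
    simp [hx]
  | succ l ih =>
    rw [iterations, PMF.mem_support_bind_iff] at hx
    obtain ⟨y, hy, hx⟩ := hx
    rw [iteration, PMF.support_map] at hx
    obtain ⟨out, -, rfl⟩ := hx
    have h1 := ih hy
    have h2 : ∑ s, (R (l + 1) y.v s).queries ≤ Fintype.card 𝒮 * T := by
      rw [← smul_eq_mul, ← Finset.card_univ]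
      exact Finset.sum_le_card_nsmul _ _ _ fun s _ => hT _ _ s
    simp only
    linarith

variable [MeasurableSpace 𝒮] [DiscreteMeasurableSpace 𝒮] {M : RewardModel 𝒮 𝒜}
  {p : 𝒮 → 𝒜 → PMF 𝒮} {ε f : ℝ}

theorem le_toOuterMeasure_iterations (hR : R.Correct M p U ε f) (hε : 0 < ε) (hf0 : 0 ≤ f)
    (hf1 : f ≤ 1) (hfS : Fintype.card 𝒮 * f ≤ 1) (l : ℕ) (hl : l ≤ numIter M ε) :
    ENNReal.ofReal (1 - l * (Fintype.card 𝒮 * f)) ≤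
      (iterations R U π₀ l).toOuterMeasure {x | IsValueBound M p (errorBound M ε l) x.v x.π} := by
  induction l with
  | zero =>
    rw [iterations, PMF.toOuterMeasure_pure_apply, if_pos (by exact isValueBound_zero M p hε π₀)]
    simp
  | succ l ih =>
    have hSf : 0 ≤ Fintype.card 𝒮 * f := by positivity
    calc ENNReal.ofReal (1 - (l + 1 : ℕ) * (Fintype.card 𝒮 * f))
        ≤ ENNReal.ofReal ((1 - l * (Fintype.card 𝒮 * f)) * (1 - Fintype.card 𝒮 * f)) := by
          refine ENNReal.ofReal_le_ofReal ?_
          push_cast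
          nlinarith [mul_nonneg (Nat.cast_nonneg (α := ℝ) l) (mul_nonneg hSf hSf)]
      _ = ENNReal.ofReal (1 - l * (Fintype.card 𝒮 * f)) *
            ENNReal.ofReal (1 - Fintype.card 𝒮 * f) := ENNReal.ofReal_mul' (by linarith)
      _ ≤ (iterations R U π₀ l).toOuterMeasure
            {x | IsValueBound M p (errorBound M ε l) x.v x.π} *
            ENNReal.ofReal (1 - Fintype.card 𝒮 * f) := by
          gcongr
          exact ih (by omega)
      _ ≤ _ := by
          rw [iterations]
          refine mul_le_toOuterMeasure_bind _ _ fun x hx => ?_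
          have hx : IsValueBound M p (errorBound M ε l) x.v x.π := hx
          refine (one_sub_card_mul_le_runAll (R (l + 1) x.v) U _ hf1 fun s =>
            hR (l + 1) (by omega) hl x.v (fun s => ⟨hx.nonneg s, hx.le_horizon s⟩) s).trans ?_
          rw [iteration, PMF.toOuterMeasure_map_apply]
          exact measure_mono fun out hout => hx.update hout

end Run

/-! ### The maximum finding routine -/

section Circuit

variable {Q Out : Type} [Fintype Q] [DecidableEq Q]

theorem SolvesIn.exists_circuit {c f : ℝ} {G : Matrix.unitaryGroup Q ℂ → Set Out}
    (h : SolvesIn c f G) : ∃ C : QueryCircuit Q Out, C.queries = 2 * ⌊c⌋₊ ∧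
      ∀ U, ENNReal.ofReal (1 - f) ≤ (C.output U).toOuterMeasure (G U) := by
  obtain ⟨W, _, _, start, E, read, hE, hw⟩ := h
  obtain ⟨prep, steps, hlen, hsteps⟩ := hE.exists_steps
  refine ⟨⟨W, start, prep, steps, read⟩, hlen, fun U => ?_⟩
  have hfinal : ∀ x, QueryCircuit.finalState ⟨W, start, prep, steps, read⟩ U x =
      (E U).1 x start := fun x => by
    simp only [QueryCircuit.finalState, QueryCircuit.evolution, hsteps,
      Matrix.mulVec_single_one, Matrix.col_apply]
  have hind : ∀ x, (read ⁻¹' G U).indicator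
      (QueryCircuit.measurement ⟨W, start, prep, steps, read⟩ U) x =
      ENNReal.ofReal (‖(E U).1 x start‖ ^ 2 * (G U).indicator 1 (read x)) := fun x => by
    by_cases hx : read x ∈ G U
    · rw [Set.indicator_of_mem (by exact hx), Set.indicator_of_mem hx, Pi.one_apply, mul_one,
        ← hfinal]
      rfl
    · rw [Set.indicator_of_notMem (by exact hx), Set.indicator_of_notMem hx, mul_zero,
        ENNReal.ofReal_zero]
  have hnn : ∀ x, 0 ≤ ‖(E U).1 x start‖ ^ 2 * (G U).indicator (1 : Out → ℝ) (read x) := fun x =>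
    mul_nonneg (sq_nonneg _) (Set.indicator_nonneg (fun _ _ => zero_le_one) _)
  rw [QueryCircuit.output, PMF.toOuterMeasure_map_apply, PMF.toOuterMeasure_apply_fintype,
    Finset.sum_congr rfl fun x _ => hind x, ← ENNReal.ofReal_sum_of_nonneg fun x _ => hnn x]
  refine ENNReal.ofReal_le_ofReal ?_
  have h1 := hw U
  have h2 := sum_norm_sq_column (E U) start
  have h3 : ∑ x, ‖(E U).1 x start‖ ^ 2 * (G U)ᶜ.indicator (1 : Out → ℝ) (read x) +
      ∑ x, ‖(E U).1 x start‖ ^ 2 * (G U).indicator (1 : Out → ℝ) (read x) = 1 := by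
    rw [← Finset.sum_add_distrib, ← h2]
    refine Finset.sum_congr rfl fun x _ => ?_
    rw [← mul_add, Set.indicator_compl_add_self_apply, Pi.one_apply, mul_one]
  linarith

end Circuit

section Routine

/-- The estimates are chosen after the fact. For an arm whose exact value exceeds `w`, `z` is solved
from `r + γ z = w`, within tolerance by `hall`; for any other arm the estimated mean is exact and
`z` is that mean shifted down. No entry exceeds `w`, and the returned arm attains it, by equality or
by clipping at `0`. -/
theorem isCorrectMax_of_lt {𝒮 𝒜 : Type} [Fintype 𝒮] {M : RewardModel 𝒮 𝒜} {p : 𝒮 → 𝒜 → PMF 𝒮} {ε : ℝ} {l : ℕ} {v : 𝒮 → ℝ}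
    {s : 𝒮} {a : 𝒜} {w : ℝ} (hl : l ≠ 1) (hγ : 0 < M.γ) (hε : 0 < accuracy M ε) (hw : 0 ≤ w)
    (hall : ∀ a, M.r s a + M.γ * (nextMean p v s a - 2 * accuracy M ε) < w)
    (hlt : w < M.r s a + M.γ * nextMean p v s a ∨ w = 0) :
    IsCorrectMax M p ε l v s (a, w) := by
  have hz : ∀ a, ∃ z, |z + accuracy M ε - nextMean p v s a| < accuracy M ε ∧
      M.r s a + M.γ * z ≤ w ∧ (w < M.r s a + M.γ * nextMean p v s a → M.r s a + M.γ * z = w) := by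
    intro a
    rcases lt_or_ge w (M.r s a + M.γ * nextMean p v s a) with h | h
    · have he : M.r s a + M.γ * ((w - M.r s a) / M.γ) = w := by field_simp; ring
      refine ⟨(w - M.r s a) / M.γ, ?_, he.le, fun _ => he⟩
      have h1 : (w - M.r s a) / M.γ < nextMean p v s a := by
        rw [div_lt_iff₀ hγ]; linarith
      have h2 : nextMean p v s a - 2 * accuracy M ε < (w - M.r s a) / M.γ := by
        rw [lt_div_iff₀ hγ]; linarith [hall a]
      rw [abs_lt]
      constructor <;> linarith
    · refine ⟨nextMean p v s a - accuracy M ε, by simpa using hε, ?_, fun h' => absurd h h'.not_ge⟩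
      nlinarith
  choose z hz1 hz2 hz3 using hz
  have hmax : max (M.r s a + M.γ * z a) 0 = w := by
    rcases hlt with h | h
    · rw [hz3 a h, max_eq_left hw]
    · rw [h, max_eq_right (h ▸ hz2 a)]
  refine ⟨fun a => max (M.r s a + M.γ * z a) 0, ?_, fun a' => ?_, hmax.symm⟩
  · rw [IsQVector, if_neg hl]
    exact ⟨z, ⟨fun a => z a + accuracy M ε, hz1, fun a => by ring⟩, fun _ => rfl⟩
  · exact (max_le (hz2 a') hw).trans hmax.ge

variable {𝒮 𝒜 J : Type} [Fintype 𝒮] [Fintype 𝒜] [Fintype J] [DecidableEq 𝒮] [DecidableEq 𝒜]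
  [DecidableEq J]

theorem IsGenerativeModel.bornMean_eq {p : 𝒮 → 𝒜 → PMF 𝒮} {s₀ : 𝒮} {j₀ : J}
    {U : Matrix.unitaryGroup (OracleReg 𝒮 𝒜 J) ℂ} (h : IsGenerativeModel p s₀ j₀ U) (v : 𝒮 → ℝ)
    (s : 𝒮) (a : 𝒜) :
    bornMean U (fun x => v x.2.2.1) (s, a, s₀, j₀) = nextMean p v s a := by
  obtain ⟨ψ, hψ, hU⟩ := h
  have hcol : ∀ x, U.1 x (s, a, s₀, j₀) = if x.1 = s ∧ x.2.1 = a then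
      (Real.sqrt (p s a x.2.2.1).toReal : ℂ) * ψ x.2.2.1 s a x.2.2.2 else 0 := fun x => by
    have := congrFun (hU s a) x
    rwa [Matrix.mulVec_single_one, Matrix.col_apply] at this
  simp only [bornMean, hcol, Fintype.sum_prod_type]
  rw [Finset.sum_eq_single s, Finset.sum_eq_single a]
  · simp only [and_self, if_true, norm_mul, Complex.norm_real, mul_pow, Real.norm_eq_abs, sq_abs,
      Real.sq_sqrt ENNReal.toReal_nonneg, nextMean]
    refine Finset.sum_congr rfl fun s' _ => ?_
    rw [← Finset.sum_mul, ← Finset.mul_sum, hψ, mul_one]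
  · intro a' _ ha'
    simp [ha']
  · simp
  · intro s' _ hs'
    simp [hs']
  · simp

variable [Nonempty 𝒜] (s₀ : 𝒮) (j₀ : J) (M : RewardModel 𝒮 𝒜) {ε f : ℝ}

/-- Half of the number of queries of a call of the maximum finding routine. -/
def routineCost (M : RewardModel 𝒮 𝒜) (ε f : ℝ) : ℝ :=
  28000 * (Real.sqrt (Fintype.card 𝒜) / (2 * accuracy M ε / M.horizon)) * logFactor f

/-- Dividing `r + γ P v` by `γ Γ` gives arms with known offsets and means in `[0, 1]`; precision `2
· accuracy / Γ` there becomes `2 γ · accuracy` after scaling back. Success must be a property of the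
oracle alone, hence the quantifier over all `p` that it models. -/
theorem solvesIn_isCorrectMax (hε : 0 < ε) (hεΓ : ε ≤ M.horizon) (hf : 0 < f) (hf1 : f ≤ 1)
    (l : ℕ) (v : 𝒮 → ℝ) (hv : ∀ s, 0 ≤ v s ∧ v s ≤ M.horizon) (s : 𝒮) :
    SolvesIn (routineCost M ε f) f fun U => {out | ∀ p : 𝒮 → 𝒜 → PMF 𝒮,
      IsGenerativeModel p s₀ j₀ U → IsCorrectMax M p ε l v s out} := by
  have : Nonempty (OracleReg 𝒮 𝒜 J) := ⟨(s₀, Classical.arbitrary 𝒜, s₀, j₀)⟩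
  have hα := accuracy_pos M hε
  have hΓ := one_le_horizon M
  rcases eq_or_ne l 1 with rfl | hl
  · exact SolvesIn.pure (Classical.arbitrary 𝒜, 0) hf.le fun U p _ =>
      ⟨0, by simp [IsQVector], fun a => le_rfl, rfl⟩
  -- For `γ = 0` the rescaling breaks down, but the rewards alone determine the maximum.
  rcases M.γ_nonneg.eq_or_lt with hγ | hγ
  · obtain ⟨a, ha⟩ := Finite.exists_max (M.r s)
    refine SolvesIn.pure (a, M.r s a) hf.le fun U p _ => ⟨M.r s, ?_, ha, rfl⟩
    rw [IsQVector, if_neg hl]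
    refine ⟨fun a => nextMean p v s a - accuracy M ε,
      ⟨nextMean p v s, fun a => ?_, fun _ => rfl⟩, fun a => ?_⟩
    · simpa [nextMean] using hα
    · rw [← hγ, zero_mul, add_zero, max_eq_left (M.r_nonneg s a)]
  have hΓ0 : 0 < M.horizon := by linarith
  have hΓ' : (1 - M.γ) * M.horizon = 1 := by linarith [gamma_mul_horizon_add_one M]
  have hβ1 : 2 * accuracy M ε / M.horizon ≤ 1 := by
    rw [div_le_one hΓ0, accuracy]
    have := mul_le_mul_of_nonneg_left hεΓ (by linarith [M.γ_lt_one] : 0 ≤ 1 - M.γ)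
    linarith
  refine (SolvesIn.map (fun o : 𝒜 × ℝ => (o.1, max (M.γ * M.horizon * o.2) 0))
    ((solvesIn_maximum (fun a : 𝒜 => ((s, a, s₀, j₀) : OracleReg 𝒮 𝒜 J))
      (ν := fun x => v x.2.2.1 / M.horizon)
      (fun x => ⟨div_nonneg (hv _).1 hΓ0.le, (div_le_one hΓ0).2 (hv _).2⟩)
      (fun a => M.r s a / (M.γ * M.horizon)) (by positivity) hβ1 hf hf1).mono le_rfl ?_))
  rintro U ⟨a, y⟩ ⟨hy1, hy2⟩ p hU
  have harm : ∀ a, M.γ * M.horizon * armValue (fun a : 𝒜 => ((s, a, s₀, j₀) : OracleReg 𝒮 𝒜 J))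
      (fun a => M.r s a / (M.γ * M.horizon)) (fun x => v x.2.2.1 / M.horizon) U a =
      M.r s a + M.γ * nextMean p v s a := by
    intro a
    have h1 := hU.bornMean_eq (fun s => v s / M.horizon) s a
    have h2 : nextMean p (fun s => v s / M.horizon) s a = nextMean p v s a / M.horizon := by
      simp only [nextMean, Finset.sum_div, mul_div_assoc]
    rw [armValue, h1, h2]
    field_simp
  have hc : 0 < M.γ * M.horizon := by positivity
  refine isCorrectMax_of_lt hl hγ hα (le_max_right _ _) (fun a' => ?_) ?_
  · refine lt_of_lt_of_le ?_ (le_max_left _ _)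
    have h1 := mul_lt_mul_of_pos_left (hy1 a') hc
    rw [harm] at h1
    have h2 : M.γ * M.horizon * (y + 2 * accuracy M ε / M.horizon) =
      M.γ * M.horizon * y + M.γ * (2 * accuracy M ε) := by field_simp
    simp only at h1 ⊢
    linarith
  · have h1 := mul_lt_mul_of_pos_left hy2 hc
    rw [harm] at h1
    rcases max_choice (M.γ * M.horizon * y) 0 with h | h
    · exact .inl (h.trans_lt h1)
    · exact .inr h

theorem exists_maxRoutine (hε : 0 < ε) (hεΓ : ε ≤ M.horizon) (hf : 0 < f) (hf1 : f ≤ 1) :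
    ∃ R : MaxRoutine 𝒮 𝒜 (OracleReg 𝒮 𝒜 J),
      (∀ l v s, (R l v s).queries ≤ 2 * ⌊routineCost M ε f⌋₊) ∧
      ∀ (p : 𝒮 → 𝒜 → PMF 𝒮) (U : Matrix.unitaryGroup (OracleReg 𝒮 𝒜 J) ℂ),
        IsGenerativeModel p s₀ j₀ U → R.Correct M p U ε f := by
  have : Nonempty (OracleReg 𝒮 𝒜 J) := ⟨(s₀, Classical.arbitrary 𝒜, s₀, j₀)⟩
  have h : ∀ (l : ℕ) (v : 𝒮 → ℝ) (s : 𝒮), ∃ C : QueryCircuit (OracleReg 𝒮 𝒜 J) (𝒜 × ℝ),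
      C.queries = 2 * ⌊routineCost M ε f⌋₊ ∧ ((∀ s, 0 ≤ v s ∧ v s ≤ M.horizon) →
        ∀ U, ENNReal.ofReal (1 - f) ≤ (C.output U).toOuterMeasure
          {out | ∀ p : 𝒮 → 𝒜 → PMF 𝒮, IsGenerativeModel p s₀ j₀ U →
            IsCorrectMax M p ε l v s out}) := by
    intro l v s
    by_cases hv : ∀ s, 0 ≤ v s ∧ v s ≤ M.horizon
    · obtain ⟨C, hC1, hC2⟩ :=
        (solvesIn_isCorrectMax s₀ j₀ M hε hεΓ hf hf1 l v hv s).exists_circuit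
      exact ⟨C, hC1, fun _ => hC2⟩
    -- Outside the promised range of `v` only the query bound matters, so any circuit of that length
    -- will do.
    · obtain ⟨C, hC1, -⟩ := (SolvesIn.pure (Q := OracleReg 𝒮 𝒜 J) (c := routineCost M ε f)
        (G := fun _ => Set.univ) (Classical.arbitrary 𝒜, (0 : ℝ)) hf.le
        fun _ => Set.mem_univ _).exists_circuit
      exact ⟨C, hC1, fun hv' => absurd hv' hv⟩
  choose R hR1 hR2 using h
  refine ⟨R, fun l v s => (hR1 l v s).le, fun p U hU l _ _ v hv s => (hR2 l v s hv U).trans ?_⟩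
  exact measure_mono fun out hout => hout p hU

end Routine

/-! ### Total query count -/

section Cost

variable {𝒮 𝒜 : Type} {M : RewardModel 𝒮 𝒜} {ε δ : ℝ}

theorem log_two_le_log_horizon (hε : 0 < ε) (hεΓ : ε ≤ M.horizon) :
    Real.log 2 ≤ Real.log (2 * M.horizon / ε) := by
  refine Real.log_le_log two_pos ?_
  rw [le_div_iff₀ hε]
  linarith

theorem numIter_le (hε : 0 < ε) (hεΓ : ε ≤ M.horizon) :
    (numIter M ε : ℝ) ≤ 7 * M.horizon * Real.log (2 * M.horizon / ε) := by
  have hΓ := one_le_horizon M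
  have hl := log_two_le_log_horizon hε hεΓ
  have h2 := Real.log_two_gt_d9
  have h2' := Real.log_two_lt_d9
  have h4 : Real.log (4 * M.horizon / ε) = Real.log 2 + Real.log (2 * M.horizon / ε) := by
    rw [← Real.log_mul two_ne_zero (by positivity)]
    congr 1
    ring
  have h5 : (⌈Real.log (4 * M.horizon / ε)⌉₊ : ℝ) < Real.log (4 * M.horizon / ε) + 1 :=
    Nat.ceil_lt_add_one (by rw [h4]; linarith)
  have h6 := Nat.ceil_lt_add_one (a := M.horizon * ⌈Real.log (4 * M.horizon / ε)⌉₊)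
    (by positivity)
  have h7 := mul_le_mul_of_nonneg_left h5.le (by linarith : 0 ≤ M.horizon)
  rw [h4] at h7
  rw [numIter]
  push_cast
  rw [h4] at *
  nlinarith

/-- The failure budget contributes `log L`, hence a term `log y ≤ y - 1` with `y = log (2Γ/ε)`.
Since `y` and the other logarithm are both at least `log 2`, their product dominates every summand;
the second factor `y` in the theorem arises here. -/
theorem logFactor_le {S A : ℕ} (hS : 0 < S) (hA : 0 < A) (hε : 0 < ε) (hεΓ : ε ≤ M.horizon)
    (hδ : 0 < δ) (hδ1 : δ < 1) :
    logFactor (δ / (numIter M ε * S)) ≤ 27 * (Real.log (2 * M.horizon / ε) *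
      Real.log (2 * S * A * M.horizon / δ)) := by
  have hΓ := one_le_horizon M
  have hl := log_two_le_log_horizon hε hεΓ
  have h2 := Real.log_two_gt_d9
  have hL := numIter_le hε hεΓ
  have hS1 : (1 : ℝ) ≤ S := by exact_mod_cast hS
  have hA1 : (1 : ℝ) ≤ A := by exact_mod_cast hA
  set y := Real.log (2 * M.horizon / ε) with hy
  have hy0 : 0 < y := by linarith
  have hΛ : Real.log (2 * S * A * M.horizon / δ) = Real.log 2 + Real.log A +
      Real.log (M.horizon * S / δ) := by
    rw [← Real.log_mul two_ne_zero (by positivity), ← Real.log_mul (by positivity) (by positivity)]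
    congr 1
    ring
  have hΛ1 : 0 ≤ Real.log (M.horizon * S / δ) := by
    refine Real.log_nonneg ?_
    rw [le_div_iff₀ hδ]
    nlinarith
  have hA2 := Real.log_nonneg hA1
  have hL0 : (0 : ℝ) < numIter M ε := by
    rw [numIter]
    positivity
  have h3 : -Real.log (δ / (numIter M ε * S)) ≤
      Real.log 7 + Real.log y + Real.log (M.horizon * S / δ) := by
    rw [← Real.log_inv, inv_div, ← Real.log_mul (by norm_num) hy0.ne',
      ← Real.log_mul (by positivity) (by positivity)]
    refine Real.log_le_log (by positivity) ?_
    calc numIter M ε * S / δ ≤ 7 * M.horizon * y * S / δ := by gcongr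
      _ = 7 * y * (M.horizon * S / δ) := by ring
  have h7 : Real.log 7 ≤ 2 := by
    rw [Real.log_le_iff_le_exp (by norm_num)]
    have h1 := Real.exp_one_gt_d9
    have : Real.exp 2 = Real.exp 1 * Real.exp 1 := by rw [← Real.exp_add]; norm_num
    rw [this]
    nlinarith
  have h8 := Real.log_le_sub_one_of_pos hy0
  unfold logFactor
  rw [hΛ]
  set z := Real.log (M.horizon * S / δ)
  set b := Real.log A
  -- As `0.69 < log 2`, both factors are nonnegative; expanding bounds linear terms by the product
  -- of the logarithms.
  have h9 : 0 ≤ (y - 0.69) * (z + (Real.log 2 - 0.69) + b) := by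
    refine mul_nonneg ?_ ?_ <;> linarith
  nlinarith

theorem one_div_two_mul_accuracy_div (hε : 0 < ε) :
    (2 * accuracy M ε / M.horizon)⁻¹ = 2 * M.horizon ^ 2 * ε⁻¹ := by
  have : 1 - M.γ ≠ 0 := by linarith [M.γ_lt_one]
  unfold accuracy RewardModel.horizon
  field_simp
  norm_num

theorem total_queries_le {S : ℕ} [Fintype 𝒜] [Nonempty 𝒜] (hS : 0 < S) (hε : 0 < ε)
    (hεΓ : ε ≤ M.horizon) (hδ : 0 < δ) (hδ1 : δ < 1) :
    ((numIter M ε * (S * (2 * ⌊routineCost M ε (δ / (numIter M ε * S))⌋₊)) : ℕ) : ℝ) ≤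
      21168000 * (S * Real.sqrt (Fintype.card 𝒜) * M.horizon ^ 3 * ε⁻¹ *
        Real.log (2 * M.horizon / ε) ^ 2 *
        Real.log (2 * S * Fintype.card 𝒜 * M.horizon / δ)) := by
  have hΓ := one_le_horizon M
  have h1 := numIter_le hε hεΓ
  have h2 := logFactor_le hS (Fintype.card_pos (α := 𝒜)) hε hεΓ hδ hδ1
  have hy0 : 0 ≤ Real.log (2 * M.horizon / ε) :=
    (Real.log_nonneg one_le_two).trans (log_two_le_log_horizon hε hεΓ)
  have hS1 : (1 : ℝ) ≤ S := by exact_mod_cast hS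
  have hL1 : (1 : ℝ) ≤ numIter M ε := by
    rw [numIter]
    push_cast
    linarith [Nat.cast_nonneg (α := ℝ) ⌈M.horizon * ⌈Real.log (4 * M.horizon / ε)⌉₊⌉₊]
  have hl := ten_le_logFactor (f := δ / (numIter M ε * S)) (by positivity)
    ((div_le_one (by positivity)).2 (by nlinarith))
  have hcost : routineCost M ε (δ / (numIter M ε * S)) = 56000 *
      (Real.sqrt (Fintype.card 𝒜) * M.horizon ^ 2 * ε⁻¹) * logFactor (δ / (numIter M ε * S)) := by
    rw [routineCost, div_eq_mul_inv, one_div_two_mul_accuracy_div hε]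
    ring
  have h3 := Nat.floor_le (a := routineCost M ε (δ / (numIter M ε * S))) (by
    rw [hcost]
    have : 0 ≤ logFactor (δ / (numIter M ε * S)) := by linarith
    positivity)
  rw [hcost] at h3 ⊢
  push_cast
  set y := Real.log (2 * M.horizon / ε)
  set Λ := Real.log (2 * S * Fintype.card 𝒜 * M.horizon / δ)
  calc (numIter M ε : ℝ) * (S * (2 * _))
      ≤ (7 * M.horizon * y) * (S * (2 * (56000 *
          (Real.sqrt (Fintype.card 𝒜) * M.horizon ^ 2 * ε⁻¹) * (27 * (y * Λ))))) := by
        gcongr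
        exact h3.trans (by gcongr)
    _ = _ := by ring

end Cost

end
end QMDP

theorem mainTheorem4 :
    ∃ C : ℝ, 0 < C ∧
      ∀ (𝒮 𝒜 J : Type) [Fintype 𝒮] [Fintype 𝒜] [Fintype J]
        [DecidableEq 𝒮] [DecidableEq 𝒜] [DecidableEq J] [Nonempty 𝒜]
        [MeasurableSpace 𝒮] [DiscreteMeasurableSpace 𝒮]
        (s₀ : 𝒮) (j₀ : J) (M : QMDP.RewardModel 𝒮 𝒜) (ε δ : ℝ),
        0 < ε → ε ≤ M.horizon → 0 < δ → δ < 1 →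
        ∃ R : QMDP.MaxRoutine 𝒮 𝒜 (QMDP.OracleReg 𝒮 𝒜 J),
          ∀ (p : 𝒮 → 𝒜 → PMF 𝒮) (U : Matrix.unitaryGroup (QMDP.OracleReg 𝒮 𝒜 J) ℂ),
            QMDP.IsGenerativeModel p s₀ j₀ U →
            R.Correct M p U ε (δ / (QMDP.numIter M ε * Fintype.card 𝒮)) ∧
            ∀ π₀ : 𝒮 → 𝒜,
              (∀ x ∈ (QMDP.solveMdp2 M R U ε π₀).support,
                (x.queries : ℝ) ≤
                  C * (Fintype.card 𝒮 * Real.sqrt (Fintype.card 𝒜) * M.horizon ^ 3 * ε⁻¹ *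
                    Real.log (2 * M.horizon / ε) ^ 2 *
                    Real.log (2 * Fintype.card 𝒮 * Fintype.card 𝒜 * M.horizon / δ))) ∧
              ENNReal.ofReal (1 - δ) ≤
                (QMDP.solveMdp2 M R U ε π₀).toOuterMeasure
                  {x | ∀ s, QMDP.optimalValue M p s - ε ≤ x.v s ∧
                    x.v s ≤ QMDP.value M p x.π s ∧
                    QMDP.value M p x.π s ≤ QMDP.optimalValue M p s} := by
  -- The product of `7` (iterations), `2` (queries per pair), `56000` (search) and `27` (log
  -- factor).
  refine ⟨21168000, by norm_num, ?_⟩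
  intro 𝒮 𝒜 J _ _ _ _ _ _ _ _ _ s₀ j₀ M ε δ hε hεΓ hδ hδ1
  have hS : 0 < Fintype.card 𝒮 := Fintype.card_pos_iff.2 ⟨s₀⟩
  have hS1 : (1 : ℝ) ≤ Fintype.card 𝒮 := by exact_mod_cast hS
  have hL1 : (1 : ℝ) ≤ QMDP.numIter M ε := by exact_mod_cast Nat.succ_pos _
  have hLS : QMDP.numIter M ε * (Fintype.card 𝒮 * (δ / (QMDP.numIter M ε * Fintype.card 𝒮))) = δ := by
    field_simp
  have hf : 0 < δ / (QMDP.numIter M ε * Fintype.card 𝒮) := by positivity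
  have hSf : Fintype.card 𝒮 * (δ / (QMDP.numIter M ε * Fintype.card 𝒮)) ≤ 1 := by
    have : 0 ≤ Fintype.card 𝒮 * (δ / (QMDP.numIter M ε * Fintype.card 𝒮)) := by positivity
    nlinarith
  have hf1 : δ / (QMDP.numIter M ε * Fintype.card 𝒮) ≤ 1 := by nlinarith
  obtain ⟨R, hR1, hR2⟩ := QMDP.exists_maxRoutine s₀ j₀ M hε hεΓ hf hf1
  refine ⟨R, fun p U hU => ⟨hR2 p U hU, fun π₀ => ⟨fun x hx => ?_, ?_⟩⟩⟩
  · exact (Nat.cast_le.2 (QMDP.queries_le_of_mem_support hR1 _ hx)).trans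
      (QMDP.total_queries_le hS hε hεΓ hδ hδ1)
  · have h := QMDP.le_toOuterMeasure_iterations (π₀ := π₀) (hR2 p U hU) hε hf.le hf1 hSf _ le_rfl
    rw [hLS] at h
    refine h.trans (measure_mono fun x hx s => ?_)
    have hx : QMDP.IsValueBound M p (QMDP.errorBound M ε (QMDP.numIter M ε)) x.v x.π := hx
    obtain ⟨h1, h2⟩ := hx.conclusion s
    exact ⟨by linarith [QMDP.errorBound_numIter M hε], h2⟩
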